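/- Let $\mathfrak g=\mathfrak g_{\bar0}\oplus\mathfrak g_{\bar1}$ be a complex Lie superalgebra that is either basic (finite-dimensional, simple and non-abelian, with $\mathfrak g_{\bar1}$ completely reducible over $\mathfrak g_{\bar0}$, admitting an even nondegenerate invariant bilinear form) or isomorphic to $\mathfrak{sl}(n,n)$ for some $n\ge2$. Fix a system of simple roots $\Sigma$ with Cartan subalgebra $\mathfrak h$ and triangular decomposition $\mathfrak g=\mathfrak n^-\oplus\mathfrak h\oplus\mathfrak n^+$, where $\mathfrak n^+$ is generated by the simple root vectors. For $\mathfrak{sl}(n,n)$ and $A(n-1,n-1)=\mathfrak{sl}(n,n)/\text{center}$, roots, and weights relative to a given highest weight, are taken with respect to the root lattice of $\mathfrak{gl}(n,n)$, so that the simple roots are linearly independent in all cases; put $Q^+=\sum_{\beta\in\Sigma}\mathbb N\beta$. Let $\Sigma(\mathfrak g_{\bar0})$ be the set of simple roots of $\mathfrak g_{\bar0}$ for the positive system of even positive roots, and for $\alpha\in\Sigma(\mathfrak g_{\bar0})$ let $(X_\alpha,Y_\alpha,H_\alpha)$ be an $\mathfrak{sl}(2)$-triple with $X_\alpha\in\mathfrak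 g_\alpha$, $Y_\alpha\in\mathfrak g_{-\alpha}$, $H_\alpha\in\mathfrak h$. Let $\Lambda^+$ be the set of $\lambda\in\mathfrak h^*$ such that the irreducible highest weight $\mathfrak g$-module of highest weight $\lambda$ is finite-dimensional. Let $A\neq0$ be an associative commutative unital $\mathbb C$-algebra, let $\mathfrak g\otimes A$ be the Lie superalgebra with bracket $[x\otimes a,y\otimes b]=[x,y]\otimes ab$, and identify $\mathfrak g$ with $\mathfrak g\otimes1$. Modules over Lie superalgebras are $\mathbb Z_2$-graded; homomorphisms and isomorphisms are homogeneous and may preserve or reverse parity. Let $\mathcal I(\mathfrak g\otimes A,\mathfrak g_{\bar0})$ be the category of $\mathfrak g\otimes A$-modules whose restriction to $\mathfrak g_{\bar0}$ is a direct sum of irreducible finite-dimensional $\mathfrak g_{\bar0}$-modules. A highest weight vector of weight $\lambda$ in a $\mathfrak g\otimes A$-module is a nonzero homogeneous vector $v$ with $(\mathfrak n^+\otimes A)v=0$ and $hv=\lambda(h)v$ for all $h\in\mathfrak h$. For $\lambda\in\Lambda^+$, let $\bar V(\lambda)$ be the $\mathfrak g$-module generated by a vector $v_\lambda$ with defining relations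 $$\mathfrak n^+v_\lambda=0,\qquad hv_\lambda=\lambda(h)v_\lambda\ (h\in\mathfrak h),\qquad Y_\alpha^{\lambda(H_\alpha)+1}v_\lambda=0\ (\alpha\in\Sigma(\mathfrak g_{\bar0})),$$ let $P_A(\bar V(\lambda))=U(\mathfrak g\otimes A)\otimes_{U(\mathfrak g)}\bar V(\lambda)$, and let the global Weyl module $W(\lambda)$ be the quotient of $P_A(\bar V(\lambda))$ by the submodule generated by all its weight spaces of weights $\mu\notin\lambda-Q^+$. **Proposition 3.5.** Let $\lambda\in\Lambda^+$. The module $W(\lambda)$ is an object of $\mathcal I(\mathfrak g\otimes A,\mathfrak g_{\bar0})$ that is generated by a highest weight vector of weight $\lambda$, and it admits a surjective homomorphism onto every object of $\mathcal I(\mathfrak g\otimes A,\mathfrak g_{\bar0})$ generated by a highest weight vector of weight $\lambda$. Moreover, every object of $\mathcal I(\mathfrak g\otimes A,\mathfrak g_{\bar0})$ with these two properties is isomorphic to $W(\lambda)$. -/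

import Mathlib

open scoped TensorProduct

noncomputable section

/-! ## Lie superalgebras over the complex numbers -/

/-- The sign `(-1)^{ij}` for parities `i`, `j`. -/
def koszulSign (i j : ZMod 2) : ℂ := (-1) ^ (i.val * j.val)

/-- A Lie superalgebra structure on a complex vector space `L = L₀ ⊕ L₁`. -/
class LieSuperalgebra (L : Type*) [AddCommGroup L] [Module ℂ L] where
  /-- the homogeneous components `L₀`, `L₁` -/
  part : ZMod 2 → Submodule ℂ L
  isCompl : IsCompl (part 0) (part 1)
  /-- the superbracket -/
  br : L →ₗ[ℂ] L →ₗ[ℂ] L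
  br_mem : ∀ (i j : ZMod 2) (x y : L), x ∈ part i → y ∈ part j → br x y ∈ part (i + j)
  br_skew : ∀ (i j : ZMod 2) (x y : L), x ∈ part i → y ∈ part j →
    br x y = -(koszulSign i j • br y x)
  br_jacobi : ∀ (i j k : ZMod 2) (x y z : L), x ∈ part i → y ∈ part j → z ∈ part k →
    br x (br y z) = br (br x y) z + koszulSign i j • br y (br x z)

namespace LieSuperalgebra

/-! ### The map superalgebra `g ⊗ A` -/

section MapAlgebra

variable {g : Type*} [AddCommGroup g] [Module ℂ g]
variable (A : Type*) [CommRing A] [Algebra ℂ A]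

/-- The subspace `N ⊗ A` of `g ⊗ A`, for a subspace `N` of `g`. -/
def tensorPart (N : Submodule ℂ g) : Submodule ℂ (g ⊗[ℂ] A) :=
  Submodule.span ℂ {t | ∃ x ∈ N, ∃ a : A, t = x ⊗ₜ[ℂ] a}

/-- The bilinear map `(x ⊗ a, y ⊗ b) ↦ [x, y] ⊗ ab`. -/
def mapBr [LieSuperalgebra g] : g ⊗[ℂ] A →ₗ[ℂ] g ⊗[ℂ] A →ₗ[ℂ] g ⊗[ℂ] A :=
  TensorProduct.map₂ (br (L := g)) (LinearMap.mul ℂ A)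

variable {A}

lemma mapBr_tmul [LieSuperalgebra g] (x y : g) (a b : A) :
    mapBr A (x ⊗ₜ[ℂ] a) (y ⊗ₜ[ℂ] b) = br x y ⊗ₜ[ℂ] (a * b) := rfl

lemma tmul_mem_tensorPart {N : Submodule ℂ g} {x : g} (hx : x ∈ N) (a : A) :
    x ⊗ₜ[ℂ] a ∈ tensorPart A N := Submodule.subset_span ⟨x, hx, a, rfl⟩

/-- A linear map that vanishes on the pure tensors `x ⊗ a`, `x ∈ N`, vanishes on `N ⊗ A`. -/
lemma eqOn_tensorPart {M : Type*} [AddCommGroup M] [Module ℂ M] {N : Submodule ℂ g}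
    (f f' : g ⊗[ℂ] A →ₗ[ℂ] M) (h : ∀ x ∈ N, ∀ a : A, f (x ⊗ₜ[ℂ] a) = f' (x ⊗ₜ[ℂ] a))
    {t : g ⊗[ℂ] A} (ht : t ∈ tensorPart A N) : f t = f' t := by
  have : Set.EqOn f f' (tensorPart A N : Set (g ⊗[ℂ] A)) := by
    apply LinearMap.eqOn_span
    rintro _ ⟨x, hx, a, rfl⟩
    exact h x hx a
  exact this ht

lemma isCompl_tensorPart {N N' : Submodule ℂ g} (h : IsCompl N N') :
    IsCompl (tensorPart A N) (tensorPart A N') := by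
  let p : g →ₗ[ℂ] g := N.subtype ∘ₗ N.projectionOnto N' h
  let P : g ⊗[ℂ] A →ₗ[ℂ] g ⊗[ℂ] A := TensorProduct.map p LinearMap.id
  have hp : ∀ x ∈ N, p x = x := fun x hx => by
    have := Submodule.projectionOnto_apply_left h ⟨x, hx⟩
    simp [p, this]
  have hp' : ∀ x ∈ N', p x = 0 := fun x hx => by
    have := Submodule.projectionOnto_apply_right h ⟨x, hx⟩
    simp only [p, LinearMap.comp_apply, Submodule.subtype_apply]
    rw [this]; rfl
  constructor
  · rw [Submodule.disjoint_def]
    intro t ht ht'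
    have h1 : P t = LinearMap.id (R := ℂ) t :=
      eqOn_tensorPart P LinearMap.id (fun x hx a => by simp [P, hp x hx]) ht
    have h2 : P t = (0 : g ⊗[ℂ] A →ₗ[ℂ] g ⊗[ℂ] A) t :=
      eqOn_tensorPart P 0 (fun x hx a => by simp [P, hp' x hx]) ht'
    rw [h2] at h1
    simpa using h1.symm
  · rw [codisjoint_iff, eq_top_iff]
    intro t _
    induction t using TensorProduct.induction_on with
    | zero => exact Submodule.zero_mem _
    | add u v hu hv => exact Submodule.add_mem _ (hu trivial) (hv trivial)
    | tmul x a =>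
      have hx : x ∈ N ⊔ N' := by rw [h.sup_eq_top]; trivial
      obtain ⟨y, hy, z, hz, rfl⟩ := Submodule.mem_sup.1 hx
      rw [TensorProduct.add_tmul]
      exact Submodule.add_mem_sup (tmul_mem_tensorPart hy a) (tmul_mem_tensorPart hz a)

/-- The map superalgebra `g ⊗ A`: grading `(g ⊗ A)ᵢ = gᵢ ⊗ A`, bracket
`[x ⊗ a, y ⊗ b] = [x, y] ⊗ ab`. -/
instance mapSuperalgebra [LieSuperalgebra g] : LieSuperalgebra (g ⊗[ℂ] A) where
  part i := tensorPart A (part (L := g) i)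
  isCompl := isCompl_tensorPart isCompl
  br := mapBr A
  br_mem := by
    intro i j s t hs ht
    induction hs using Submodule.span_induction with
    | zero => simp
    | add u v _ _ hu hv => rw [map_add, LinearMap.add_apply]; exact Submodule.add_mem _ hu hv
    | smul c u _ hu => rw [map_smul, LinearMap.smul_apply]; exact Submodule.smul_mem _ _ hu
    | mem u hu =>
      obtain ⟨x, hx, a, rfl⟩ := hu
      induction ht using Submodule.span_induction with
      | zero => simp
      | add u v _ _ hu hv => rw [map_add]; exact Submodule.add_mem _ hu hv
      | smul c u _ hu => rw [map_smul]; exact Submodule.smul_mem _ _ hu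
      | mem u hu =>
        obtain ⟨y, hy, b, rfl⟩ := hu
        rw [mapBr_tmul]
        exact tmul_mem_tensorPart (br_mem i j x y hx hy) _
  br_skew := by
    intro i j s t hs ht
    refine eqOn_tensorPart (mapBr A s) (-(koszulSign i j • (mapBr A).flip s)) ?_ ht
    intro y hy b
    refine eqOn_tensorPart ((mapBr A).flip (y ⊗ₜ b))
      (-(koszulSign i j • (mapBr A (y ⊗ₜ b)))) ?_ hs
    intro x hx a
    simp only [LinearMap.flip_apply, LinearMap.neg_apply, LinearMap.smul_apply, mapBr_tmul]
    rw [br_skew i j x y hx hy, TensorProduct.neg_tmul, TensorProduct.smul_tmul', mul_comm]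
  br_jacobi := by
    intro i j k s t r hs ht hr
    refine eqOn_tensorPart (mapBr A s ∘ₗ mapBr A t)
      (mapBr A (mapBr A s t) + koszulSign i j • (mapBr A t ∘ₗ mapBr A s)) ?_ hr
    intro z hz c
    refine eqOn_tensorPart (mapBr A s ∘ₗ (mapBr A).flip (z ⊗ₜ c))
      ((mapBr A).flip (z ⊗ₜ c) ∘ₗ mapBr A s +
        koszulSign i j • (mapBr A).flip (mapBr A s (z ⊗ₜ c))) ?_ ht
    intro y hy b
    refine eqOn_tensorPart ((mapBr A).flip (mapBr A (y ⊗ₜ b) (z ⊗ₜ c)))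
      ((mapBr A).flip (z ⊗ₜ c) ∘ₗ (mapBr A).flip (y ⊗ₜ b) +
        koszulSign i j • (mapBr A (y ⊗ₜ b) ∘ₗ (mapBr A).flip (z ⊗ₜ c))) ?_ hs
    intro x hx a
    simp only [LinearMap.flip_apply, LinearMap.add_apply, LinearMap.smul_apply,
      LinearMap.comp_apply, mapBr_tmul]
    rw [br_jacobi i j k x y z hx hy hz, TensorProduct.add_tmul, TensorProduct.smul_tmul',
      mul_assoc, mul_left_comm b a c]

end MapAlgebra

/-! ### Subalgebras, basic Lie superalgebras, and `sl(n,n)` -/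

section Basic

variable {L : Type*} [AddCommGroup L] [Module ℂ L] [LieSuperalgebra L]

/-- The subalgebra (as a subspace) generated by a set. -/
def generated (S : Set L) : Submodule ℂ L :=
  sInf {N | S ⊆ N ∧ ∀ x ∈ N, ∀ y ∈ N, br x y ∈ N}

variable (L)

/-- `L` is simple: the bracket is not zero and `L` has no graded ideal other than `0` and `L`. -/
def IsSimple : Prop :=
  (∃ x y : L, br x y ≠ 0) ∧
  ∀ N : Submodule ℂ L, N = (N ⊓ part 0) ⊔ (N ⊓ part 1) →
    (∀ x ∈ N, ∀ y, br x y ∈ N) → N = ⊥ ∨ N = ⊤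

/-- The `L₀`-module `L₁` is completely reducible. -/
def OddPartCompletelyReducible : Prop :=
  ∀ N : Submodule ℂ L, N ≤ part 1 → (∀ x ∈ part (L := L) 0, ∀ y ∈ N, br x y ∈ N) →
    ∃ N' : Submodule ℂ L, N' ≤ part 1 ∧ (∀ x ∈ part (L := L) 0, ∀ y ∈ N', br x y ∈ N') ∧
      N ⊓ N' = ⊥ ∧ N ⊔ N' = part 1

/-- Basic (classical) Lie superalgebras: finite-dimensional, simple, with `L₁` completely
reducible over `L₀`, admitting an even nondegenerate invariant bilinear form. -/
structure IsBasic : Prop where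
  finiteDimensional : FiniteDimensional ℂ L
  simple : IsSimple L
  classical : OddPartCompletelyReducible L
  form : ∃ B : L →ₗ[ℂ] L →ₗ[ℂ] ℂ,
    (∀ x ∈ part (L := L) 0, ∀ y ∈ part (L := L) 1, B x y = 0 ∧ B y x = 0) ∧
    (∀ x, (∀ y, B x y = 0) → x = 0) ∧ (∀ y, (∀ x, B x y = 0) → y = 0) ∧
    ∀ x y z, B (br x y) z = B x (br y z)

/-- `L` is isomorphic to `sl(n,n)`: the `(n|n)`-block matrices of supertrace zero, with
block-diagonal even part, block-off-diagonal odd part and the supercommutator as bracket. -/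
def IsSl (n : ℕ) : Prop :=
  ∃ φ : L →ₗ[ℂ] Matrix (Fin n ⊕ Fin n) (Fin n ⊕ Fin n) ℂ,
    Function.Injective φ ∧
    (∀ M, (∃ x, φ x = M) ↔ M.toBlocks₁₁.trace - M.toBlocks₂₂.trace = 0) ∧
    (∀ x ∈ part (L := L) 0, (φ x).toBlocks₁₂ = 0 ∧ (φ x).toBlocks₂₁ = 0) ∧
    (∀ x ∈ part (L := L) 1, (φ x).toBlocks₁₁ = 0 ∧ (φ x).toBlocks₂₂ = 0) ∧
    ∀ (i j : ZMod 2) (x y : L), x ∈ part i → y ∈ part j →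
      φ (br x y) = φ x * φ y - koszulSign i j • (φ y * φ x)

end Basic

/-! ### The universal enveloping superalgebra and its modules -/

section Enveloping

variable (L : Type*) [AddCommGroup L] [Module ℂ L] [LieSuperalgebra L]

/-- The relations `x y - (-1)^{|x||y|} y x = [x, y]` in the tensor algebra. -/
inductive EnvRel : TensorAlgebra ℂ L → TensorAlgebra ℂ L → Prop
  | mk (i j : ZMod 2) (x y : L) (hx : x ∈ part i) (hy : y ∈ part j) :
      EnvRel (TensorAlgebra.ι ℂ x * TensorAlgebra.ι ℂ y)
        (koszulSign i j • (TensorAlgebra.ι ℂ y * TensorAlgebra.ι ℂ x) +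
          TensorAlgebra.ι ℂ (br x y))

/-- The universal enveloping superalgebra `U(L)`. -/
def Env := RingQuot (EnvRel L)

instance : Ring (Env L) := inferInstanceAs (Ring (RingQuot (EnvRel L)))
instance : Algebra ℂ (Env L) := inferInstanceAs (Algebra ℂ (RingQuot (EnvRel L)))

/-- The canonical map `L → U(L)`. -/
def Env.ι : L →ₗ[ℂ] Env L :=
  (RingQuot.mkAlgHom ℂ (EnvRel L)).toLinearMap ∘ₗ TensorAlgebra.ι ℂ

variable {L}

/-- For a family of subspaces `γ q` of `L` indexed by a commutative monoid, the subspace of `U(L)`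
spanned by the products `x₁ ⋯ xₖ` with `xᵢ ∈ γ qᵢ` and `q₁ + ⋯ + qₖ = q`. -/
def Env.degPart {Γ : Type*} [AddCommMonoid Γ] (γ : Γ → Submodule ℂ L) (q : Γ) :
    Submodule ℂ (Env L) :=
  Submodule.span ℂ {u | ∃ l : List (Γ × L), (∀ p ∈ l, p.2 ∈ γ p.1) ∧
    (l.map Prod.fst).sum = q ∧ u = (l.map fun p => Env.ι L p.2).prod}

lemma Env.ι_mul_ι (i j : ZMod 2) (x y : L) (hx : x ∈ part i) (hy : y ∈ part j) :
    Env.ι L x * Env.ι L y = koszulSign i j • (Env.ι L y * Env.ι L x) + Env.ι L (br x y) := by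
  have := RingQuot.mkAlgHom_rel ℂ (EnvRel.mk i j x y hx hy)
  rw [map_mul, map_add, map_smul, map_mul] at this
  exact this

/-- The algebra homomorphism `U(g) → U(g ⊗ A)` induced by the inclusion `x ↦ x ⊗ 1`. -/
def Env.incl (g : Type*) [AddCommGroup g] [Module ℂ g] [LieSuperalgebra g]
    (A : Type*) [CommRing A] [Algebra ℂ A] : Env g →ₐ[ℂ] Env (g ⊗[ℂ] A) :=
  RingQuot.liftAlgHom ℂ
    ⟨TensorAlgebra.lift ℂ (Env.ι (g ⊗[ℂ] A) ∘ₗ (TensorProduct.mk ℂ g A).flip 1), by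
      rintro _ _ ⟨i, j, x, y, hx, hy⟩
      simp only [map_mul, map_add, map_smul, TensorAlgebra.lift_ι_apply, LinearMap.comp_apply,
        LinearMap.flip_apply, TensorProduct.mk_apply]
      rw [Env.ι_mul_ι i j (x ⊗ₜ[ℂ] (1 : A)) (y ⊗ₜ[ℂ] (1 : A)) (tmul_mem_tensorPart hx 1)
        (tmul_mem_tensorPart hy 1)]
      congr 2
      change mapBr A _ _ = _
      rw [mapBr_tmul, one_mul]⟩

section Module

variable {M : Type*} [AddCommGroup M] [Module ℂ M] [Module (Env L) M]

/-- `M = G 0 ⊕ G 1` is a `ℤ₂`-grading making the `U(L)`-module `M` an `L`-supermodule. -/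
structure IsSuperGrading (G : ZMod 2 → Submodule ℂ M) : Prop where
  isCompl : IsCompl (G 0) (G 1)
  smul_mem : ∀ (i j : ZMod 2) (x : L) (m : M), x ∈ part i → m ∈ G j → Env.ι L x • m ∈ G (i + j)

/-- The supermodule `M` is irreducible. -/
def IsIrreducible (G : ZMod 2 → Submodule ℂ M) : Prop :=
  Nontrivial M ∧ ∀ N : Submodule (Env L) M,
    (∀ m ∈ N, ∃ m₀ ∈ N, ∃ m₁ ∈ N, m₀ ∈ G 0 ∧ m₁ ∈ G 1 ∧ m = m₀ + m₁) → N = ⊥ ∨ N = ⊤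

variable [IsScalarTower ℂ (Env L) M]

/-- The subspace `P v` of `M`, for a subspace `P` of `U(L)` and a vector `v`. -/
def orbit (P : Submodule ℂ (Env L)) (v : M) : Submodule ℂ M :=
  P.map ((LinearMap.toSpanSingleton (Env L) M v).restrictScalars ℂ)

end Module

/-- A homomorphism of `U(L)`-modules is homogeneous if it preserves or reverses parity. (Twisting
by the parity operator identifies the parity-reversing `U(L)`-linear maps with the maps `f`
satisfying `f (x m) = (-1)^{|x|} x (f m)`, the odd homomorphisms in the other sign convention.) -/
def IsHomogeneousMap {M N : Type*} [AddCommGroup M] [Module ℂ M] [AddCommGroup N] [Module ℂ N]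
    (G : ZMod 2 → Submodule ℂ M) (G' : ZMod 2 → Submodule ℂ N) (f : M → N) : Prop :=
  ∃ d : ZMod 2, ∀ i, ∀ m ∈ G i, f m ∈ G' (i + d)

end Enveloping

/-! ### Simple root systems and triangular decompositions -/

/-- A system of simple roots `Σ = {β₁, …, βᵣ}` of `g` with its Cartan subalgebra `𝔥` and simple root
vectors `Xᵢ`, `Yᵢ`. The root lattice is the free abelian group `ℤ^r` on `Σ`, and `root q` is the
component of `g` of degree `q` in the root decomposition: `𝔥` for `q = 0`, the root space of
`∑ qᵢ βᵢ` for `q ≠ 0`.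

If the functionals `βᵢ` on `𝔥` are linearly independent, then `root` is just the decomposition of
`g` into weight spaces of `𝔥`. For `sl(n,n)` and `A(n-1,n-1) = sl(n,n)/center` the restrictions of the
roots of `gl(n,n)` to `𝔥` are linearly dependent, and `root` is the decomposition induced by the
root decomposition of `gl(n,n)`, whose simple roots are independent. -/
structure SimpleRoots (g : Type*) [AddCommGroup g] [Module ℂ g] [LieSuperalgebra g] where
  /-- the number of simple roots -/
  rank : ℕ
  /-- the root decomposition -/
  root : (Fin rank → ℤ) → Submodule ℂ g
  root_internal : DirectSum.IsInternal root
  root_br : ∀ q q' x y, x ∈ root q → y ∈ root q' → br x y ∈ root (q + q')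
  cartan_even : root 0 ≤ part 0
  cartan_abelian : ∀ x ∈ root 0, ∀ y ∈ root 0, br x y = 0
  /-- the simple roots as functionals on the Cartan subalgebra -/
  β : Fin rank → Module.Dual ℂ (root 0)
  /-- the parities of the simple roots -/
  parity : Fin rank → ZMod 2
  X : Fin rank → g
  Y : Fin rank → g
  X_ne_zero : ∀ i, X i ≠ 0
  Y_ne_zero : ∀ i, Y i ≠ 0
  X_mem : ∀ i, X i ∈ root (Pi.single i 1)
  Y_mem : ∀ i, Y i ∈ root (-Pi.single i 1)
  X_parity : ∀ i, X i ∈ part (parity i)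
  Y_parity : ∀ i, Y i ∈ part (parity i)
  br_cartan_X : ∀ i (h : root 0), br (h : g) (X i) = β i h • X i
  br_cartan_Y : ∀ i (h : root 0), br (h : g) (Y i) = -(β i h • Y i)
  br_X_Y : ∀ i j, i ≠ j → br (X i) (Y j) = 0
  generated_eq_top : generated (Set.range X ∪ Set.range Y ∪ (root 0 : Set g)) = ⊤

namespace SimpleRoots

variable {g : Type*} [AddCommGroup g] [Module ℂ g] [LieSuperalgebra g] (S : SimpleRoots g)

/-- The Cartan subalgebra `𝔥`. -/
abbrev cartan : Submodule ℂ g := S.root 0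

/-- `𝔫⁺`, the subalgebra generated by the simple root vectors `Xᵢ`. -/
def nPlus : Submodule ℂ g := generated (Set.range S.X)

/-- The positive even roots. -/
def posEvenRoots : Set (Fin S.rank → ℤ) := {q | 0 ≤ q ∧ q ≠ 0 ∧ S.root q ⊓ part 0 ≠ ⊥}

/-- `Σ(g₀)`: the simple roots of `g₀` with respect to the positive even roots. -/
def simpleEvenRoots : Set (Fin S.rank → ℤ) :=
  {q ∈ S.posEvenRoots | ∀ q₁ ∈ S.posEvenRoots, ∀ q₂ ∈ S.posEvenRoots, q ≠ q₁ + q₂}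

/-- `(e, f, h)` is an `sl(2)`-triple `(X_α, Y_α, H_α)` of the even root `α`. -/
structure IsTriple (α : Fin S.rank → ℤ) (e f : g) (h : S.cartan) : Prop where
  e_mem : e ∈ S.root α ⊓ part 0
  f_mem : f ∈ S.root (-α) ⊓ part 0
  e_ne_zero : e ≠ 0
  br_e_f : br e f = h
  br_h_e : br (h : g) e = (2 : ℂ) • e
  br_h_f : br (h : g) f = -((2 : ℂ) • f)

/-- `v` is a highest weight vector of weight `lam` in a `g`-module: `v ≠ 0`, `𝔫⁺ v = 0` and
`h v = lam(h) v` for `h ∈ 𝔥`. -/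
def IsHighestWeightVector {M : Type*} [AddCommGroup M] [Module ℂ M] [Module (Env g) M]
    (lam : Module.Dual ℂ S.cartan) (v : M) : Prop :=
  v ≠ 0 ∧ (∀ x ∈ S.nPlus, Env.ι g x • v = 0) ∧
    ∀ h : S.cartan, Env.ι g (h : g) • v = lam h • v

/-- `Λ⁺`: the weights `lam` for which the irreducible `g`-supermodule of highest weight `lam` is
finite-dimensional. -/
def dominantWeights : Set (Module.Dual ℂ S.cartan) :=
  {lam | ∃ (V : Type) (_ : AddCommGroup V) (_ : Module ℂ V) (_ : Module (Env g) V)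
      (_ : IsScalarTower ℂ (Env g) V) (G : ZMod 2 → Submodule ℂ V),
    FiniteDimensional ℂ V ∧ IsSuperGrading (L := g) G ∧ IsIrreducible (L := g) G ∧
      ∃ v : V, (∃ i, v ∈ G i) ∧ S.IsHighestWeightVector lam v}

/-! ### The modules `V̄(lam)`, `P_A(V)` and `W(lam)` -/

/-- The left ideal of `U(g)` generated by the defining relations of `V̄(lam)`:
`𝔫⁺`, `h - lam(h)` for `h ∈ 𝔥`, and `Y_α^{lam(H_α)+1}` for `α ∈ Σ(g₀)`. -/
def kacIdeal (lam : Module.Dual ℂ S.cartan) : Submodule (Env g) (Env g) :=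
  Submodule.span (Env g)
    ({u | ∃ x ∈ S.nPlus, u = Env.ι g x} ∪
     {u | ∃ h : S.cartan, u = Env.ι g (h : g) - algebraMap ℂ (Env g) (lam h)} ∪
     {u | ∃ α ∈ S.simpleEvenRoots, ∃ (e f : g) (h : S.cartan) (n : ℕ),
        S.IsTriple α e f h ∧ lam h = n ∧ u = Env.ι g f ^ (n + 1)})

/-- The generalized Kac module `V̄(lam)`. -/
abbrev Kac (lam : Module.Dual ℂ S.cartan) : Type _ := Env g ⧸ S.kacIdeal lam

/-- The generator `v_lam` of `V̄(lam)`. -/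
def kacVec (lam : Module.Dual ℂ S.cartan) : S.Kac lam := Submodule.Quotient.mk 1

end SimpleRoots

section Induced

variable (g : Type*) [AddCommGroup g] [Module ℂ g] [LieSuperalgebra g]
variable (A : Type*) [CommRing A] [Algebra ℂ A]
variable (V : Type*) [AddCommGroup V] [Module ℂ V] [Module (Env g) V]

/-- The relations `(u x) ⊗ v = u ⊗ (x v)`, `x ∈ U(g)`, in `U(g ⊗ A) ⊗_ℂ V`. -/
def inducedRel : Submodule (Env (g ⊗[ℂ] A)) (Env (g ⊗[ℂ] A) ⊗[ℂ] V) :=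
  Submodule.span _ {t | ∃ (u : Env (g ⊗[ℂ] A)) (x : Env g) (v : V),
    t = (u * Env.incl g A x) ⊗ₜ[ℂ] v - u ⊗ₜ[ℂ] (x • v)}

/-- `P_A(V) = U(g ⊗ A) ⊗_{U(g)} V`, as a left `U(g ⊗ A)`-module. -/
abbrev Induced : Type _ := (Env (g ⊗[ℂ] A) ⊗[ℂ] V) ⧸ inducedRel g A V

end Induced

namespace SimpleRoots

variable {g : Type*} [AddCommGroup g] [Module ℂ g] [LieSuperalgebra g] (S : SimpleRoots g)
variable (A : Type*) [CommRing A] [Algebra ℂ A]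

/-- The generator `1 ⊗ v_lam` of `P_A(V̄(lam))`. -/
def inducedVec (lam : Module.Dual ℂ S.cartan) : Induced g A (S.Kac lam) :=
  Submodule.Quotient.mk (1 ⊗ₜ[ℂ] S.kacVec lam)

/-- The weight space of `P_A(V̄(lam))` of weight `lam + q`, for `q` in the root lattice. The
generator has weight `lam` and `g_q ⊗ A` raises weights by `q`, so this is `U(g ⊗ A)_q v_lam`. -/
def inducedWeightSpace (lam : Module.Dual ℂ S.cartan) (q : Fin S.rank → ℤ) :
    Submodule ℂ (Induced g A (S.Kac lam)) :=
  orbit (Env.degPart (fun q' => tensorPart A (S.root q')) q) (S.inducedVec A lam)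

/-- The submodule of `P_A(V̄(lam))` generated by the weight spaces of the weights that do not lie
in `lam - Q⁺`. -/
def nonLowerSubmodule (lam : Module.Dual ℂ S.cartan) :
    Submodule (Env (g ⊗[ℂ] A)) (Induced g A (S.Kac lam)) :=
  Submodule.span _ {m | ∃ q : Fin S.rank → ℤ, ¬ q ≤ 0 ∧ m ∈ S.inducedWeightSpace A lam q}

/-- The global Weyl module `W(lam) = P_A(V̄(lam))^lam`: the largest quotient of `P_A(V̄(lam))` all of
whose weights lie in `lam - Q⁺`. -/
abbrev Weyl (lam : Module.Dual ℂ S.cartan) : Type _ :=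
  Induced g A (S.Kac lam) ⧸ S.nonLowerSubmodule A lam

/-- The generator `w_lam` of `W(lam)`. -/
def weylVec (lam : Module.Dual ℂ S.cartan) : S.Weyl A lam :=
  Submodule.Quotient.mk (S.inducedVec A lam)

/-- The `ℤ₂`-grading of `W(lam)` in which `w_lam` is even. -/
def weylGrading (lam : Module.Dual ℂ S.cartan) (i : ZMod 2) : Submodule ℂ (S.Weyl A lam) :=
  orbit (Env.degPart (part (L := g ⊗[ℂ] A)) i) (S.weylVec A lam)

/-! ### The category `I(g ⊗ A, g₀)` and highest weight objects -/

variable {A}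
variable {M : Type*} [AddCommGroup M] [Module ℂ M] [Module (Env (g ⊗[ℂ] A)) M]

/-- `v` is a highest weight vector of weight `lam` in a `g ⊗ A`-module: `v ≠ 0`,
`(𝔫⁺ ⊗ A) v = 0` and `h v = lam(h) v` for `h ∈ 𝔥`. -/
def IsMapHighestWeightVector (lam : Module.Dual ℂ S.cartan) (v : M) : Prop :=
  v ≠ 0 ∧ (∀ x ∈ S.nPlus, ∀ a : A, Env.ι (g ⊗[ℂ] A) (x ⊗ₜ a) • v = 0) ∧
    ∀ h : S.cartan, Env.ι (g ⊗[ℂ] A) ((h : g) ⊗ₜ 1) • v = lam h • v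

end SimpleRoots

section Category

variable (g : Type*) [AddCommGroup g] [Module ℂ g] [LieSuperalgebra g]
variable (A : Type*) [CommRing A] [Algebra ℂ A]

/-- A subspace stable under `g₀`. -/
def IsEvenStable {M : Type*} [AddCommGroup M] [Module ℂ M] [Module (Env (g ⊗[ℂ] A)) M]
    (N : Submodule ℂ M) : Prop :=
  ∀ x ∈ part (L := g) 0, ∀ m ∈ N, Env.ι (g ⊗[ℂ] A) (x ⊗ₜ 1) • m ∈ N

/-- The restriction of `M` to `g₀` is a direct sum of irreducible finite-dimensional modules. -/
def IsEvenIntegrable (M : Type*) [AddCommGroup M] [Module ℂ M] [Module (Env (g ⊗[ℂ] A)) M] :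
    Prop :=
  ∃ F : Set (Submodule ℂ M),
    (∀ N ∈ F, FiniteDimensional ℂ N ∧ IsEvenStable g A N ∧ N ≠ ⊥ ∧
      ∀ N' ≤ N, IsEvenStable g A N' → N' = ⊥ ∨ N' = N) ∧
    sSupIndep F ∧ sSup F = ⊤

end Category

/-- The supermodule `M` (with `ℤ₂`-grading `G`) is an object of `I(g ⊗ A, g₀)` generated by a
(homogeneous) highest weight vector of weight `lam`. -/
structure IsHighestWeightObject {g : Type*} [AddCommGroup g] [Module ℂ g] [LieSuperalgebra g]
    (S : SimpleRoots g) {A : Type*} [CommRing A] [Algebra ℂ A] (lam : Module.Dual ℂ S.cartan)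
    {M : Type*} [AddCommGroup M] [Module ℂ M] [Module (Env (g ⊗[ℂ] A)) M]
    (G : ZMod 2 → Submodule ℂ M) : Prop where
  grading : IsSuperGrading (L := g ⊗[ℂ] A) G
  integrable : IsEvenIntegrable g A M
  generated : ∃ v : M, (∃ i, v ∈ G i) ∧ S.IsMapHighestWeightVector (A := A) lam v ∧
    Submodule.span (Env (g ⊗[ℂ] A)) {v} = ⊤

end LieSuperalgebra

end

universe u v w

open LieSuperalgebra

/-! A homomorphism out of W(λ) is the same thing as a vector satisfying its relations
(`exists_weyl_lift`). For a vector killed by 𝔫⁺ ⊗ A, straightening shows that the module it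
generates is spanned by vectors obtained with factors of degree ≤ 0 (`IsLower.smul_mem_span`), so no
weight outside λ − Q⁺ occurs. In an integrable module sl₂-theory adds the relations for Y_α
(`IsExtremal.pow_smul_eq_zero`). Hence W(λ) maps onto every highest weight object.

Three things put W(λ) itself into the category. Its generator is not zero: V(λ) ⊗ A, with x ⊗ a
acting on u ⊗ b as xu ⊗ ab, contains v ⊗ 1, which satisfies the relations (`weylVec_ne_zero`). It is
ℤ₂-graded: the parity automorphism of g ⊗ A induces an operator on W(λ) whose eigenspaces for 1 and
−1 separate the two parts (`isSuperGrading_weylGrading`). And it is integrable, which is the longest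
part. Here g₀ is shown to be reductive with center inside 𝔥 (`isReductiveGrading_of`), from a
faithful semisimple representation: the odd part or the adjoint module for basic g, the natural
module for sl(n,n). Elements that act locally nilpotently span a subalgebra
(`lie_mem_span_locallyNilpotentSet`), so local nilpotency passes from the simple even root vectors
to all root vectors. Then g₀ has a basis of locally finite elements, every vector lies in a
finite-dimensional g₀-submodule (`exists_finiteDimensional_lieSubmodule`), and Weyl's theorem for
[g₀, g₀], together with diagonalizability of the center, gives semisimplicity (`sSup_atoms_eq_top`).

For uniqueness, another object W with the universal property and W(λ) map onto each other, so it
suffices that a surjective endomorphism φ of W(λ) is injective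
(`injective_of_surjective_endomorphism`). No finiteness of A is available; the substitute is that a
surjective endomorphism of a cyclic module over a commutative ring is bijective. The height-zero
part of W(λ) is cyclic over the commutative algebra generated by 𝔥 ⊗ A. The image φ(w) of the
generator may have components of several heights, because the simple roots can be dependent on 𝔥 and
an 𝔥-weight does not determine a degree. All heights are ≤ 0, so φ is triangular for the height
grading. Its diagonal term is an endomorphism inverted by the commutative argument, and injectivity
of φ follows by descending through the heights. -/

section

open Module

namespace LieAlgebra

/-! ### Casimir elements of semisimple Lie algebras. -/

section Casimir

variable {K L V : Type*} [Field K] [CharZero K] [LieRing L] [LieAlgebra K L] [FiniteDimensional K L]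
  [IsKilling K L] [AddCommGroup V] [Module K V] [LieRingModule L V] [LieModule K L V]
  [FiniteDimensional K V]

open scoped TensorProduct

variable (K L) in
omit [CharZero K] in
/-- A Lie algebra with nondegenerate Killing form is perfect. -/
theorem IsKilling.lie_top_top : ⁅(⊤ : LieIdeal K L), (⊤ : LieIdeal K L)⁆ = ⊤ := by
  set D : LieIdeal K L := ⁅(⊤ : LieIdeal K L), (⊤ : LieIdeal K L)⁆
  -- Brackets of elements of the complementary ideal lie in it and in `D`, so that ideal is abelian.
  have hc : Dᶜ = ⊥ := by
    apply (hasTrivialRadical_iff_no_abelian_ideals K L).1 inferInstance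
    refine ⟨fun x y => ?_⟩
    have h1 : ⁅(x : L), (y : L)⁆ ∈ D := LieSubmodule.lie_mem_lie trivial trivial
    have h2 : ⁅(x : L), (y : L)⁆ ∈ Dᶜ := lie_mem_right K L _ _ _ y.2
    have h3 : ⁅(x : L), (y : L)⁆ ∈ D ⊓ Dᶜ := ⟨h1, h2⟩
    rw [inf_compl_eq_bot, LieSubmodule.mem_bot] at h3
    exact Subtype.ext h3
  rw [← compl_compl D, hc, compl_bot]

variable (K L V) in
/-- The kernel of the trace form of an irreducible module of a semisimple Lie algebra acts
trivially. -/
theorem IsKilling.lie_eq_zero_of_mem_ker_traceForm [LieModule.IsIrreducible K L V] {x : L}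
    (hx : ∀ y, LieModule.traceForm K L V x y = 0) (v : V) : ⁅x, v⁆ = 0 := by
  let I : LieIdeal K L :=
    { LinearMap.ker (LieModule.traceForm K L V) with
      lie_mem := by
        intro y x hx
        simp only [AddSubsemigroup.mem_carrier, AddSubmonoid.mem_toSubsemigroup,
          Submodule.mem_toAddSubmonoid, LinearMap.mem_ker] at hx ⊢
        ext z
        rw [← lie_skew, map_neg, LinearMap.neg_apply, LieModule.traceForm_apply_lie_apply, hx]
        simp }
  let N : LieIdeal K L := LieModule.ker K L V
  -- Cut down by the complement of the annihilator `N`. Since the trace form vanishes on `J`, its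
  -- derived algebra acts nilpotently; the invariants of that algebra form a nonzero submodule,
  -- hence all of `V`. So `⁅J, J⁆` lies in `N` and in its complement, and `J` is an abelian ideal.
  let J : LieIdeal K L := I ⊓ Nᶜ
  have hJ : LieModule.IsNilpotent (derivedSeries K J 1) V := by
    apply LieModule.isNilpotent_derivedSeries_of_traceForm_eq_zero
    ext a b
    have : LieModule.traceForm K L V a = 0 := a.2.1
    exact LinearMap.congr_fun this b
  let D : LieIdeal K L := ⁅J, J⁆
  have hD : ∀ a ∈ D, a ∈ N := by
    have hnil : LieModule.IsNilpotent D V := by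
      rw [LieModule.isNilpotent_iff_forall' (R := K)] at hJ ⊢
      rintro ⟨a, ha⟩
      have haJ : a ∈ J := LieSubmodule.lie_le_left J J ha
      refine hJ ⟨⟨a, haJ⟩, ?_⟩
      rwa [LieIdeal.derivedSeries_eq_derivedSeriesOfIdeal_comap, LieIdeal.mem_comap]
    have : Nontrivial V := LieModule.nontrivial_of_isIrreducible K L V
    let T : LieSubmodule K L V :=
      { LieModule.maxTrivSubmodule K D V with
        lie_mem := by
          intro y m hm
          simp only [AddSubsemigroup.mem_carrier, AddSubmonoid.mem_toSubsemigroup,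
            Submodule.mem_toAddSubmonoid, LieSubmodule.mem_toSubmodule,
            LieModule.mem_maxTrivSubmodule] at hm ⊢
          rintro ⟨a, ha⟩
          change ⁅a, ⁅y, m⁆⁆ = 0
          have h1 : ⁅a, m⁆ = 0 := hm ⟨a, ha⟩
          have h2 : ⁅⁅a, y⁆, m⁆ = 0 := hm ⟨⁅a, y⁆, lie_mem_left K L D a y ha⟩
          rw [leibniz_lie, h1, h2]; simp }
    have hTn : Nontrivial T := LieModule.nontrivial_max_triv_of_isNilpotent K D V
    have hT : T = ⊤ := LieSubmodule.eq_top_of_isIrreducible K L V T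
    intro a ha
    rw [LieModule.mem_ker]
    intro m
    have : m ∈ T := hT ▸ LieSubmodule.mem_top m
    exact this ⟨a, ha⟩
  have hJ0 : J = ⊥ := by
    apply (hasTrivialRadical_iff_no_abelian_ideals K L).1 inferInstance
    refine ⟨fun x y => ?_⟩
    have h1 : ⁅(x : L), (y : L)⁆ ∈ D := LieSubmodule.lie_mem_lie x.2 y.2
    have h2 : ⁅(x : L), (y : L)⁆ ∈ Nᶜ := lie_mem_right K L _ _ _ y.2.2
    have h3 : ⁅(x : L), (y : L)⁆ ∈ N ⊓ Nᶜ := ⟨hD _ h1, h2⟩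
    rw [inf_compl_eq_bot, LieSubmodule.mem_bot] at h3
    exact Subtype.ext h3
  have hIN : I ≤ N := by
    rw [← compl_compl N, le_compl_iff_disjoint_right]
    exact disjoint_iff.2 hJ0
  exact (LieModule.mem_ker K L V x).1 (hIN (LinearMap.ext hx)) v

variable (K L V) in
/-- Families `x`, `y` such that `∑ xᵢ ⊗ yᵢ` is invariant and `∑ xᵢ yᵢ` has nonzero trace on a given
nontrivial irreducible module. -/
theorem IsKilling.exists_casimir [LieModule.IsIrreducible K L V] (hV : ∃ (x : L) (v : V), ⁅x, v⁆ ≠ 0) :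
    ∃ (n : ℕ) (x y : Fin n → L),
      (∀ z : L, ∑ i, (⁅z, x i⁆ ⊗ₜ[K] y i + x i ⊗ₜ[K] ⁅z, y i⁆) = 0) ∧
      LinearMap.trace K V (∑ i, LieModule.toEnd K L V (x i) ∘ₗ LieModule.toEnd K L V (y i)) ≠ 0 := by
  classical
  let N : LieIdeal K L := LieModule.ker K L V
  let I : LieIdeal K L := Nᶜ
  -- On an ideal complementary to the kernel of the action the trace form is nondegenerate; the
  -- families `x` and `y` will be dual bases for it.
  let B : LinearMap.BilinForm K I := (LieModule.traceForm K L V).restrict I.toSubmodule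
  have hB : B.Nondegenerate := by
    have hsymm : B.IsSymm := ⟨fun a b => LieModule.traceForm_comm K L V a b⟩
    refine hsymm.isRefl.nondegenerate_iff_separatingLeft.2 ?_
    intro a ha
    have h1 : ∀ y, LieModule.traceForm K L V a y = 0 := by
      intro y
      have hy : y ∈ N ⊔ I := by rw [sup_compl_eq_top]; trivial
      obtain ⟨b, hb, c, hc, rfl⟩ := (LieSubmodule.mem_sup _ _ _).1 hy
      have h2 : LieModule.toEnd K L V b = 0 := by
        ext v; exact (LieModule.mem_ker K L V b).1 hb v
      rw [map_add, LieModule.traceForm_apply_apply, h2, LinearMap.comp_zero, map_zero, zero_add]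
      exact ha ⟨c, hc⟩
    have h2 : (a : L) ∈ N := (LieModule.mem_ker K L V _).2
      (IsKilling.lie_eq_zero_of_mem_ker_traceForm K L V h1)
    have h3 : (a : L) ∈ N ⊓ I := ⟨h2, a.2⟩
    rw [inf_compl_eq_bot, LieSubmodule.mem_bot] at h3
    exact Subtype.ext h3
  let b := Module.finBasis K I
  let d := B.dualBasis hB b
  have hd : ∀ i j, B (d i) (b j) = if j = i then 1 else 0 := fun i j =>
    LinearMap.BilinForm.apply_dualBasis_left hB b i j
  have hsymm : ∀ a c, B a c = B c a := fun a c => LieModule.traceForm_comm K L V a c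
  have hb' : ∀ a : I, a = ∑ j, B (d j) a • b j := by
    intro a
    conv_lhs => rw [← b.sum_repr a]
    refine Finset.sum_congr rfl fun j _ => ?_
    congr 1
    conv_rhs => rw [← b.sum_repr a]
    rw [map_sum, Finset.sum_eq_single j]
    · rw [map_smul, hd, if_pos rfl, smul_eq_mul, mul_one]
    · intro i _ hij
      rw [map_smul, hd, if_neg hij, smul_zero]
    · simp
  have hd' : ∀ a : I, a = ∑ j, B a (b j) • d j := by
    intro a
    conv_lhs => rw [← d.sum_repr a]
    refine Finset.sum_congr rfl fun j _ => ?_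
    rw [LinearMap.BilinForm.dualBasis_repr_apply]
  refine ⟨_, fun i => (b i : L), fun i => (d i : L), fun z => ?_, ?_⟩
  -- By invariance of the form, the matrices of `ad z` in the two dual bases are negative transposes
  -- of each other, so the double sums cancel termwise.
  · have hinv : ∀ a c : I, B ⁅z, a⁆ c + B a ⁅z, c⁆ = 0 := by
      intro a c
      change LieModule.traceForm K L V ⁅z, (a : L)⁆ c + LieModule.traceForm K L V a ⁅z, (c : L)⁆ = 0
      rw [← lie_skew, map_neg, LinearMap.neg_apply, LieModule.traceForm_apply_lie_apply]
      simp
    have e1 : ∀ i, ⁅z, (b i : L)⁆ = ∑ j, B (d j) ⁅z, b i⁆ • (b j : L) := fun i => by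
      have := congrArg (Subtype.val) (hb' ⁅z, b i⁆)
      simpa using this
    have e2 : ∀ i, ⁅z, (d i : L)⁆ = ∑ j, B ⁅z, d i⁆ (b j) • (d j : L) := fun i => by
      have := congrArg (Subtype.val) (hd' ⁅z, d i⁆)
      simpa using this
    rw [Finset.sum_add_distrib]
    simp_rw [e1, e2, TensorProduct.sum_tmul, TensorProduct.tmul_sum, TensorProduct.tmul_smul,
      TensorProduct.smul_tmul']
    rw [Finset.sum_comm, ← Finset.sum_add_distrib]
    refine Finset.sum_eq_zero fun i _ => ?_
    rw [← Finset.sum_add_distrib]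
    refine Finset.sum_eq_zero fun j _ => ?_
    rw [← TensorProduct.smul_tmul', ← TensorProduct.smul_tmul', ← add_smul]
    have := hinv (d i) (b j)
    rw [add_comm, this, zero_smul]
  -- Each summand has trace 1 by duality of the bases, so the total trace is the dimension of `I`,
  -- which is not zero because the action is not trivial.
  · have : ∀ i, LinearMap.trace K V
        (LieModule.toEnd K L V (b i) ∘ₗ LieModule.toEnd K L V (d i)) = 1 := by
      intro i
      have := hd i i
      rw [hsymm, if_pos rfl] at this
      rw [← this]
      exact (LieModule.traceForm_apply_apply K L V _ _).symm
    rw [map_sum, Finset.sum_congr rfl fun i _ => this i]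
    simp only [Finset.sum_const, Finset.card_univ, Fintype.card_fin, nsmul_eq_mul, mul_one, ne_eq,
      Nat.cast_eq_zero]
    intro h0
    have hI : ∀ a ∈ I, a = 0 := by
      have := finrank_zero_iff.1 h0
      intro a ha
      exact congrArg Subtype.val (Subsingleton.elim (⟨a, ha⟩ : I) 0)
    obtain ⟨x, v, hxv⟩ := hV
    apply hxv
    have hx : x ∈ N ⊔ I := by rw [sup_compl_eq_top]; trivial
    obtain ⟨p, hp, c, hc, rfl⟩ := (LieSubmodule.mem_sup _ _ _).1 hx
    rw [hI c hc, add_zero]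
    exact (LieModule.mem_ker K L V p).1 hp v

end Casimir

/-! ### Complete reducibility of finite-dimensional modules. -/

section Weyl

variable {K L : Type*} [Field K] [CharZero K] [IsAlgClosed K] [LieRing L] [LieAlgebra K L]
  [FiniteDimensional K L] [IsKilling K L]

open scoped TensorProduct

universe uV

omit [CharZero K] [FiniteDimensional K L] [IsKilling K L] in
/-- A central operator acts on an irreducible module by a scalar. -/
theorem _root_.LieModule.exists_eq_smul_of_commute {V : Type*} [AddCommGroup V] [Module K V]
    [LieRingModule L V] [LieModule K L V] [FiniteDimensional K V] [LieModule.IsIrreducible K L V]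
    (c : Module.End K V) (hc : ∀ (x : L) (v : V), c ⁅x, v⁆ = ⁅x, c v⁆) : ∃ s : K, ∀ v, c v = s • v := by
  have : Nontrivial V := LieModule.nontrivial_of_isIrreducible K L V
  obtain ⟨s, hs⟩ := Module.End.exists_eigenvalue c
  let E : LieSubmodule K L V :=
    { Module.End.eigenspace c s with
      lie_mem := by
        intro x m hm
        simp only [AddSubsemigroup.mem_carrier, AddSubmonoid.mem_toSubsemigroup,
          Submodule.mem_toAddSubmonoid, Module.End.mem_eigenspace_iff] at hm ⊢
        rw [hc, hm, lie_smul] }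
  obtain ⟨v, hv, hv0⟩ := hs.exists_hasEigenvector
  have : Nontrivial E := ⟨⟨⟨v, hv⟩, 0, fun h => hv0 (congrArg Subtype.val h)⟩⟩
  have hE : E = ⊤ := LieSubmodule.eq_top_of_isIrreducible K L V E
  refine ⟨s, fun w => ?_⟩
  have : w ∈ E := hE ▸ LieSubmodule.mem_top w
  exact Module.End.mem_eigenspace_iff.1 this

/-- The heart of Weyl's theorem, by induction on the dimension. A proper nonzero submodule of `W` is
divided out and then reinstated; if `W` is irreducible and not trivial, a Casimir operator splits it
off; if `W` is trivial, perfectness of `L` makes all of `V` trivial. -/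
theorem IsKilling.exists_lie_eq_zero_of_finrank (n : ℕ) : ∀ (V : Type uV) [AddCommGroup V] [Module K V]
    [LieRingModule L V] [LieModule K L V] [FiniteDimensional K V] (_ : finrank K V ≤ n)
    (W : LieSubmodule K L V) (_ : ∀ (x : L) (v : V), ⁅x, v⁆ ∈ W) (_ : W ≠ ⊤),
    ∃ v ∉ W, ∀ x : L, ⁅x, v⁆ = 0 := by
  induction n with
  | zero =>
    intro V _ _ _ _ _ hn W _ hW
    have : Subsingleton V := finrank_zero_iff.1 (Nat.le_zero.1 hn)
    exact absurd (Subsingleton.elim _ _) hW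
  | succ n ih =>
    intro V _ _ _ _ _ hn W hLW hW
    obtain ⟨v₀, -, hv₀⟩ := SetLike.exists_of_lt (lt_top_iff_ne_top.2 hW)
    by_cases hbot : W = ⊥
    · refine ⟨v₀, hv₀, fun x => ?_⟩
      have := hLW x v₀
      rwa [hbot, LieSubmodule.mem_bot] at this
    by_cases hirr : ∃ W' : LieSubmodule K L V, W' ≠ ⊥ ∧ W' < W
    · obtain ⟨W', hW'0, hW'W⟩ := hirr
      have hfin : finrank K (V ⧸ W') ≤ n := by
        have h1 := Submodule.finrank_quotient_add_finrank W'.toSubmodule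
        have h2 : 0 < finrank K W'.toSubmodule := by
          rw [Nat.pos_iff_ne_zero, ne_eq, Submodule.finrank_eq_zero]
          simpa using hW'0
        have h3 : finrank K (V ⧸ W') = finrank K (V ⧸ W'.toSubmodule) := rfl
        omega
      let W₁ : LieSubmodule K L (V ⧸ W') := W.map (LieSubmodule.Quotient.mk' W')
      have hmem : ∀ v : V, LieSubmodule.Quotient.mk' W' v ∈ W₁ ↔ v ∈ W := by
        intro v
        constructor
        · intro h
          obtain ⟨w, hw, hwv⟩ := (LieSubmodule.mem_map _).1 h
          have : w - v ∈ W' := by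
            rw [← LieSubmodule.Quotient.mk_eq_zero, map_sub, hwv, sub_self]
          have h2 : w - (w - v) ∈ W := sub_mem hw (hW'W.le this)
          simpa using h2
        · exact fun h => (LieSubmodule.mem_map _).2 ⟨v, h, rfl⟩
      obtain ⟨q, hq, hq0⟩ := ih (V ⧸ W') hfin W₁ (by
        intro x q
        obtain ⟨v, rfl⟩ := LieSubmodule.Quotient.surjective_mk' W' q
        rw [← LieModuleHom.map_lie, hmem]
        exact hLW x v) (by
        intro h
        apply hv₀
        rw [← hmem, h]
        trivial)
      obtain ⟨v, rfl⟩ := LieSubmodule.Quotient.surjective_mk' W' q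
      rw [hmem] at hq
      have hxv : ∀ x : L, ⁅x, v⁆ ∈ W' := by
        intro x
        have := hq0 x
        rwa [← LieModuleHom.map_lie, LieSubmodule.Quotient.mk_eq_zero] at this
      -- The vector found modulo `W'` is invariant only up to `W'`; a second use of the induction
      -- hypothesis, on `W' + K v`, corrects it.
      let V₁ : LieSubmodule K L V :=
        { W'.toSubmodule ⊔ Submodule.span K {v} with
          lie_mem := by
            intro x m hm
            simp only [AddSubsemigroup.mem_carrier, AddSubmonoid.mem_toSubsemigroup,
              Submodule.mem_toAddSubmonoid] at hm ⊢
            obtain ⟨w, hw, u, hu, rfl⟩ := Submodule.mem_sup.1 hm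
            obtain ⟨c, rfl⟩ := Submodule.mem_span_singleton.1 hu
            rw [lie_add, lie_smul]
            exact Submodule.mem_sup_left (add_mem (W'.lie_mem hw) (Submodule.smul_mem _ _ (hxv x))) }
      have hV₁ : ∀ m ∈ V₁, ∃ w ∈ W', ∃ c : K, m = w + c • v := by
        intro m hm
        obtain ⟨w, hw, u, hu, rfl⟩ := Submodule.mem_sup.1 hm
        obtain ⟨c, rfl⟩ := Submodule.mem_span_singleton.1 hu
        exact ⟨w, hw, c, rfl⟩
      have hvV₁ : v ∈ V₁ := Submodule.mem_sup_right (Submodule.mem_span_singleton_self v)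
      have hfin₁ : finrank K V₁ ≤ n := by
        have hlt : V₁ < ⊤ := by
          rw [lt_top_iff_ne_top]
          intro htop
          obtain ⟨w, hw, hwW'⟩ := SetLike.exists_of_lt hW'W
          obtain ⟨w', hw', c, hc⟩ := hV₁ w (htop ▸ LieSubmodule.mem_top w)
          have hcv : c • v ∈ W := by
            have : c • v = w - w' := by rw [hc]; abel
            rw [this]; exact sub_mem hw (hW'W.le hw')
          by_cases hc0 : c = 0
          · apply hwW'; rw [hc, hc0]; simpa using hw'
          · apply hq
            have := W.smul_mem c⁻¹ hcv
            rwa [smul_smul, inv_mul_cancel₀ hc0, one_smul] at this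
        have h1 : finrank K V₁.toSubmodule < finrank K V := Submodule.finrank_lt (by
          intro h
          apply hlt.ne
          rwa [← LieSubmodule.toSubmodule_eq_top])
        have h3 : finrank K V₁ = finrank K V₁.toSubmodule := rfl
        omega
      obtain ⟨⟨m, hm⟩, hmW, hm0⟩ := ih V₁ hfin₁ (W'.comap V₁.incl) (by
        rintro x ⟨m, hm⟩
        obtain ⟨w, hw, c, rfl⟩ := hV₁ m hm
        rw [LieSubmodule.mem_comap]
        change ⁅x, w + c • v⁆ ∈ W'
        rw [lie_add, lie_smul]
        exact add_mem (W'.lie_mem hw) (W'.smul_mem _ (hxv x))) (by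
        intro h
        apply hq
        have : (⟨v, hvV₁⟩ : V₁) ∈ W'.comap V₁.incl := h ▸ LieSubmodule.mem_top _
        exact hW'W.le this)
      refine ⟨m, ?_, fun x => congrArg Subtype.val (hm0 x)⟩
      intro hmW2
      apply hmW
      rw [LieSubmodule.mem_comap]
      change m ∈ W'
      obtain ⟨w, hw, c, rfl⟩ := hV₁ m hm
      by_cases hc0 : c = 0
      · rw [hc0]; simpa using hw
      · exfalso
        apply hq
        have h1 : c • v ∈ W := by
          have : c • v = (w + c • v) - w := by abel
          rw [this]; exact sub_mem hmW2 (hW'W.le hw)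
        have := W.smul_mem c⁻¹ h1
        rwa [smul_smul, inv_mul_cancel₀ hc0, one_smul] at this
    · push Not at hirr
      have hW_irr : LieModule.IsIrreducible K L W := by
        have hnt : Nontrivial (LieSubmodule K L W) := by
          rw [LieSubmodule.nontrivial_iff]
          obtain ⟨w, hw, hw0⟩ := W.toSubmodule.ne_bot_iff.1 (by simpa using hbot)
          exact ⟨⟨⟨w, hw⟩, 0, fun h => hw0 (congrArg Subtype.val h)⟩⟩
        refine ⟨fun N => ?_⟩
        by_cases hN : N.map W.incl = ⊥
        · left
          rw [LieSubmodule.eq_bot_iff]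
          intro w hw
          have : (w : V) ∈ N.map W.incl := (LieSubmodule.mem_map _).2 ⟨w, hw, rfl⟩
          rw [hN, LieSubmodule.mem_bot] at this
          exact Subtype.ext this
        · right
          have h1 : ¬ N.map W.incl < W := hirr _ hN
          have h2 : N.map W.incl ≤ W := by
            intro w hw
            obtain ⟨w', -, rfl⟩ := (LieSubmodule.mem_map _).1 hw
            exact w'.2
          have h3 : N.map W.incl = W := h2.eq_of_not_lt h1
          rw [eq_top_iff]
          rintro ⟨w, hw⟩ -
          rw [← h3] at hw
          obtain ⟨w', hw', h4⟩ := (LieSubmodule.mem_map _).1 hw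
          have : w' = ⟨w, h3 ▸ hw⟩ := Subtype.ext h4
          rwa [← this]
      by_cases htriv : ∃ (x : L) (w : W), ⁅x, w⁆ ≠ 0
      · obtain ⟨k, x, y, hinv, htr⟩ := IsKilling.exists_casimir K L W htriv
        let c : Module.End K V :=
          ∑ i, LieModule.toEnd K L V (x i) ∘ₗ LieModule.toEnd K L V (y i)
        have hcv : ∀ v, c v = ∑ i, ⁅x i, ⁅y i, v⁆⁆ := fun v => by simp [c]
        have hc : ∀ (z : L) (v : V), c ⁅z, v⁆ = ⁅z, c v⁆ := by
          intro z v
          let T : L ⊗[K] L →ₗ[K] V := TensorProduct.lift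
            (LinearMap.mk₂ K (fun a b : L => ⁅a, ⁅b, v⁆⁆) (by simp) (by simp) (by simp) (by simp))
          have := congrArg T (hinv z)
          simp only [map_sum, map_add, map_zero, T, TensorProduct.lift.tmul,
            LinearMap.mk₂_apply] at this
          rw [hcv, hcv, lie_sum, ← sub_eq_zero, ← Finset.sum_sub_distrib, ← neg_eq_zero,
            ← Finset.sum_neg_distrib, ← this]
          refine Finset.sum_congr rfl fun i _ => ?_
          rw [lie_lie, lie_lie, lie_sub]
          abel
        have hcW : ∀ v, c v ∈ W := fun v => by
          rw [hcv]; exact sum_mem fun i _ => hLW _ _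
        let cW : Module.End K W :=
          ∑ i, LieModule.toEnd K L W (x i) ∘ₗ LieModule.toEnd K L W (y i)
        have hcWc : ∀ w : W, (cW w : V) = c w := fun w => by simp [c, cW]
        obtain ⟨s, hs⟩ := LieModule.exists_eq_smul_of_commute (L := L) cW (fun z w => Subtype.ext (by
          rw [hcWc]
          simp only [LieSubmodule.coe_bracket]
          rw [hcWc, hc]))
        have hs0 : s ≠ 0 := by
          rintro rfl
          apply htr
          have : cW = 0 := by ext w; simp [hs w]
          change LinearMap.trace K W cW = 0
          rw [this, map_zero]
        have hsW : ∀ w ∈ W, c w = s • w := fun w hw => by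
          rw [← hcWc ⟨w, hw⟩, hs]; rfl
        have hker : c (v₀ - s⁻¹ • c v₀) = 0 := by
          rw [map_sub, map_smul, hsW _ (hcW v₀), smul_smul, inv_mul_cancel₀ hs0, one_smul, sub_self]
        -- `c` maps `V` into `W` and is the nonzero scalar `s` there, so this is the component of
        -- `v₀` in `ker c`. Its translates under `L` lie in `W ⊓ ker c`, which is zero.
        refine ⟨v₀ - s⁻¹ • c v₀, fun h => hv₀ ?_, fun z => ?_⟩
        · have := add_mem h (W.smul_mem s⁻¹ (hcW v₀))
          simpa using this
        · have h1 := hsW _ (hLW z (v₀ - s⁻¹ • c v₀))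
          rw [hc, hker, lie_zero] at h1
          exact (smul_eq_zero.1 h1.symm).resolve_left hs0
      · push Not at htriv
        refine ⟨v₀, hv₀, fun z => ?_⟩
        -- Two successive actions kill `v₀`, since the first lands in the trivial module `W`. So
        -- brackets kill it, and `L` is spanned by brackets.
        have hz : z ∈ ⁅(⊤ : LieIdeal K L), (⊤ : LieIdeal K L)⁆ := by
          rw [IsKilling.lie_top_top]; trivial
        rw [← LieSubmodule.mem_toSubmodule, LieSubmodule.lieIdeal_oper_eq_linear_span'] at hz
        induction hz using Submodule.span_induction with
        | mem u hu =>
          obtain ⟨a, -, b, -, rfl⟩ := hu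
          have h1 := htriv a ⟨_, hLW b v₀⟩
          have h2 := htriv b ⟨_, hLW a v₀⟩
          rw [lie_lie]
          rw [show ⁅a, ⁅b, v₀⁆⁆ = 0 from congrArg Subtype.val h1,
            show ⁅b, ⁅a, v₀⁆⁆ = 0 from congrArg Subtype.val h2, sub_zero]
        | zero => simp
        | add a b _ _ ha hb => rw [add_lie, ha, hb, add_zero]
        | smul c a _ ha => rw [smul_lie, ha, smul_zero]

/-- **Weyl's theorem** on complete reducibility. -/
theorem IsKilling.exists_isCompl {V : Type*} [AddCommGroup V] [Module K V]
    [LieRingModule L V] [LieModule K L V] [FiniteDimensional K V] (W : LieSubmodule K L V) :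
    ∃ W' : LieSubmodule K L V, IsCompl W W' := by
  by_cases hbot : W = ⊥
  · exact ⟨⊤, hbot ▸ isCompl_bot_top⟩
  -- The algebra `L` maps the maps that are scalar on `W` to maps that vanish on `W`. An invariant
  -- element of `P` outside `P₀` is, up to a scalar, an equivariant projection onto `W`, and its
  -- kernel is the complement.
  let P : LieSubmodule K L (V →ₗ[K] W) :=
    { carrier := {f | ∃ c : K, ∀ w : W, f w = c • w}
      add_mem' := by
        rintro f g ⟨c, hc⟩ ⟨d, hd⟩
        exact ⟨c + d, fun w => by rw [LinearMap.add_apply, hc, hd, add_smul]⟩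
      zero_mem' := ⟨0, fun w => by simp⟩
      smul_mem' := by
        rintro a f ⟨c, hc⟩
        exact ⟨a * c, fun w => by rw [LinearMap.smul_apply, hc, mul_smul]⟩
      lie_mem := by
        rintro x f ⟨c, hc⟩
        refine ⟨0, fun w => ?_⟩
        have := hc ⁅x, w⁆
        rw [LieSubmodule.coe_bracket] at this
        rw [LieHom.lie_apply, hc, this, lie_smul]; simp }
  let P₀ : LieSubmodule K L P :=
    { carrier := {f | ∀ w : W, f.1 w = 0}
      add_mem' := by
        intro f g hf hg w
        change f.1 w + g.1 w = 0
        rw [hf, hg, add_zero]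
      zero_mem' := fun w => rfl
      smul_mem' := by
        intro a f hf w
        change a • f.1 w = 0
        rw [hf, smul_zero]
      lie_mem := by
        intro x f hf w
        have h1 := hf ⁅x, w⁆
        rw [LieSubmodule.coe_bracket] at h1
        change (⁅x, f.1⁆ : V →ₗ[K] W) w = 0
        rw [LieHom.lie_apply, hf, h1]; simp }
  have hP₀ : P₀ ≠ ⊤ := by
    intro h
    obtain ⟨p, hp⟩ := W.toSubmodule.exists_isCompl
    obtain ⟨w, hw, hw0⟩ := W.toSubmodule.ne_bot_iff.1 (by simpa using hbot)
    let f : V →ₗ[K] W := W.toSubmodule.projectionOnto p hp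
    have hf : ∀ w : W, f w = w := fun w => Submodule.projectionOnto_apply_left hp w
    have hfP : f ∈ P := ⟨1, fun w => by rw [hf, one_smul]⟩
    have : (⟨f, hfP⟩ : P) ∈ P₀ := h ▸ LieSubmodule.mem_top _
    have h2 := this ⟨w, hw⟩
    rw [show (⟨f, hfP⟩ : P).1 = f from rfl, hf] at h2
    exact hw0 (congrArg Subtype.val h2)
  obtain ⟨⟨f, c, hfc⟩, hf, hinv⟩ := IsKilling.exists_lie_eq_zero_of_finrank (L := L) _ P le_rfl P₀ (by
    rintro x ⟨f, c, hc⟩ w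
    have := hc ⁅x, w⁆
    rw [LieSubmodule.coe_bracket] at this
    change (⁅x, f⁆ : V →ₗ[K] W) w = 0
    rw [LieHom.lie_apply, hc, this, lie_smul, sub_self]) hP₀
  have hc0 : c ≠ 0 := by
    rintro rfl
    exact hf fun w => by rw [show f w = _ from hfc w, zero_smul]
  have hcomm : ∀ (x : L) (v : V), f ⁅x, v⁆ = ⁅x, f v⁆ := by
    intro x v
    have h1 : ⁅x, f⁆ = 0 := congrArg Subtype.val (hinv x)
    have h2 := LinearMap.congr_fun h1 v
    rw [LieHom.lie_apply, LinearMap.zero_apply, sub_eq_zero] at h2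
    exact h2.symm
  let W' : LieSubmodule K L V :=
    { LinearMap.ker f with
      lie_mem := by
        intro x m hm
        simp only [AddSubsemigroup.mem_carrier, AddSubmonoid.mem_toSubsemigroup,
          Submodule.mem_toAddSubmonoid, LinearMap.mem_ker] at hm ⊢
        rw [hcomm, hm, lie_zero] }
  refine ⟨W', ?_⟩
  rw [isCompl_iff, disjoint_iff, codisjoint_iff]
  constructor
  · rw [LieSubmodule.eq_bot_iff]
    rintro w ⟨hw, hw'⟩
    have h1 := hfc ⟨w, hw⟩
    have h2 : f w = 0 := hw'
    rw [show f (⟨w, hw⟩ : W) = f w from rfl, h2] at h1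
    exact congrArg Subtype.val ((smul_eq_zero.1 h1.symm).resolve_left hc0)
  · rw [eq_top_iff]
    intro v _
    rw [LieSubmodule.mem_sup]
    refine ⟨c⁻¹ • (f v : V), W.smul_mem _ (f v).2, v - c⁻¹ • (f v : V), ?_, by abel⟩
    change f _ = 0
    rw [map_sub, map_smul, hfc, smul_smul, inv_mul_cancel₀ hc0, one_smul, sub_self]

end Weyl

end LieAlgebra

end

section

open Module

/-! ### Locally nilpotent operators and their exponentials -/

namespace Module.End

variable {K M : Type*} [Field K] [AddCommGroup M] [Module K M]

/-- `X` is locally nilpotent: every vector is killed by a power of `X`. -/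
def IsLocallyNilpotent (X : Module.End K M) : Prop := ∀ m, ∃ n, (X ^ n) m = 0

theorem pow_apply_eq_zero_of_le {X : Module.End K M} {m : M} {n k : ℕ} (h : (X ^ n) m = 0)
    (hnk : n ≤ k) : (X ^ k) m = 0 := by
  obtain ⟨d, rfl⟩ := Nat.exists_eq_add_of_le' hnk
  rw [pow_add, Module.End.mul_apply, h, map_zero]

theorem expSum_eq {X : Module.End K M} {m : M} {n k : ℕ} (h : (X ^ n) m = 0) (hnk : n ≤ k) :
    ∑ i ∈ Finset.range k, ((i.factorial : K)⁻¹) • (X ^ i) m =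
      ∑ i ∈ Finset.range n, ((i.factorial : K)⁻¹) • (X ^ i) m := by
  symm
  apply Finset.sum_subset (Finset.range_mono hnk)
  intro i _ hi
  rw [pow_apply_eq_zero_of_le h (by simpa using hi), smul_zero]

/-- The exponential of a locally nilpotent operator. -/
noncomputable def IsLocallyNilpotent.exp {X : Module.End K M} (hX : X.IsLocallyNilpotent) : M →ₗ[K] M where
  toFun m := ∑ i ∈ Finset.range (hX m).choose, ((i.factorial : K)⁻¹) • (X ^ i) m
  map_add' a b := by
    set k := max (max (hX a).choose (hX b).choose) (hX (a + b)).choose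
    rw [← expSum_eq (hX a).choose_spec (k := k) (by simp [k]),
      ← expSum_eq (hX b).choose_spec (k := k) (by simp [k]),
      ← expSum_eq (hX (a + b)).choose_spec (k := k) (by simp [k]), ← Finset.sum_add_distrib]
    simp [smul_add]
  map_smul' c a := by
    set k := max (hX a).choose (hX (c • a)).choose
    rw [← expSum_eq (hX a).choose_spec (k := k) (by simp [k]),
      ← expSum_eq (hX (c • a)).choose_spec (k := k) (by simp [k]), Finset.smul_sum]
    simp [smul_comm c]

theorem IsLocallyNilpotent.exp_apply {X : Module.End K M} (hX : X.IsLocallyNilpotent) {m : M} {n : ℕ}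
    (h : (X ^ n) m = 0) : hX.exp m = ∑ i ∈ Finset.range n, ((i.factorial : K)⁻¹) • (X ^ i) m := by
  change ∑ i ∈ Finset.range (hX m).choose, ((i.factorial : K)⁻¹) • (X ^ i) m = _
  rw [← expSum_eq (hX m).choose_spec (le_max_left _ n), ← expSum_eq h (le_max_right _ _)]

/-- `exp X - 1` lowers the nilpotency order of every vector, so a preimage is built by successive
approximation. -/
theorem IsLocallyNilpotent.exp_surjective {X : Module.End K M} (hX : X.IsLocallyNilpotent) :
    Function.Surjective hX.exp := by
  have key : ∀ n m, (X ^ n) m = 0 → ∃ m', hX.exp m' = m := by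
    intro n
    induction n with
    | zero => intro m hm; exact ⟨0, by rw [map_zero]; simpa using hm.symm⟩
    | succ n ih =>
      intro m hm
      obtain ⟨m', hm'⟩ := ih (m - hX.exp m) (by
        rw [hX.exp_apply hm, Finset.sum_range_succ', map_sub, map_add, map_sum]
        simp only [Nat.factorial_zero, Nat.cast_one, inv_one, pow_zero, Module.End.one_apply,
          one_smul]
        rw [Finset.sum_eq_zero, zero_add, sub_self]
        intro i _
        rw [map_smul, ← Module.End.mul_apply, ← pow_add,
          pow_apply_eq_zero_of_le hm (by omega), smul_zero])
      exact ⟨m + m', by rw [map_add, hm']; abel⟩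
  exact fun m => key _ m (hX m).choose_spec

theorem IsLocallyNilpotent.smul {X : Module.End K M} (hX : X.IsLocallyNilpotent) (t : K) :
    (t • X).IsLocallyNilpotent := fun m => by
  obtain ⟨n, hn⟩ := hX m
  exact ⟨n, by rw [smul_pow, LinearMap.smul_apply, hn, smul_zero]⟩

end Module.End

namespace LieModule

open Module.End

/-! ### Conjugation by exponentials and spans of locally nilpotent elements. -/

section LocallyNilpotent

variable {K L M : Type*} [Field K] [CharZero K] [LieRing L] [LieAlgebra K L] [AddCommGroup M] [Module K M]
  [LieRingModule L M] [LieModule K L M]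

/-- This is the Leibniz formula for powers of `x`, with the binomial coefficients absorbed by the
factorials; the Cauchy product of the two exponential series gives the identity. -/
theorem exp_lie {x : L} (hL : (toEnd K L L x).IsLocallyNilpotent)
    (hM : (toEnd K L M x).IsLocallyNilpotent) (y : L) (m : M) :
    hM.exp ⁅y, m⁆ = ⁅hL.exp y, hM.exp m⁆ := by
  obtain ⟨p, hp⟩ := hL y
  obtain ⟨q, hq⟩ := hM m
  let F : ℕ → ℕ → M := fun i j => ((i.factorial : K)⁻¹ * (j.factorial : K)⁻¹) •
    ⁅(toEnd K L L x ^ i) y, (toEnd K L M x ^ j) m⁆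
  have hF₁ : ∀ i j, p ≤ i → F i j = 0 := fun i j h => by
    simp only [F]; rw [pow_apply_eq_zero_of_le hp h, zero_lie, smul_zero]
  have hF₂ : ∀ i j, q ≤ j → F i j = 0 := fun i j h => by
    simp only [F]; rw [pow_apply_eq_zero_of_le hq h, lie_zero, smul_zero]
  have hsum : ∀ n : ℕ, ((n.factorial : K)⁻¹) • (toEnd K L M x ^ n) ⁅y, m⁆ =
      ∑ i ∈ Finset.range (n + 1), F i (n - i) := by
    intro n
    rw [toEnd_pow_lie, Finset.smul_sum, Finset.Nat.sum_antidiagonal_eq_sum_range_succ_mk]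
    refine Finset.sum_congr rfl fun i hi => ?_
    have hi' : i ≤ n := by simpa [Nat.lt_succ_iff] using hi
    simp only [F]
    rw [← Nat.cast_smul_eq_nsmul K, smul_smul, Nat.cast_choose K hi']
    congr 1
    have := Nat.factorial_ne_zero n
    field_simp
  -- In every term of total degree `p + q` either the first index is at least `p` or the second at
  -- least `q`.
  have hpq : (toEnd K L M x ^ (p + q)) ⁅y, m⁆ = 0 := by
    have h1 := hsum (p + q)
    rw [Finset.sum_eq_zero] at h1
    · exact (smul_eq_zero.1 h1).resolve_left
        (inv_ne_zero (Nat.cast_ne_zero.2 (Nat.factorial_ne_zero _)))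
    · intro i hi
      rcases le_or_gt p i with h | h
      · exact hF₁ _ _ h
      · exact hF₂ _ _ (by omega)
  rw [hM.exp_apply hpq, hL.exp_apply hp, hM.exp_apply hq, Finset.sum_congr rfl fun n _ => hsum n,
    Finset.sum_range_diag_flip, sum_lie, Finset.sum_range_add, add_eq_left.2]
  · refine Finset.sum_congr rfl fun i hi => ?_
    rw [lie_sum, ← Finset.sum_subset (Finset.range_mono (by
      have := Finset.mem_range.1 hi; omega : q ≤ p + q - i))]
    · refine Finset.sum_congr rfl fun j _ => ?_
      simp only [F]
      rw [smul_lie, lie_smul, smul_smul]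
    · intro j _ hj
      exact hF₂ _ _ (by simpa using hj)
  · exact Finset.sum_eq_zero fun i _ => Finset.sum_eq_zero fun j _ => hF₁ _ _ (by omega)

variable (K L M) in
/-- The elements of `L` that are locally nilpotent on `L` and on `M`. -/
def locallyNilpotentSet : Set L :=
  {x | (toEnd K L L x).IsLocallyNilpotent ∧ (toEnd K L M x).IsLocallyNilpotent}

omit [CharZero K] in
theorem smul_mem_locallyNilpotentSet {x : L} (hx : x ∈ locallyNilpotentSet K L M) (t : K) :
    t • x ∈ locallyNilpotentSet K L M := by
  refine ⟨?_, ?_⟩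
  · rw [map_smul]; exact hx.1.smul t
  · rw [map_smul]; exact hx.2.smul t

/-- The operator of `hL.exp y` is intertwined with that of `y` by the surjection `hM.exp`, so it
inherits local nilpotency. -/
theorem isLocallyNilpotent_exp {x y : L} (hL : (toEnd K L L x).IsLocallyNilpotent)
    (hM : (toEnd K L M x).IsLocallyNilpotent) (hy : (toEnd K L M y).IsLocallyNilpotent) :
    (toEnd K L M (hL.exp y)).IsLocallyNilpotent := by
  intro m
  obtain ⟨m, rfl⟩ := hM.exp_surjective m
  obtain ⟨n, hn⟩ := hy m
  refine ⟨n, ?_⟩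
  have : ∀ k, (toEnd K L M (hL.exp y) ^ k) (hM.exp m) = hM.exp ((toEnd K L M y ^ k) m) := by
    intro k
    induction k with
    | zero => simp
    | succ k ih =>
      rw [pow_succ', pow_succ', Module.End.mul_apply, Module.End.mul_apply, ih, toEnd_apply_apply,
        toEnd_apply_apply, exp_lie hL hM]
  rw [this, hn, map_zero]

/-- For every scalar `t` the element exp(t ad x) y is again locally nilpotent. It is polynomial in
`t`, and a polynomial with values in a subspace over an infinite field has its coefficients there;
the bracket is the coefficient of `t`. -/
theorem lie_mem_span_locallyNilpotentSet {x y : L} (hx : x ∈ locallyNilpotentSet K L M)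
    (hy : y ∈ locallyNilpotentSet K L M) :
    ⁅x, y⁆ ∈ Submodule.span K (locallyNilpotentSet K L M) := by
  obtain ⟨n, hn⟩ := hx.1 y
  let S := Submodule.span K (locallyNilpotentSet K L M)
  -- The range `n + 2` contains the index 1 even when `n = 0`, so the linear term is always present.
  have hmem : ∀ t : K, ∑ i ∈ Finset.range (n + 2),
      (t ^ i * (i.factorial : K)⁻¹) • (toEnd K L L x ^ i) y ∈ S := by
    intro t
    have htx := smul_mem_locallyNilpotentSet hx t
    have h0 : (toEnd K L L (t • x) ^ (n + 2)) y = 0 := by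
      rw [map_smul, smul_pow, LinearMap.smul_apply, pow_apply_eq_zero_of_le hn (by omega), smul_zero]
    have h1 := htx.1.exp_apply h0
    have h2 : htx.1.exp y ∈ S := Submodule.subset_span
      ⟨isLocallyNilpotent_exp htx.1 htx.1 hy.1, isLocallyNilpotent_exp htx.1 htx.2 hy.2⟩
    rw [h1] at h2
    convert h2 using 2 with i
    rw [map_smul, smul_pow, LinearMap.smul_apply, smul_smul, mul_comm]
  by_contra hxy
  obtain ⟨f, hf, hfS⟩ := Submodule.exists_le_ker_of_notMem hxy
  let P : Polynomial K := ∑ i ∈ Finset.range (n + 2),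
    Polynomial.monomial i ((i.factorial : K)⁻¹ * f ((toEnd K L L x ^ i) y))
  have hP : P = 0 := by
    apply Polynomial.funext
    intro t
    have := hfS (hmem t)
    rw [LinearMap.mem_ker, map_sum] at this
    rw [Polynomial.eval_finsetSum, Polynomial.eval_zero, ← this]
    refine Finset.sum_congr rfl fun i _ => ?_
    rw [Polynomial.eval_monomial, map_smul, smul_eq_mul]
    ring
  have h1 : P.coeff 1 = f ⁅x, y⁆ := by
    simp [P, Polynomial.finsetSum_coeff, Polynomial.coeff_monomial]
  rw [hP, Polynomial.coeff_zero] at h1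
  exact hf h1.symm

variable (K L M) in
/-- The span of the elements that are locally nilpotent on `L` and on `M` is a subalgebra. -/
def locallyNilpotentSubalgebra : LieSubalgebra K L where
  __ := Submodule.span K (locallyNilpotentSet K L M)
  lie_mem' := by
    intro x y hx hy
    simp only [AddSubsemigroup.mem_carrier, AddSubmonoid.mem_toSubsemigroup,
      Submodule.mem_toAddSubmonoid] at hx hy ⊢
    induction hx using Submodule.span_induction with
    | zero => simp
    | add a b _ _ ha hb => rw [add_lie]; exact add_mem ha hb
    | smul c a _ ha => rw [smul_lie]; exact Submodule.smul_mem _ _ ha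
    | mem x hx =>
      induction hy using Submodule.span_induction with
      | zero => simp
      | add a b _ _ ha hb => rw [lie_add]; exact add_mem ha hb
      | smul c a _ ha => rw [lie_smul]; exact Submodule.smul_mem _ _ ha
      | mem y hy => exact lie_mem_span_locallyNilpotentSet hx hy

end LocallyNilpotent

/-! ### Locally finite modules -/

section LocallyFinite

variable {K L M : Type*} [Field K] [LieRing L] [LieAlgebra K L] [AddCommGroup M] [Module K M]
  [LieRingModule L M] [LieModule K L M]

variable (K M) in
/-- `x` acts locally finitely on `M`. -/
def IsLocallyFinite (x : L) : Prop :=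
  ∀ m : M, ∃ F : Submodule K M, FiniteDimensional K F ∧ m ∈ F ∧ ∀ u ∈ F, ⁅x, u⁆ ∈ F

theorem IsLocallyFinite.of_isLocallyNilpotent {x : L} (hx : (toEnd K L M x).IsLocallyNilpotent) :
    IsLocallyFinite K M x := by
  intro m
  obtain ⟨n, hn⟩ := hx m
  refine ⟨Submodule.span K (Set.range fun i : Fin (n + 1) => (toEnd K L M x ^ (i : ℕ)) m),
    FiniteDimensional.span_of_finite K (Set.finite_range _),
    Submodule.subset_span ⟨0, by simp⟩, fun u hu => ?_⟩
  induction hu using Submodule.span_induction with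
  | zero => simp
  | add a b _ _ ha hb => rw [lie_add]; exact add_mem ha hb
  | smul c a _ ha => rw [lie_smul]; exact Submodule.smul_mem _ _ ha
  | mem a ha =>
    obtain ⟨i, rfl⟩ := ha
    have h1 : ⁅x, (toEnd K L M x ^ (i : ℕ)) m⁆ = (toEnd K L M x ^ ((i : ℕ) + 1)) m := by
      rw [pow_succ', Module.End.mul_apply, toEnd_apply_apply]
    simp only [h1]
    rcases lt_or_ge ((i : ℕ) + 1) (n + 1) with h | h
    · exact Submodule.subset_span ⟨⟨_, h⟩, rfl⟩
    · rw [pow_apply_eq_zero_of_le hn (by omega)]; exact zero_mem _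

omit [LieAlgebra K L] [LieModule K L M] in
theorem IsLocallyFinite.exists_le {x : L} (hx : IsLocallyFinite K M x) (V : Submodule K M)
    [FiniteDimensional K V] :
    ∃ F : Submodule K M, FiniteDimensional K F ∧ V ≤ F ∧ ∀ u ∈ F, ⁅x, u⁆ ∈ F := by
  have hV : V.FG := Module.Finite.iff_fg.1 inferInstance
  induction V, hV using Submodule.fg_induction with
  | singleton m =>
    obtain ⟨F, h1, h2, h3⟩ := hx m
    exact ⟨F, h1, by simpa [Submodule.span_singleton_le_iff_mem] using h2, h3⟩
  | sup V₁ V₂ _ _ h1 h2 =>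
    obtain ⟨F₁, _, hF₁, hs₁⟩ := h1
    obtain ⟨F₂, _, hF₂, hs₂⟩ := h2
    refine ⟨F₁ ⊔ F₂, inferInstance, sup_le_sup hF₁ hF₂, fun u hu => ?_⟩
    obtain ⟨a, ha, b, hb, rfl⟩ := Submodule.mem_sup.1 hu
    rw [lie_add]
    exact Submodule.add_mem_sup (hs₁ a ha) (hs₂ b hb)

/-- The product of the elements of a list, applied to a vector. -/
def listAct (l : List L) (m : M) : M := l.foldr (fun x u => ⁅x, u⁆) m

@[simp] theorem listAct_cons (x : L) (l : List L) (m : M) : listAct (x :: l) m = ⁅x, listAct l m⁆ := rfl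

theorem listAct_append (l l' : List L) (m : M) : listAct (l ++ l') m = listAct l (listAct l' m) := by
  simp [listAct]

-- Gathering equal letters into blocks makes words harmless: each block is a power of one locally
-- finite operator, so applying the blocks in a fixed order stays inside one finite-dimensional
-- space, however long the word.
omit [LieAlgebra K L] [LieModule K L M] in
theorem exists_perm_listAct_mem (xs : List L) (hxs : ∀ x ∈ xs, IsLocallyFinite K M x) (m : M) :
    ∃ F : Submodule K M, FiniteDimensional K F ∧
      ∀ l : List L, (∀ x ∈ l, x ∈ xs) → ∃ l', l.Perm l' ∧ listAct l' m ∈ F := by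
  classical
  induction xs with
  | nil =>
    refine ⟨Submodule.span K {m}, inferInstance, fun l hl => ⟨l, .refl l, ?_⟩⟩
    cases l with
    | nil => exact Submodule.mem_span_singleton_self m
    | cons x l => exact absurd (hl x (by simp)) (by simp)
  | cons x xs ih =>
    obtain ⟨F₀, _, hF₀⟩ := ih fun y hy => hxs y (by simp [hy])
    obtain ⟨F, hF, hle, hstab⟩ := (hxs x (by simp)).exists_le F₀
    refine ⟨F, hF, fun l hl => ?_⟩
    obtain ⟨l', hl', hl'm⟩ := hF₀ (l.filter fun y => !(y == x)) (by
      intro y hy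
      rw [List.mem_filter] at hy
      have := hl y hy.1
      simp only [List.mem_cons] at this
      exact this.resolve_left (by simpa using hy.2))
    refine ⟨l.filter (· == x) ++ l', ?_, ?_⟩
    · exact (List.filter_append_perm (· == x) l).symm.trans (hl'.append_left _)
    · rw [listAct_append]
      have : ∀ k : List L, (∀ y ∈ k, y = x) → listAct k (listAct l' m) ∈ F := by
        intro k
        induction k with
        | nil => intro _; exact hle hl'm
        | cons y k ihk =>
          intro hk
          rw [listAct_cons, hk y (by simp)]
          exact hstab _ (ihk fun z hz => hk z (by simp [hz]))
      exact this _ fun y hy => by simpa using (List.mem_filter.1 hy).2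

/-- As in the spanning half of the Poincaré–Birkhoff–Witt theorem: exchanging two neighbouring
letters costs a word with their bracket in place of both, and expanding the bracket in the letters
gives shorter words. -/
theorem listAct_sub_mem_of_perm {xs : Set L} (hxs : Submodule.span K xs = ⊤) (m : M) {l l' : List L}
    (h : l.Perm l') (hl : ∀ x ∈ l, x ∈ xs) :
    listAct l m - listAct l' m ∈
      Submodule.span K {u | ∃ k : List L, (∀ x ∈ k, x ∈ xs) ∧ k.length < l.length ∧
        u = listAct k m} := by
  induction h with
  | nil => simp
  | cons x h ih =>
    rename_i l₁ l₂
    have := ih fun y hy => hl y (by simp [hy])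
    rw [listAct_cons, listAct_cons, ← lie_sub]
    generalize listAct l₁ m - listAct l₂ m = w at this
    induction this using Submodule.span_induction with
    | zero => simp
    | add a b _ _ ha hb => rw [lie_add]; exact add_mem ha hb
    | smul c a _ ha => rw [lie_smul]; exact Submodule.smul_mem _ _ ha
    | mem a ha =>
      obtain ⟨k, hk, hkl, rfl⟩ := ha
      refine Submodule.subset_span ⟨x :: k, ?_, by simpa using hkl, rfl⟩
      intro y hy
      rcases List.mem_cons.1 hy with rfl | hy
      · exact hl y (by simp)
      · exact hk y hy
  | swap x y l =>
    simp only [listAct_cons]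
    rw [← lie_lie]
    have hxy : ⁅y, x⁆ ∈ Submodule.span K xs := hxs ▸ Submodule.mem_top
    generalize ⁅y, x⁆ = z at hxy
    induction hxy using Submodule.span_induction with
    | zero => simp
    | add a b _ _ ha hb => rw [add_lie]; exact add_mem ha hb
    | smul c a _ ha => rw [smul_lie]; exact Submodule.smul_mem _ _ ha
    | mem a ha =>
      refine Submodule.subset_span ⟨a :: l, ?_, by simp, rfl⟩
      intro z hz
      rcases List.mem_cons.1 hz with rfl | hz
      · exact ha
      · exact hl z (by simp [hz])
  | trans h₁ h₂ ih₁ ih₂ =>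
    have h1 := ih₁ hl
    have h2 := ih₂ fun y hy => hl y (h₁.mem_iff.2 hy)
    rw [← h₁.length_eq] at h2
    simpa using add_mem h1 h2

/-- If `L` is spanned by finitely many elements acting locally finitely on `M`, then `M` is a locally
finite `L`-module. -/
theorem exists_finiteDimensional_lieSubmodule (xs : List L) (hxs : ∀ x ∈ xs, IsLocallyFinite K M x)
    (hspan : Submodule.span K {x | x ∈ xs} = ⊤) (m : M) :
    ∃ N : LieSubmodule K L M, FiniteDimensional K N ∧ m ∈ N := by
  obtain ⟨F, hF, hperm⟩ := exists_perm_listAct_mem xs hxs m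
  -- Every word differs from a rearrangement landing in `F` by shorter words, so induction on the
  -- length puts all of them into `F`.
  have key : ∀ n, ∀ l : List L, l.length < n → (∀ x ∈ l, x ∈ xs) → listAct l m ∈ F := by
    intro n
    induction n with
    | zero => intro l hl; omega
    | succ n ih =>
      intro l hln hl
      obtain ⟨l', hl', hl'F⟩ := hperm l hl
      have h1 := listAct_sub_mem_of_perm hspan m hl' hl
      have h2 : listAct l m - listAct l' m ∈ F := by
        refine (Submodule.span_le.2 ?_) h1
        rintro _ ⟨k, hk, hkl, rfl⟩
        exact ih k (by omega) hk
      simpa using add_mem h2 hl'F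
  let N : LieSubmodule K L M :=
    { Submodule.span K {u | ∃ l : List L, (∀ x ∈ l, x ∈ xs) ∧ u = listAct l m} with
      lie_mem := by
        intro x u hu
        simp only [AddSubsemigroup.mem_carrier, AddSubmonoid.mem_toSubsemigroup,
          Submodule.mem_toAddSubmonoid] at hu ⊢
        have hx : x ∈ Submodule.span K {x | x ∈ xs} := hspan ▸ Submodule.mem_top
        induction hx using Submodule.span_induction with
        | zero => simp
        | add a b _ _ ha hb => rw [add_lie]; exact add_mem ha hb
        | smul c a _ ha => rw [smul_lie]; exact Submodule.smul_mem _ _ ha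
        | mem x hx =>
          induction hu using Submodule.span_induction with
          | zero => simp
          | add a b _ _ ha hb => rw [lie_add]; exact add_mem ha hb
          | smul c a _ ha => rw [lie_smul]; exact Submodule.smul_mem _ _ ha
          | mem u hu =>
            obtain ⟨l, hl, rfl⟩ := hu
            refine Submodule.subset_span ⟨x :: l, ?_, rfl⟩
            intro y hy
            rcases List.mem_cons.1 hy with rfl | hy
            · exact hx
            · exact hl y hy }
  refine ⟨N, ?_, Submodule.subset_span ⟨[], by simp, rfl⟩⟩
  have hle : N.toSubmodule ≤ F := by
    refine Submodule.span_le.2 ?_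
    rintro _ ⟨l, hl, rfl⟩
    exact key _ l (Nat.lt_succ_self _) hl
  exact Submodule.finiteDimensional_of_le hle

end LocallyFinite

end LieModule

end

section

open Module

/-! ### Semisimplicity of locally finite modules -/

namespace LieSubmodule

section

variable {K L M : Type*} [Field K] [CharZero K] [IsAlgClosed K] [LieRing L] [LieAlgebra K L]
  [FiniteDimensional K L] [AddCommGroup M] [Module K M] [LieRingModule L M] [LieModule K L M]

omit [CharZero K] [IsAlgClosed K] [LieAlgebra K L] [FiniteDimensional K L] [LieModule K L M] in
/-- If a finite-dimensional submodule `N` has complements in itself for all its submodules, it is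
contained in the sum of the finite-dimensional irreducible submodules. -/
theorem le_sSup_atoms_of_forall_exists_compl (N : LieSubmodule K L M) [FiniteDimensional K N]
    (h : ∀ W ≤ N, ∃ W', W ⊔ W' = N ∧ W ⊓ W' = ⊥) :
    N ≤ sSup {P : LieSubmodule K L M | IsAtom P ∧ FiniteDimensional K P} := by
  -- A nonzero complement of `A` in `N` would contain, for reasons of dimension, an irreducible
  -- submodule, and that one also lies in `A`.
  set A := sSup {P : LieSubmodule K L M | IsAtom P ∧ FiniteDimensional K P ∧ P ≤ N}
  have hAN : A ≤ N := sSup_le fun P hP => hP.2.2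
  obtain ⟨C, hsup, hinf⟩ := h A hAN
  have hCN : C ≤ N := hsup ▸ le_sup_right
  have hmin : ∀ (k : ℕ) (P : LieSubmodule K L M), P ≤ N → finrank K P ≤ k → P ≠ ⊥ →
      ∃ Q ≤ P, IsAtom Q := by
    intro k
    induction k with
    | zero =>
      intro P hPN hk hP
      have : FiniteDimensional K P.toSubmodule :=
        Submodule.finiteDimensional_of_le (S₂ := N.toSubmodule) hPN
      have : P.toSubmodule = ⊥ := Submodule.finrank_eq_zero.1 (Nat.le_zero.1 hk)
      exact absurd (by simpa using this) hP
    | succ k ih =>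
      intro P hPN hk hP
      by_cases hat : IsAtom P
      · exact ⟨P, le_rfl, hat⟩
      · obtain ⟨Q, hQP, hQ⟩ : ∃ Q < P, Q ≠ ⊥ := by
          by_contra! hcon
          exact hat ⟨hP, hcon⟩
        have : FiniteDimensional K P.toSubmodule :=
          Submodule.finiteDimensional_of_le (S₂ := N.toSubmodule) hPN
        have hlt : finrank K Q.toSubmodule < finrank K P.toSubmodule :=
          Submodule.finrank_lt_finrank_of_lt hQP
        obtain ⟨R, hRQ, hR⟩ := ih Q (hQP.le.trans hPN) (by
          have : finrank K P.toSubmodule ≤ k + 1 := hk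
          change finrank K Q.toSubmodule ≤ k
          omega) hQ
        exact ⟨R, hRQ.trans hQP.le, hR⟩
  have hC : C = ⊥ := by
    by_contra hC
    obtain ⟨Q, hQC, hQ⟩ := hmin _ C hCN le_rfl hC
    have hQN := hQC.trans hCN
    have : FiniteDimensional K Q := Submodule.finiteDimensional_of_le (S₂ := N.toSubmodule) hQN
    have hQA : Q ≤ A := le_sSup ⟨hQ, this, hQN⟩
    exact hQ.1 (le_bot_iff.1 (hinf ▸ le_inf hQA hQC))
  rw [hC, sup_bot_eq] at hsup
  rw [← hsup]
  exact sSup_le_sSup fun P hP => ⟨hP.1, hP.2.1⟩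

/-- Let `L = Z + s` with `Z` central and `s` an ideal with nondegenerate Killing form. A locally
finite `L`-module spanned by eigenvectors of `Z` is the sum of its finite-dimensional irreducible
submodules. -/
theorem sSup_atoms_eq_top (s : LieIdeal K L) [LieAlgebra.IsKilling K s]
    (hs : (LieAlgebra.center K L).toSubmodule ⊔ s.toSubmodule = ⊤)
    (hfin : ∀ m : M, ∃ N : LieSubmodule K L M, FiniteDimensional K N ∧ m ∈ N)
    (hspan : Submodule.span K {m : M | ∃ χ : L → K, ∀ z ∈ LieAlgebra.center K L, ⁅z, m⁆ = χ z • m} = ⊤) :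
    sSup {P : LieSubmodule K L M | IsAtom P ∧ FiniteDimensional K P} = ⊤ := by
  rw [eq_top_iff]
  suffices h : (⊤ : Submodule K M) ≤
      (sSup {P : LieSubmodule K L M | IsAtom P ∧ FiniteDimensional K P}).toSubmodule from
    fun m hm => h trivial
  rw [← hspan, Submodule.span_le]
  rintro m ⟨χ, hχ⟩
  obtain ⟨N₀, hN₀, hmN₀⟩ := hfin m
  -- A common eigenspace of the center is a submodule on which the center acts by scalars. There
  -- stability under `s` amounts to stability under `L`, so Weyl's theorem for `s` yields
  -- complements of `L`-submodules.
  let N : LieSubmodule K L M :=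
    { carrier := {u | u ∈ N₀ ∧ ∀ z ∈ LieAlgebra.center K L, ⁅z, u⁆ = χ z • u}
      add_mem' := by
        rintro a b ⟨ha, ha'⟩ ⟨hb, hb'⟩
        exact ⟨add_mem ha hb, fun z hz => by rw [lie_add, ha' z hz, hb' z hz, smul_add]⟩
      zero_mem' := ⟨zero_mem _, fun z _ => by simp⟩
      smul_mem' := by
        rintro c a ⟨ha, ha'⟩
        exact ⟨N₀.smul_mem c ha, fun z hz => by rw [lie_smul, ha' z hz, smul_comm]⟩
      lie_mem := by
        rintro x a ⟨ha, ha'⟩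
        refine ⟨N₀.lie_mem ha, fun z hz => ?_⟩
        have : ⁅z, x⁆ = 0 := by
          rw [← lie_skew, (LieModule.mem_maxTrivSubmodule K L L z).1 hz x, neg_zero]
        rw [leibniz_lie, this, zero_lie, zero_add, ha' z hz, lie_smul] }
  have hle : N ≤ N₀ := fun u hu => hu.1
  have : FiniteDimensional K N := Submodule.finiteDimensional_of_le (S₂ := N₀.toSubmodule) hle
  refine le_sSup_atoms_of_forall_exists_compl N ?_ ⟨hmN₀, hχ⟩
  intro W hWN
  let Ws : LieSubmodule K s N :=
    { W.toSubmodule.comap (N.incl : N →ₗ[K] M) with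
      lie_mem := by
        rintro ⟨x, hx⟩ ⟨u, hu⟩ huW
        exact W.lie_mem (x := x) huW }
  obtain ⟨Cs, hCs⟩ := LieAlgebra.IsKilling.exists_isCompl (K := K) (L := s) Ws
  let C : LieSubmodule K L M :=
    { Cs.toSubmodule.map (N.incl : N →ₗ[K] M) with
      lie_mem := by
        rintro x _ ⟨u, hu, rfl⟩
        have hx : x ∈ (LieAlgebra.center K L).toSubmodule ⊔ s.toSubmodule := hs ▸ Submodule.mem_top
        obtain ⟨z, hz, y, hy, rfl⟩ := Submodule.mem_sup.1 hx
        rw [add_lie]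
        refine Submodule.add_mem _ ?_ ?_
        · exact ⟨χ z • u, Cs.smul_mem _ hu, (u.2.2 z hz).symm⟩
        · exact ⟨⁅(⟨y, hy⟩ : s), u⁆, Cs.lie_mem hu, rfl⟩ }
  refine ⟨C, ?_, ?_⟩
  · refine le_antisymm (sup_le hWN ?_) ?_
    · rintro _ ⟨u, -, rfl⟩
      exact u.2
    · intro u hu
      have : (⟨u, hu⟩ : N) ∈ Ws ⊔ Cs := by rw [hCs.sup_eq_top]; trivial
      obtain ⟨a, ha, b, hb, hab⟩ := (LieSubmodule.mem_sup _ _ _).1 this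
      rw [LieSubmodule.mem_sup]
      exact ⟨a, ha, b, ⟨b, hb, rfl⟩, congrArg Subtype.val hab⟩
  · rw [LieSubmodule.eq_bot_iff]
    rintro _ ⟨hW, ⟨u, hu, rfl⟩⟩
    have : u ∈ Ws ⊓ Cs := ⟨hW, hu⟩
    rw [hCs.inf_eq_bot, LieSubmodule.mem_bot] at this
    exact congrArg Subtype.val this

end

end LieSubmodule

end

section

open Module

namespace LieAlgebra

/-! ### Lie algebras with a faithful semisimple representation -/

section

variable {K L V : Type*} [Field K] [CharZero K] [IsAlgClosed K] [LieRing L] [LieAlgebra K L]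
  [FiniteDimensional K L] [AddCommGroup V] [Module K V] [LieRingModule L V] [LieModule K L V]
  [FiniteDimensional K V]

/-- The radical acts by scalars on an irreducible module. -/
theorem exists_radical_lie_eq_smul [LieModule.IsIrreducible K L V] :
    ∃ χ : L → K, ∀ x ∈ radical K L, ∀ v : V, ⁅x, v⁆ = χ x • v := by
  classical
  have := LieModule.nontrivial_of_isIrreducible K L V
  -- Lie's theorem gives a common eigenvector of the radical; its weight space is stable under all
  -- of `L`, hence everything.
  obtain ⟨χ, hχ⟩ : ∃ χ : Module.Dual K (radical K L), Nontrivial (LieModule.weightSpace V χ) :=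
    LieModule.exists_nontrivial_weightSpace_of_isSolvable K (radical K L) V
  let N : LieSubmodule K L V := LieModule.weightSpaceOfIsLieTower K V χ
  replace hχ : Nontrivial N := hχ
  replace hχ : N = ⊤ := N.eq_top_of_isIrreducible K L V
  refine ⟨fun x => if hx : x ∈ radical K L then χ ⟨x, hx⟩ else 0, fun x hx v => ?_⟩
  simp only [dif_pos hx]
  have hm : v ∈ N := hχ ▸ LieSubmodule.mem_top v
  have hm' : ∀ (y : L) (hy : y ∈ radical K L), ⁅y, v⁆ = χ ⟨y, hy⟩ • v := by
    simpa [N, LieModule.weightSpaceOfIsLieTower, LieModule.mem_weightSpace] using hm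
  exact hm' x hx

omit [CharZero K] [IsAlgClosed K] [LieAlgebra K L] [FiniteDimensional K L] [LieModule K L V]
  [FiniteDimensional K V] in
theorem _root_.LieSubmodule.isIrreducible_of_isAtom {P : LieSubmodule K L V} (hP : IsAtom P) :
    LieModule.IsIrreducible K L P := by
  have : Nontrivial (LieSubmodule K L P) := by
    rw [LieSubmodule.nontrivial_iff]
    obtain ⟨w, hw, hw0⟩ := P.toSubmodule.ne_bot_iff.1 (by simpa using hP.1)
    exact ⟨⟨⟨w, hw⟩, 0, fun h => hw0 (congrArg Subtype.val h)⟩⟩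
  refine ⟨fun N => ?_⟩
  have h2 : N.map P.incl ≤ P := by
    intro w hw
    obtain ⟨w', -, rfl⟩ := (LieSubmodule.mem_map _).1 hw
    exact w'.2
  rcases hP.le_iff.1 h2 with h | h
  · left
    rw [LieSubmodule.eq_bot_iff]
    intro w hw
    have : (w : V) ∈ N.map P.incl := (LieSubmodule.mem_map _).2 ⟨w, hw, rfl⟩
    rw [h, LieSubmodule.mem_bot] at this
    exact Subtype.ext this
  · right
    rw [eq_top_iff]
    rintro ⟨w, hw⟩ -
    rw [← h] at hw
    obtain ⟨w', hw', h4⟩ := (LieSubmodule.mem_map _).1 hw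
    have : w' = ⟨w, h ▸ hw⟩ := Subtype.ext h4
    rwa [← this]

variable (hss : sSup {P : LieSubmodule K L V | IsAtom P} = ⊤)

omit [CharZero K] [IsAlgClosed K] [LieAlgebra K L] [FiniteDimensional K L] [LieModule K L V]
  [FiniteDimensional K V] in
include hss in
theorem eq_zero_on_of_atoms (T : Module.End K V)
    (h : ∀ P : LieSubmodule K L V, IsAtom P → ∀ v ∈ P, T v = 0) (v : V) : T v = 0 := by
  have h1 : (sSup {P : LieSubmodule K L V | IsAtom P}).toSubmodule ≤ LinearMap.ker T := by
    rw [LieSubmodule.sSup_toSubmodule]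
    refine sSup_le ?_
    rintro _ ⟨P, hP, rfl⟩ v hv
    exact h P hP v hv
  rw [hss] at h1
  exact h1 (Submodule.mem_top (x := v))

theorem exists_radical_lie_eq_smul_of_isAtom {P : LieSubmodule K L V} (hP : IsAtom P) :
    ∃ χ : L → K, ∀ x ∈ radical K L, ∀ v ∈ P, ⁅x, v⁆ = χ x • v := by
  have := LieSubmodule.isIrreducible_of_isAtom hP
  obtain ⟨χ, hχ⟩ := exists_radical_lie_eq_smul (K := K) (L := L) (V := P)
  exact ⟨χ, fun x hx v hv => congrArg Subtype.val (hχ x hx ⟨v, hv⟩)⟩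

variable (hfaith : ∀ x : L, (∀ v : V, ⁅x, v⁆ = 0) → x = 0)

include hss hfaith

/-- The radical acts by scalars on each irreducible summand, so its brackets with `L` act by zero
and vanish by faithfulness. -/
theorem radical_eq_center_of_faithful : radical K L = center K L := by
  refine le_antisymm (fun x hx => ?_) (center_le_radical K L)
  rw [LieModule.mem_maxTrivSubmodule]
  intro y
  apply hfaith
  refine eq_zero_on_of_atoms hss (LieModule.toEnd K L V ⁅y, x⁆) fun P hP v hv => ?_
  obtain ⟨χ, hχ⟩ := exists_radical_lie_eq_smul_of_isAtom hP
  rw [LieModule.toEnd_apply_apply, lie_lie, hχ x hx v hv, hχ x hx _ (P.lie_mem hv), lie_smul, sub_self]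

/-- A central element acting nilpotently is zero. -/
theorem eq_zero_of_mem_center_of_isNilpotent {x : L} (hx : x ∈ center K L)
    (hnil : IsNilpotent (LieModule.toEnd K L V x)) : x = 0 := by
  apply hfaith
  refine eq_zero_on_of_atoms hss (LieModule.toEnd K L V x) fun P hP v hv => ?_
  obtain ⟨χ, hχ⟩ := exists_radical_lie_eq_smul_of_isAtom hP
  have hχv := hχ x (center_le_radical K L hx)
  obtain ⟨n, hn⟩ := hnil
  have h1 : ∀ k, (LieModule.toEnd K L V x ^ k) v = χ x ^ k • v := by
    intro k
    induction k with
    | zero => simp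
    | succ k ih =>
      rw [pow_succ', Module.End.mul_apply, ih, LieModule.toEnd_apply_apply, lie_smul,
        hχv v hv, smul_smul, pow_succ]
  have h2 := h1 n
  rw [hn, LinearMap.zero_apply] at h2
  rw [LieModule.toEnd_apply_apply, hχv v hv]
  rcases smul_eq_zero.1 h2.symm with h | h
  · rw [eq_zero_of_pow_eq_zero h, zero_smul]
  · rw [h, smul_zero]

/-- On an irreducible submodule a central element is a scalar and an element of the derived algebra
has trace zero; in characteristic zero an element that is both acts by zero. -/
theorem center_inf_lie_top_top :
    ∀ x ∈ center K L, x ∈ ⁅(⊤ : LieIdeal K L), (⊤ : LieIdeal K L)⁆ → x = 0 := by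
  intro x hx hxD
  apply hfaith
  refine eq_zero_on_of_atoms hss (LieModule.toEnd K L V x) fun P hP v hv => ?_
  obtain ⟨χ, hχ⟩ := exists_radical_lie_eq_smul_of_isAtom hP
  have hχP := hχ x (center_le_radical K L hx)
  have htr : ∀ y ∈ ⁅(⊤ : LieIdeal K L), (⊤ : LieIdeal K L)⁆,
      LinearMap.trace K P (LieModule.toEnd K L P y) = 0 := by
    intro y hy
    rw [← LieSubmodule.mem_toSubmodule, LieSubmodule.lieIdeal_oper_eq_linear_span'] at hy
    induction hy using Submodule.span_induction with
    | mem u hu =>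
      obtain ⟨a, -, b, -, rfl⟩ := hu
      simp
    | zero => simp
    | add a b _ _ ha hb => rw [map_add, map_add, ha, hb, add_zero]
    | smul c a _ ha => rw [map_smul, map_smul, ha, smul_zero]
  have h1 : LieModule.toEnd K L P x = χ x • LinearMap.id := by
    ext u
    exact hχP u u.2
  have h2 := htr x hxD
  rw [h1, map_smul, LinearMap.trace_id, smul_eq_mul, mul_eq_zero, Nat.cast_eq_zero] at h2
  rw [LieModule.toEnd_apply_apply, hχP v hv]
  rcases h2 with h2 | h2
  · rw [h2, zero_smul]
  · have : Subsingleton P := finrank_zero_iff.1 h2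
    have : v = 0 := congrArg Subtype.val (Subsingleton.elim (⟨v, hv⟩ : P) 0)
    rw [this, smul_zero]

-- The preimage of an abelian ideal of the quotient has its derived ideal inside the radical, so it
-- is solvable and already lies in the radical.
omit [AddCommGroup V] [Module K V] [LieRingModule L V] [LieModule K L V] [FiniteDimensional K V]
  hss hfaith [CharZero K] [IsAlgClosed K] in
theorem hasTrivialRadical_quotient_radical : HasTrivialRadical K (L ⧸ radical K L) := by
  rw [hasTrivialRadical_iff_no_abelian_ideals]
  intro J hJ
  let π : L →ₗ[K] L ⧸ radical K L := (LieSubmodule.Quotient.mk' (radical K L) : L →ₗ[K] _)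
  have hπ : ∀ x y : L, π ⁅x, y⁆ = ⁅π x, π y⁆ := fun x y =>
    rfl
  have hπ0 : ∀ x : L, π x = 0 ↔ x ∈ radical K L := fun x => LieSubmodule.Quotient.mk_eq_zero _
  let J' : LieIdeal K L :=
    { J.toSubmodule.comap π with
      lie_mem := by
        intro x y hy
        change π ⁅x, y⁆ ∈ J
        rw [hπ]
        exact J.lie_mem hy }
  have hJ' : ∀ x, x ∈ J' ↔ π x ∈ J := fun x => Iff.rfl
  have h1 : derivedSeriesOfIdeal K L 1 J' ≤ radical K L := by
    rw [derivedSeriesOfIdeal_succ, derivedSeriesOfIdeal_zero, LieSubmodule.lieIdeal_oper_eq_span,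
      LieSubmodule.lieSpan_le]
    rintro _ ⟨⟨a, ha⟩, ⟨b, hb⟩, rfl⟩
    rw [SetLike.mem_coe, ← hπ0, hπ]
    exact congrArg Subtype.val (trivial_lie_zero J J ⟨π a, ha⟩ ⟨π b, hb⟩)
  obtain ⟨k, hk⟩ := IsSolvable.solvable K (radical K L)
  rw [LieIdeal.derivedSeries_eq_bot_iff] at hk
  have h2 : IsSolvable J' := by
    refine IsSolvable.mk (R := K) (k := k + 1) ?_
    rw [LieIdeal.derivedSeries_eq_bot_iff, derivedSeriesOfIdeal_add, eq_bot_iff, ← hk]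
    exact derivedSeriesOfIdeal_mono h1 k
  rw [LieIdeal.solvable_iff_le_radical] at h2
  rw [LieSubmodule.eq_bot_iff]
  intro y hy
  obtain ⟨x, rfl⟩ : ∃ x, π x = y := LieSubmodule.Quotient.surjective_mk' (radical K L) y
  exact (hπ0 x).2 (h2 hy)

-- The quotient by the radical is semisimple, hence perfect, and brackets in the quotient lift to
-- brackets in `L`.
omit [AddCommGroup V] [Module K V] [LieRingModule L V] [LieModule K L V] [FiniteDimensional K V]
  hss hfaith [IsAlgClosed K] in
theorem radical_sup_lie_top_top :
    (radical K L).toSubmodule ⊔ (⁅(⊤ : LieIdeal K L), (⊤ : LieIdeal K L)⁆ : LieIdeal K L).toSubmodule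
      = ⊤ := by
  have := hasTrivialRadical_quotient_radical (K := K) (L := L)
  have hperf := IsKilling.lie_top_top K (L ⧸ radical K L)
  let π : L →ₗ[K] L ⧸ radical K L := (LieSubmodule.Quotient.mk' (radical K L) : L →ₗ[K] _)
  have hπ : ∀ x y : L, π ⁅x, y⁆ = ⁅π x, π y⁆ := fun x y =>
    rfl
  have hπ0 : ∀ x : L, π x = 0 ↔ x ∈ radical K L := fun x => LieSubmodule.Quotient.mk_eq_zero _
  have hsurj : ∀ y, ∃ x, π x = y := LieSubmodule.Quotient.surjective_mk' (radical K L)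
  rw [eq_top_iff]
  intro x _
  have hx : π x ∈ ⁅(⊤ : LieIdeal K (L ⧸ radical K L)), (⊤ : LieIdeal K (L ⧸ radical K L))⁆ := by
    rw [hperf]; trivial
  have key : ∀ y ∈ ⁅(⊤ : LieIdeal K (L ⧸ radical K L)), (⊤ : LieIdeal K (L ⧸ radical K L))⁆,
      ∃ d ∈ ⁅(⊤ : LieIdeal K L), (⊤ : LieIdeal K L)⁆, π d = y := by
    intro y hy
    rw [← LieSubmodule.mem_toSubmodule, LieSubmodule.lieIdeal_oper_eq_linear_span'] at hy
    induction hy using Submodule.span_induction with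
    | mem u hu =>
      obtain ⟨a, -, b, -, rfl⟩ := hu
      obtain ⟨a, rfl⟩ := hsurj a
      obtain ⟨b, rfl⟩ := hsurj b
      exact ⟨⁅a, b⁆, LieSubmodule.lie_mem_lie trivial trivial, hπ a b⟩
    | zero => exact ⟨0, zero_mem _, map_zero _⟩
    | add a b _ _ ha hb =>
      obtain ⟨c, hc, rfl⟩ := ha
      obtain ⟨d, hd, rfl⟩ := hb
      exact ⟨c + d, add_mem hc hd, map_add _ _ _⟩
    | smul t a _ ha =>
      obtain ⟨c, hc, rfl⟩ := ha
      exact ⟨t • c, (LieSubmodule.toSubmodule _).smul_mem t hc, map_smul _ _ _⟩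
  obtain ⟨d, hd, hdx⟩ := key _ hx
  refine Submodule.mem_sup.2 ⟨x - d, ?_, d, hd, sub_add_cancel x d⟩
  exact (hπ0 _).1 (by rw [map_sub, hdx, sub_self])

omit [FiniteDimensional K V] in
theorem center_sup_lie_top_top [FiniteDimensional K V] :
    (center K L).toSubmodule ⊔ (⁅(⊤ : LieIdeal K L), (⊤ : LieIdeal K L)⁆ : LieIdeal K L).toSubmodule
      = ⊤ := by
  rw [← radical_eq_center_of_faithful hss hfaith, radical_sup_lie_top_top]

/-- The derived algebra of a Lie algebra with a faithful semisimple representation is semisimple. -/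
theorem isKilling_lie_top_top :
    IsKilling K (⁅(⊤ : LieIdeal K L), (⊤ : LieIdeal K L)⁆ : LieIdeal K L) := by
  set s : LieIdeal K L := ⁅(⊤ : LieIdeal K L), (⊤ : LieIdeal K L)⁆
  suffices HasTrivialRadical K s from inferInstance
  rw [hasTrivialRadical_iff_no_abelian_ideals]
  intro I hI
  -- `L` is the sum of `s` and the center, so ideals of `s` are ideals of `L`. An abelian one lies
  -- in the radical, that is, in the center, which meets `s` trivially.
  let I' : LieIdeal K L :=
    { I.toSubmodule.map (s.incl : s →ₗ[K] L) with
      lie_mem := by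
        rintro x _ ⟨u, hu, rfl⟩
        have hx : x ∈ (center K L).toSubmodule ⊔ s.toSubmodule :=
          (center_sup_lie_top_top hss hfaith).symm ▸ Submodule.mem_top
        obtain ⟨z, hz, y, hy, rfl⟩ := Submodule.mem_sup.1 hx
        have h0 : ⁅z, (u : L)⁆ = 0 := by
          rw [← lie_skew, (LieModule.mem_maxTrivSubmodule K L L z).1 hz u, neg_zero]
        refine ⟨⁅(⟨y, hy⟩ : s), u⁆, I.lie_mem hu, ?_⟩
        change ⁅y, (u : L)⁆ = ⁅z + y, (u : L)⁆
        rw [add_lie, h0, zero_add] }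
  have hab : IsLieAbelian I' := by
    refine ⟨?_⟩
    rintro ⟨_, ⟨u, hu, rfl⟩⟩ ⟨_, ⟨v, hv, rfl⟩⟩
    apply Subtype.ext
    exact congrArg (fun w : I => ((w : s) : L)) (trivial_lie_zero I I ⟨u, hu⟩ ⟨v, hv⟩)
  have hle : I' ≤ radical K L := (LieIdeal.solvable_iff_le_radical K L I').1 inferInstance
  rw [radical_eq_center_of_faithful hss hfaith] at hle
  rw [LieSubmodule.eq_bot_iff]
  intro u hu
  have h1 : (u : L) ∈ center K L := hle ⟨u, hu, rfl⟩
  exact Subtype.ext (center_inf_lie_top_top hss hfaith u h1 u.2)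

end

end LieAlgebra

end

section

/-! ### Internal direct sums of submodules -/

namespace DirectSum.IsInternal

variable {R ι M N : Type*} [CommRing R] [DecidableEq ι] [AddCommGroup M] [Module R M]
  [AddCommGroup N] [Module R N] {G : ι → Submodule R M}

theorem mem_induction (hG : DirectSum.IsInternal G) {p : M → Prop} (h : ∀ i, ∀ x ∈ G i, p x)
    (hadd : ∀ x y, p x → p y → p (x + y)) (h0 : p 0) (x : M) : p x := by
  have hx : x ∈ ⨆ i, G i := by
    rw [hG.submodule_iSup_eq_top]; trivial
  exact Submodule.iSup_induction G (motive := p) hx h h0 hadd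

theorem exists_linearMap (hG : DirectSum.IsInternal G) (f : ∀ i, G i →ₗ[R] N) :
    ∃ F : M →ₗ[R] N, ∀ i, ∀ x (hx : x ∈ G i), F x = f i ⟨x, hx⟩ := by
  let e := LinearEquiv.ofBijective (DirectSum.coeLinearMap G) hG
  refine ⟨DirectSum.toModule R ι N f ∘ₗ e.symm.toLinearMap, fun i x hx => ?_⟩
  have : e.symm x = DirectSum.lof R ι (fun i => G i) i ⟨x, hx⟩ := by
    rw [LinearEquiv.symm_apply_eq]
    exact (DirectSum.coeLinearMap_lof G i ⟨x, hx⟩).symm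
  simp [this]

theorem exists_proj (hG : DirectSum.IsInternal G) (i : ι) :
    ∃ π : M →ₗ[R] M, ∀ j, ∀ x ∈ G j, π x = if i = j then x else 0 := by
  obtain ⟨F, hF⟩ := hG.exists_linearMap (fun j => if i = j then (G j).subtype else 0)
  refine ⟨F, fun j x hx => ?_⟩
  rw [hF j x hx]
  split_ifs <;> simp

/-- The projection onto the `i`-th summand. -/
noncomputable def proj (hG : DirectSum.IsInternal G) (i : ι) : M →ₗ[R] M :=
  (hG.exists_proj i).choose

theorem proj_apply_of_mem (hG : DirectSum.IsInternal G) {i : ι} {x : M} (hx : x ∈ G i) :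
    hG.proj i x = x := by
  rw [proj, (hG.exists_proj i).choose_spec i x hx, if_pos rfl]

theorem proj_apply_of_ne (hG : DirectSum.IsInternal G) {i j : ι} (hij : i ≠ j) {x : M}
    (hx : x ∈ G j) : hG.proj i x = 0 := by
  rw [proj, (hG.exists_proj i).choose_spec j x hx, if_neg hij]

theorem proj_mem (hG : DirectSum.IsInternal G) (i : ι) (x : M) : hG.proj i x ∈ G i := by
  refine hG.mem_induction (p := fun x => hG.proj i x ∈ G i) (fun j x hx => ?_)
    (fun x y hx hy => by rw [map_add]; exact add_mem hx hy) (by simp) x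
  by_cases h : i = j
  · subst h; rwa [hG.proj_apply_of_mem hx]
  · rw [hG.proj_apply_of_ne h hx]; exact zero_mem _

theorem exists_eq_sum_proj (hG : DirectSum.IsInternal G) (x : M) :
    ∃ s : Finset ι, x = ∑ i ∈ s, hG.proj i x := by
  have key : ∀ x, ∃ s : Finset ι, x = ∑ i ∈ s, hG.proj i x ∧ ∀ i ∉ s, hG.proj i x = 0 := by
    refine hG.mem_induction (fun j x hx => ⟨{j}, by simp [hG.proj_apply_of_mem hx], fun i hi => ?_⟩)
      (fun x y ⟨s, hs, hs'⟩ ⟨t, ht, ht'⟩ => ⟨s ∪ t, ?_, ?_⟩) ⟨∅, by simp⟩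
    · exact hG.proj_apply_of_ne (by simpa using hi) hx
    · simp only [map_add, Finset.sum_add_distrib]
      rw [← Finset.sum_subset (Finset.subset_union_left : s ⊆ s ∪ t) (fun i _ hi => hs' i hi),
        ← Finset.sum_subset (Finset.subset_union_right : t ⊆ s ∪ t) (fun i _ hi => ht' i hi),
        ← hs, ← ht]
    · intro i hi
      simp only [Finset.mem_union, not_or] at hi
      rw [map_add, hs' i hi.1, ht' i hi.2, add_zero]
  exact ⟨(key x).choose, (key x).choose_spec.1⟩

theorem eq_zero_of_proj (hG : DirectSum.IsInternal G) {x : M} (hx : ∀ i, hG.proj i x = 0) :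
    x = 0 := by
  obtain ⟨s, hs⟩ := hG.exists_eq_sum_proj x
  rw [hs]
  exact Finset.sum_eq_zero fun i _ => hx i

theorem mem_of_proj (hG : DirectSum.IsInternal G) {x : M} {i : ι}
    (hx : ∀ j, j ≠ i → hG.proj j x = 0) : x ∈ G i := by
  have : x - hG.proj i x = 0 := by
    refine hG.eq_zero_of_proj fun j => ?_
    by_cases h : j = i
    · rw [h, map_sub, hG.proj_apply_of_mem (hG.proj_mem i x), sub_self]
    · rw [map_sub, hx j h, hG.proj_apply_of_ne h (hG.proj_mem i x), sub_self]
  rw [sub_eq_zero.1 this]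
  exact hG.proj_mem i x

/-- An operator acting on each summand by a scalar commutes with the projections. -/
theorem proj_apply_of_smul (hG : DirectSum.IsInternal G) {T : M →ₗ[R] M} {c : ι → R}
    (hT : ∀ i, ∀ x ∈ G i, T x = c i • x) (i : ι) (x : M) :
    hG.proj i (T x) = c i • hG.proj i x := by
  refine hG.mem_induction (p := fun x => hG.proj i (T x) = c i • hG.proj i x)
    (fun j x hx => ?_) (fun a b h h' => by simp only [map_add, h, h', smul_add]) (by simp) x
  rw [hT j x hx, map_smul]
  by_cases h : i = j
  · rw [h]
  · rw [hG.proj_apply_of_ne h hx, smul_zero, smul_zero]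

end DirectSum.IsInternal

namespace LieAlgebra

/-! ### Reductive Lie algebras graded by a root lattice -/

/-- On a Lie algebra with semisimple derived algebra, every derivation acts on the derived algebra
as an element of it. -/
theorem exists_lie_eq_derivation {K L : Type*} [Field K] [LieRing L] [LieAlgebra K L]
    [FiniteDimensional K L] [IsKilling K (⁅(⊤ : LieIdeal K L), (⊤ : LieIdeal K L)⁆ : LieIdeal K L)]
    (D : L →ₗ[K] L) (hD : ∀ x y, D ⁅x, y⁆ = ⁅D x, y⁆ + ⁅x, D y⁆) :
    ∃ t ∈ ⁅(⊤ : LieIdeal K L), (⊤ : LieIdeal K L)⁆,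
      ∀ x ∈ ⁅(⊤ : LieIdeal K L), (⊤ : LieIdeal K L)⁆, D x = ⁅t, x⁆ := by
  set s : LieIdeal K L := ⁅(⊤ : LieIdeal K L), (⊤ : LieIdeal K L)⁆ with hs
  have hDs : ∀ x ∈ s.toSubmodule, D x ∈ s.toSubmodule := by
    intro x hx
    rw [hs, LieSubmodule.lieIdeal_oper_eq_linear_span'] at hx
    induction hx using Submodule.span_induction with
    | mem x hx =>
      obtain ⟨a, -, b, -, rfl⟩ := hx
      rw [hD]
      exact add_mem (LieSubmodule.lie_mem_lie trivial trivial)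
        (LieSubmodule.lie_mem_lie trivial trivial)
    | zero => simp
    | add x y _ _ hx hy => rw [map_add]; exact add_mem hx hy
    | smul c x _ hx => rw [map_smul]; exact Submodule.smul_mem _ _ hx
  let D' : LieDerivation K s s :=
    { toLinearMap := D.restrict hDs
      leibniz' := by
        intro a b
        apply Subtype.ext
        have h1 := hD a b
        have h2 := lie_skew (b : L) (D a)
        change D ⁅(a : L), (b : L)⁆ = ⁅(a : L), D b⁆ - ⁅(b : L), D a⁆
        rw [h1, ← h2]; abel }
  obtain ⟨t, ht⟩ := LieDerivation.IsKilling.exists_eq_ad D'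
  refine ⟨t, t.2, fun x hx => ?_⟩
  have h1 := LieDerivation.congr_fun ht ⟨x, hx⟩
  rw [LieDerivation.ad_apply_apply] at h1
  exact (congrArg Subtype.val h1).symm

/-- The operator acting on `G q` by the `i`-th coordinate of `q` is a derivation. -/
theorem exists_degree_derivation {K L : Type*} [Field K] [LieRing L] [LieAlgebra K L] {r : ℕ}
    {G : (Fin r → ℤ) → Submodule K L} (hG : DirectSum.IsInternal G)
    (hlie : ∀ p q x y, x ∈ G p → y ∈ G q → ⁅x, y⁆ ∈ G (p + q)) (i : Fin r) :
    ∃ D : L →ₗ[K] L, (∀ x y, D ⁅x, y⁆ = ⁅D x, y⁆ + ⁅x, D y⁆) ∧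
      ∀ q, ∀ x ∈ G q, D x = (q i : K) • x := by
  obtain ⟨D, hD⟩ := hG.exists_linearMap (fun q => (q i : K) • (G q).subtype)
  have hD' : ∀ q, ∀ x ∈ G q, D x = (q i : K) • x := fun q x hx => hD q x hx
  refine ⟨D, fun x y => ?_, hD'⟩
  refine hG.mem_induction (p := fun x => D ⁅x, y⁆ = ⁅D x, y⁆ + ⁅x, D y⁆) (fun p x hx => ?_)
    (fun x x' h h' => by simp only [add_lie, map_add, h, h']; abel) (by simp) x
  refine hG.mem_induction (p := fun y => D ⁅x, y⁆ = ⁅D x, y⁆ + ⁅x, D y⁆) (fun q y hy => ?_)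
    (fun x x' h h' => by simp only [lie_add, map_add, h, h']; abel) (by simp) y
  rw [hD' p x hx, hD' q y hy, hD' _ _ (hlie p q x y hx hy), Pi.add_apply, smul_lie, lie_smul,
    ← add_smul, Int.cast_add]

variable {K L : Type*} [Field K] [LieRing L] [LieAlgebra K L] {r : ℕ}

/-- `G` is the root decomposition of the reductive Lie algebra `L` with respect to the abelian
subalgebra `G 0`, graded by a lattice. -/
structure IsReductiveGrading (G : (Fin r → ℤ) → Submodule K L)
    (wt : (Fin r → ℤ) →+ Module.Dual K (G 0)) : Prop where
  internal : DirectSum.IsInternal G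
  lie_mem : ∀ p q x y, x ∈ G p → y ∈ G q → ⁅x, y⁆ ∈ G (p + q)
  abelian : ∀ x ∈ G 0, ∀ y ∈ G 0, ⁅x, y⁆ = 0
  lie_cartan : ∀ (h : G 0), ∀ q, ∀ x ∈ G q, ⁅(h : L), x⁆ = wt q h • x
  center_le : (center K L).toSubmodule ≤ G 0
  isKilling : IsKilling K (⁅(⊤ : LieIdeal K L), (⊤ : LieIdeal K L)⁆ : LieIdeal K L)
  center_sup : (center K L).toSubmodule ⊔
    (⁅(⊤ : LieIdeal K L), (⊤ : LieIdeal K L)⁆ : LieIdeal K L).toSubmodule = ⊤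

namespace IsReductiveGrading

variable {G : (Fin r → ℤ) → Submodule K L} {wt : (Fin r → ℤ) →+ Module.Dual K (G 0)}
  (hG : IsReductiveGrading G wt)
include hG

theorem proj_mem_lie_top_top (q : Fin r → ℤ) {x : L}
    (hx : x ∈ ⁅(⊤ : LieIdeal K L), (⊤ : LieIdeal K L)⁆) :
    hG.internal.proj q x ∈ ⁅(⊤ : LieIdeal K L), (⊤ : LieIdeal K L)⁆ := by
  rw [← LieSubmodule.mem_toSubmodule] at hx ⊢
  rw [LieSubmodule.lieIdeal_oper_eq_linear_span'] at hx
  induction hx using Submodule.span_induction with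
  | mem x hx =>
    obtain ⟨a, -, b, -, rfl⟩ := hx
    refine hG.internal.mem_induction (p := fun a => hG.internal.proj q ⁅a, b⁆ ∈
      (⁅(⊤ : LieIdeal K L), (⊤ : LieIdeal K L)⁆ : LieIdeal K L).toSubmodule) (fun p a ha => ?_)
      (fun x x' h h' => by rw [add_lie, map_add]; exact add_mem h h') (by simp) a
    refine hG.internal.mem_induction (p := fun b => hG.internal.proj q ⁅a, b⁆ ∈
      (⁅(⊤ : LieIdeal K L), (⊤ : LieIdeal K L)⁆ : LieIdeal K L).toSubmodule) (fun p' b hb => ?_)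
      (fun x x' h h' => by rw [lie_add, map_add]; exact add_mem h h') (by simp) b
    have hab := hG.lie_mem p p' a b ha hb
    by_cases h : q = p + p'
    · rw [h, hG.internal.proj_apply_of_mem hab]
      exact LieSubmodule.lie_mem_lie trivial trivial
    · rw [hG.internal.proj_apply_of_ne h hab]; exact zero_mem _
  | zero => simp
  | add x y _ _ hx hy => rw [map_add]; exact add_mem hx hy
  | smul c x _ hx => rw [map_smul]; exact Submodule.smul_mem _ _ hx

/-- The `i`-th coordinate of the degree is an inner derivation, by an element of the Cartan
subalgebra. -/
theorem exists_degree_element [FiniteDimensional K L] (i : Fin r) :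
    ∃ t ∈ G 0, t ∈ ⁅(⊤ : LieIdeal K L), (⊤ : LieIdeal K L)⁆ ∧
      ∀ q, ∀ x ∈ G q, ⁅t, x⁆ = (q i : K) • x := by
  have := hG.isKilling
  obtain ⟨D, hD, hDG⟩ := exists_degree_derivation hG.internal hG.lie_mem i
  obtain ⟨t, ht, htD⟩ := exists_lie_eq_derivation D hD
  set π := hG.internal.proj
  -- The degree derivation preserves degrees, so the degree-zero component of `t` induces it just as
  -- well, and this component lies in the Cartan subalgebra.
  have hlie : ∀ p, ∀ x ∈ G p, ∀ t, ⁅π 0 t, x⁆ = π p ⁅t, x⁆ := by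
    intro p x hx t
    refine hG.internal.mem_induction (p := fun t => ⁅π 0 t, x⁆ = π p ⁅t, x⁆) (fun q t ht => ?_)
      (fun a b h h' => by simp only [map_add, add_lie, h, h']) (by simp) t
    have h1 := hG.lie_mem q p t x ht hx
    by_cases hq : q = 0
    · subst hq
      rw [hG.internal.proj_apply_of_mem ht, hG.internal.proj_apply_of_mem (by simpa using h1)]
    · rw [hG.internal.proj_apply_of_ne (Ne.symm hq) ht, zero_lie,
        hG.internal.proj_apply_of_ne (by simpa using hq) h1]
  refine ⟨π 0 t, hG.internal.proj_mem 0 t, hG.proj_mem_lie_top_top 0 ht, ?_⟩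
  -- So far the two derivations agree only on the derived algebra. They agree on the center too,
  -- where both vanish: central elements have degree zero.
  have hfin : ∀ x, ⁅π 0 t, x⁆ = D x := by
    intro x
    have hx : x ∈ (center K L).toSubmodule ⊔
      (⁅(⊤ : LieIdeal K L), (⊤ : LieIdeal K L)⁆ : LieIdeal K L).toSubmodule := by
      rw [hG.center_sup]; trivial
    obtain ⟨z, hz, y, hy, rfl⟩ := Submodule.mem_sup.1 hx
    have hz0 : ⁅π 0 t, z⁆ = D z := by
      rw [hDG 0 z (hG.center_le hz)]
      have : ∀ u : L, ⁅u, z⁆ = 0 := fun u => (LieModule.mem_maxTrivSubmodule K L L z).1 hz u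
      rw [this]; simp
    have hy0 : ∀ q, ⁅π 0 t, π q y⁆ = D (π q y) := by
      intro q
      have h1 := hG.internal.proj_mem q y
      rw [hlie q _ h1, ← htD _ (hG.proj_mem_lie_top_top q hy), hDG q _ h1, map_smul,
        hG.internal.proj_apply_of_mem h1]
    obtain ⟨s, hs⟩ := hG.internal.exists_eq_sum_proj y
    rw [lie_add, map_add, hz0]
    congr 1
    rw [hs, lie_sum, map_sum]
    exact Finset.sum_congr rfl fun q _ => hy0 q
  intro q x hx
  rw [hfin, hDG q x hx]

/-- The Cartan subalgebra `s ∩ G 0` of the derived algebra `s`. -/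
def cartan : LieSubalgebra K (⁅(⊤ : LieIdeal K L), (⊤ : LieIdeal K L)⁆ : LieIdeal K L) where
  toSubmodule := (G 0).comap
    (⁅(⊤ : LieIdeal K L), (⊤ : LieIdeal K L)⁆ : LieIdeal K L).toSubmodule.subtype
  lie_mem' := by
    intro x y hx hy
    have := hG.lie_mem 0 0 _ _ hx hy
    rwa [add_zero] at this

/-- In characteristic zero the eigenvalues of the degree elements separate the points of the
lattice. -/
theorem mem_of_degree_elements [CharZero K] {t : Fin r → L}
    (ht : ∀ i, ∀ q, ∀ x ∈ G q, ⁅t i, x⁆ = (q i : K) • x) {p : Fin r → ℤ} {x : L}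
    (hx : ∀ i, ⁅t i, x⁆ - (p i : K) • x = 0) : x ∈ G p := by
  refine hG.internal.mem_of_proj fun q hq => ?_
  obtain ⟨i, hi⟩ := Function.ne_iff.1 hq
  have := congrArg (hG.internal.proj q) (hx i)
  have h2 := hG.internal.proj_apply_of_smul (T := LieModule.toEnd K L L (t i))
    (c := fun q => (q i : K)) (ht i) q x
  rw [LieModule.toEnd_apply_apply] at h2
  rw [map_sub, h2, map_smul, map_zero, ← sub_smul, smul_eq_zero] at this
  refine this.resolve_left (sub_ne_zero.2 ?_)
  exact_mod_cast hi

/-- Bracketing with a degree element multiplies the component of degree `q` by a coordinate of `q`.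
If all these brackets have degree zero, as for an element of the normalizer, then they vanish and
the element itself has degree zero. -/
theorem isCartanSubalgebra [CharZero K] [FiniteDimensional K L] : hG.cartan.IsCartanSubalgebra where
  nilpotent := by
    have : IsLieAbelian hG.cartan := by
      refine ⟨fun x y => ?_⟩
      apply Subtype.ext; apply Subtype.ext
      exact hG.abelian _ x.2 _ y.2
    infer_instance
  self_normalizing := by
    choose t ht0 hts ht using hG.exists_degree_element
    refine le_antisymm (fun x hx => ?_) (LieSubalgebra.le_normalizer _)
    rw [LieSubalgebra.mem_normalizer_iff] at hx
    change (x : L) ∈ G 0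
    refine hG.mem_of_degree_elements ht fun i => ?_
    have h1 : ⁅(x : L), t i⁆ ∈ G 0 := hx ⟨t i, hts i⟩ (ht0 i)
    simp only [Pi.zero_apply, Int.cast_zero, zero_smul, sub_zero]
    have h3 : ⁅t i, (x : L)⁆ ∈ G 0 := by
      rw [← lie_skew]; exact neg_mem h1
    refine hG.internal.eq_zero_of_proj fun q => ?_
    by_cases hq : q = 0
    · have h2 := hG.internal.proj_apply_of_smul (T := LieModule.toEnd K L L (t i))
        (c := fun q => (q i : K)) (ht i) q x
      rw [LieModule.toEnd_apply_apply] at h2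
      rw [h2, hq]; simp
    · exact hG.internal.proj_apply_of_ne hq h3

end IsReductiveGrading

end LieAlgebra

end

section

open Module

/-! ### Roots and sl₂-triples of a reductive grading. -/

namespace LieAlgebra.IsReductiveGrading

variable {K L : Type*} [Field K] [CharZero K] [IsAlgClosed K] [LieRing L] [LieAlgebra K L]
  [FiniteDimensional K L] {r : ℕ} {G : (Fin r → ℤ) → Submodule K L}
  {wt : (Fin r → ℤ) →+ Module.Dual K (G 0)} (hG : IsReductiveGrading G wt)
include hG

omit [CharZero K] [IsAlgClosed K] [FiniteDimensional K L] in
theorem wt_eq_of_ne_bot {q : Fin r → ℤ} (hq : G q ≠ ⊥) {h : L} (hh : h ∈ G 0) {c : K}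
    (hc : ∀ x ∈ G q, ⁅h, x⁆ = c • x) : wt q ⟨h, hh⟩ = c := by
  obtain ⟨x, hx, hx0⟩ := (Submodule.ne_bot_iff _).1 hq
  have := hG.lie_cartan ⟨h, hh⟩ q x hx
  rw [hc x hx] at this
  exact (smul_left_injective K hx0 this).symm

omit [IsAlgClosed K] in
theorem mem_lie_top_top {q : Fin r → ℤ} (hq : q ≠ 0) {x : L} (hx : x ∈ G q) :
    x ∈ ⁅(⊤ : LieIdeal K L), (⊤ : LieIdeal K L)⁆ := by
  obtain ⟨i, hi⟩ := Function.ne_iff.1 hq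
  obtain ⟨t, -, -, ht⟩ := hG.exists_degree_element i
  have h1 : x = (q i : K)⁻¹ • ⁅t, x⁆ := by
    rw [ht q x hx, smul_smul, inv_mul_cancel₀ (by exact_mod_cast hi), one_smul]
  rw [h1, ← LieSubmodule.mem_toSubmodule]
  exact Submodule.smul_mem _ _ (LieSubmodule.lie_mem_lie trivial trivial)

/-- The weight of the Cartan subalgebra `s ∩ G 0` given by `q`. -/
def rootFun (q : Fin r → ℤ) (h : hG.cartan) : K := wt q ⟨(h : L), h.2⟩

/-- The bridge to the structure theory of Killing Lie algebras. The degree elements belong to the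
Cartan subalgebra of the derived algebra, so a weight there determines the lattice degree. -/
theorem mem_rootSpace_iff {q : Fin r → ℤ} (hq : G q ≠ ⊥)
    (x : (⁅(⊤ : LieIdeal K L), (⊤ : LieIdeal K L)⁆ : LieIdeal K L)) :
    haveI := hG.isCartanSubalgebra
    x ∈ rootSpace hG.cartan (hG.rootFun q) ↔ (x : L) ∈ G q := by
  have := hG.isCartanSubalgebra
  have := hG.isKilling
  constructor
  · intro hx
    choose t ht0 hts ht using hG.exists_degree_element
    refine hG.mem_of_degree_elements ht fun i => ?_
    have h1 := IsKilling.lie_eq_smul_of_mem_rootSpace hx ⟨⟨t i, hts i⟩, ht0 i⟩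
    have h2 : hG.rootFun q ⟨⟨t i, hts i⟩, ht0 i⟩ = (q i : K) :=
      hG.wt_eq_of_ne_bot hq (ht0 i) (ht i q)
    rw [h2] at h1
    exact sub_eq_zero.2 (congrArg Subtype.val h1)
  · intro hx
    refine LieModule.weightSpace_le_genWeightSpace _ _ ?_
    rw [LieModule.mem_weightSpace]
    intro h
    apply Subtype.ext
    exact hG.lie_cartan ⟨(h : L), h.2⟩ q x hx

omit [IsAlgClosed K] in
theorem rootFun_ne_zero {q : Fin r → ℤ} (hq0 : q ≠ 0) (hq : G q ≠ ⊥) : hG.rootFun q ≠ 0 := by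
  obtain ⟨i, hi⟩ := Function.ne_iff.1 hq0
  obtain ⟨t, ht0, hts, ht⟩ := hG.exists_degree_element i
  intro h
  have h1 := congrFun h ⟨⟨t, hts⟩, ht0⟩
  have h2 : hG.rootFun q ⟨⟨t, hts⟩, ht0⟩ = (q i : K) := hG.wt_eq_of_ne_bot hq ht0 (ht q)
  rw [h2] at h1
  exact hi (Int.cast_eq_zero.1 h1)

theorem exists_weight {q : Fin r → ℤ} (hq0 : q ≠ 0) (hq : G q ≠ ⊥) :
    haveI := hG.isCartanSubalgebra
    ∃ α : LieModule.Weight K hG.cartan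
      (⁅(⊤ : LieIdeal K L), (⊤ : LieIdeal K L)⁆ : LieIdeal K L),
      (α : hG.cartan → K) = hG.rootFun q ∧ α.IsNonZero := by
  have := hG.isCartanSubalgebra
  obtain ⟨x, hx, hx0⟩ := (Submodule.ne_bot_iff _).1 hq
  refine ⟨⟨hG.rootFun q, ?_⟩, rfl, fun h => hG.rootFun_ne_zero hq0 hq h⟩
  intro h
  have h1 := (hG.mem_rootSpace_iff hq ⟨x, hG.mem_lie_top_top hq0 hx⟩).2 hx
  rw [rootSpace, h, LieSubmodule.mem_bot] at h1
  exact hx0 (congrArg Subtype.val h1)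

/-- Each root `q` has an `sl₂`-triple. -/
theorem exists_isSl2Triple {q : Fin r → ℤ} (hq0 : q ≠ 0) (hq : G q ≠ ⊥) :
    ∃ h ∈ G 0, ∃ e ∈ G q, ∃ f ∈ G (-q), IsSl2Triple h e f := by
  have := hG.isCartanSubalgebra
  have := hG.isKilling
  obtain ⟨α, hα, hα0⟩ := hG.exists_weight hq0 hq
  obtain ⟨h, e, f, hef, he, hf⟩ := IsKilling.exists_isSl2Triple_of_weight_isNonZero hα0
  rw [hα] at he hf
  have he' := (hG.mem_rootSpace_iff hq e).1 he
  have hf' : (f : L) ∈ G (-q) := by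
    choose t ht0 hts ht using hG.exists_degree_element
    refine hG.mem_of_degree_elements ht fun i => ?_
    have h1 := IsKilling.lie_eq_smul_of_mem_rootSpace hf ⟨⟨t i, hts i⟩, ht0 i⟩
    have h2 : hG.rootFun q ⟨⟨t i, hts i⟩, ht0 i⟩ = (q i : K) :=
      hG.wt_eq_of_ne_bot hq (ht0 i) (ht i q)
    rw [Pi.neg_apply, h2] at h1
    rw [Pi.neg_apply, Int.cast_neg]
    exact sub_eq_zero.2 (congrArg Subtype.val h1)
  have hef' : IsSl2Triple (h : L) e f :=
    ⟨fun h0 => hef.h_ne_zero (Subtype.ext h0), congrArg Subtype.val hef.lie_e_f,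
      congrArg Subtype.val hef.lie_h_e_nsmul, congrArg Subtype.val hef.lie_h_f_nsmul⟩
  refine ⟨h, ?_, e, he', f, hf', hef'⟩
  rw [← hef'.lie_e_f]
  simpa using hG.lie_mem _ _ _ _ he' hf'

theorem neg_ne_bot {q : Fin r → ℤ} (hq0 : q ≠ 0) (hq : G q ≠ ⊥) : G (-q) ≠ ⊥ := by
  obtain ⟨h, -, e, -, f, hf, hef⟩ := hG.exists_isSl2Triple hq0 hq
  exact (Submodule.ne_bot_iff _).2 ⟨f, hf, hef.f_ne_zero⟩

/-- Root spaces are one-dimensional. -/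
theorem exists_eq_smul {q : Fin r → ℤ} (hq0 : q ≠ 0) {x y : L} (hx : x ∈ G q) (hx0 : x ≠ 0)
    (hy : y ∈ G q) : ∃ c : K, y = c • x := by
  have := hG.isCartanSubalgebra
  have := hG.isKilling
  have hq : G q ≠ ⊥ := (Submodule.ne_bot_iff _).2 ⟨x, hx, hx0⟩
  obtain ⟨α, hα, hα0⟩ := hG.exists_weight hq0 hq
  have h1 := IsKilling.finrank_rootSpace_eq_one α hα0
  rw [hα] at h1
  have hxm := (hG.mem_rootSpace_iff hq ⟨x, hG.mem_lie_top_top hq0 hx⟩).2 hx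
  have hym := (hG.mem_rootSpace_iff hq ⟨y, hG.mem_lie_top_top hq0 hy⟩).2 hy
  obtain ⟨c, hc⟩ := (finrank_eq_one_iff_of_nonzero' (⟨_, hxm⟩ : rootSpace hG.cartan (hG.rootFun q))
    (fun h => hx0 (congrArg Subtype.val (congrArg Subtype.val h)))).1 h1 ⟨_, hym⟩
  exact ⟨c, (congrArg Subtype.val (congrArg Subtype.val hc)).symm⟩

/-- The bracket of two root spaces is not zero if the sum of the roots is a root. -/
theorem exists_lie_ne_zero {p q : Fin r → ℤ} (hp0 : p ≠ 0) (hq0 : q ≠ 0) (hpq0 : p + q ≠ 0)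
    (hp : G p ≠ ⊥) (hq : G q ≠ ⊥) (hpq : G (p + q) ≠ ⊥) : ∃ x ∈ G p, ∃ y ∈ G q, ⁅x, y⁆ ≠ 0 := by
  have := hG.isCartanSubalgebra
  have := hG.isKilling
  by_contra! hcon
  obtain ⟨h, hh, e, he, f, hf, hef⟩ := hG.exists_isSl2Triple hp0 hp
  obtain ⟨b, hb, hb0⟩ := (Submodule.ne_bot_iff _).1 hq
  obtain ⟨c, hc, hc0⟩ := (Submodule.ne_bot_iff _).1 (hG.neg_ne_bot hpq0 hpq)
  have hwp : wt p ⟨h, hh⟩ = 2 := by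
    have h1 := hG.lie_cartan ⟨h, hh⟩ p e he
    have h2 := hef.lie_h_e_smul K
    rw [show ⁅((⟨h, hh⟩ : G 0) : L), e⁆ = ⁅h, e⁆ from rfl, h2] at h1
    exact (smul_left_injective K hef.e_ne_zero h1).symm
  have hbp : hef.HasPrimitiveVectorWith b (wt q ⟨h, hh⟩) :=
    ⟨hb0, hG.lie_cartan ⟨h, hh⟩ q b hb, hcon e he b hb⟩
  obtain ⟨n, hn⟩ := hbp.exists_nat
  -- Otherwise `c`, of degree `-(p + q)`, would be a primitive vector of weight `-(n + 2)`, which is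
  -- negative.
  have hec : ⁅e, c⁆ ≠ 0 := by
    intro hec
    have hcp : hef.HasPrimitiveVectorWith c (wt (-(p + q)) ⟨h, hh⟩) :=
      ⟨hc0, hG.lie_cartan ⟨h, hh⟩ _ c hc, hec⟩
    obtain ⟨m, hm⟩ := hcp.exists_nat
    rw [map_neg, map_add, LinearMap.neg_apply, LinearMap.add_apply, hwp, hn] at hm
    have : ((m + n + 2 : ℕ) : K) = 0 := by push_cast; rw [← hm]; ring
    rw [Nat.cast_eq_zero] at this
    omega
  have hecm : ⁅e, c⁆ ∈ G (-q) := by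
    have := hG.lie_mem _ _ _ _ he hc
    rwa [show p + -(p + q) = -q by abel] at this
  let s : LieIdeal K L := ⁅(⊤ : LieIdeal K L), (⊤ : LieIdeal K L)⁆
  let e' : s := ⟨e, hG.mem_lie_top_top hp0 he⟩
  let c' : s := ⟨c, hG.mem_lie_top_top (neg_ne_zero.2 hpq0) hc⟩
  have hecm' : ⁅e', c'⁆ ∈ rootSpace hG.cartan (hG.rootFun (-q)) :=
    (hG.mem_rootSpace_iff (hG.neg_ne_bot hq0 hq) ⁅e', c'⁆).2 hecm
  -- If `G p` and `G q` commute, invariance of the Killing form makes `⁅e, c⁆` orthogonal to the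
  -- opposite root space, hence to everything.
  have hker := mem_ker_killingForm_of_mem_rootSpace_of_forall_rootSpace_neg K s hG.cartan hecm' (by
    intro y hy
    have hroot : -hG.rootFun (-q) = hG.rootFun q := by
      funext x; simp [rootFun]
    rw [hroot, hG.mem_rootSpace_iff hq] at hy
    have h0 : ⁅e', y⁆ = 0 := Subtype.ext (hcon e he y hy)
    rw [← lie_skew, map_neg, LinearMap.neg_apply, killingForm,
      LieModule.traceForm_apply_lie_apply, h0, map_zero, neg_zero])
  rw [IsKilling.ker_killingForm_eq_bot, Submodule.mem_bot] at hker
  exact hec (congrArg Subtype.val hker)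

/-- The negative root spaces lie in every subalgebra containing those of the negatives of the
indecomposable positive roots. -/
theorem neg_le_of_indecomposable (N : LieSubalgebra K L)
    (hN : ∀ q, 0 ≤ q → q ≠ 0 → G q ≠ ⊥ →
      (∀ q₁ q₂, 0 ≤ q₁ → q₁ ≠ 0 → G q₁ ≠ ⊥ → 0 ≤ q₂ → q₂ ≠ 0 → G q₂ ≠ ⊥ → q ≠ q₁ + q₂) →
      G (-q) ≤ N.toSubmodule) (q : Fin r → ℤ) (hq : 0 ≤ q) (hq0 : q ≠ 0) :
    G (-q) ≤ N.toSubmodule := by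
  -- The height is positive on positive roots and drops when a root is decomposed, so it serves for
  -- the induction.
  have hpos : ∀ q : Fin r → ℤ, 0 ≤ q → q ≠ 0 → 0 < ∑ i, q i := by
    intro q hq hq0
    obtain ⟨i, hi⟩ := Function.ne_iff.1 hq0
    exact Finset.sum_pos' (fun i _ => hq i) ⟨i, Finset.mem_univ i, lt_of_le_of_ne (hq i) (Ne.symm hi)⟩
  obtain ⟨n, hn⟩ : ∃ n : ℕ, (∑ i, q i).toNat ≤ n := ⟨_, le_rfl⟩
  induction n generalizing q with
  | zero => have := hpos q hq hq0; omega
  | succ n ih =>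
    by_cases hqb : G (-q) = ⊥
    · rw [hqb]; exact bot_le
    have hqb' : G q ≠ ⊥ := by simpa using hG.neg_ne_bot (neg_ne_zero.2 hq0) hqb
    by_cases hind : ∀ q₁ q₂, 0 ≤ q₁ → q₁ ≠ 0 → G q₁ ≠ ⊥ → 0 ≤ q₂ → q₂ ≠ 0 → G q₂ ≠ ⊥ → q ≠ q₁ + q₂
    · exact hN q hq hq0 hqb' hind
    push Not at hind
    obtain ⟨q₁, q₂, h1, h10, h1b, h2, h20, h2b, rfl⟩ := hind
    have hs : ∑ i, (q₁ + q₂) i = ∑ i, q₁ i + ∑ i, q₂ i := by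
      simp [Finset.sum_add_distrib]
    have hp1 := hpos q₁ h1 h10
    have hp2 := hpos q₂ h2 h20
    have hsum : -(q₁ + q₂) = -q₁ + -q₂ := by abel
    -- A nonzero bracket of two smaller negative root spaces spans the target, which is
    -- one-dimensional.
    obtain ⟨x, hx, y, hy, hxy⟩ := hG.exists_lie_ne_zero (neg_ne_zero.2 h10) (neg_ne_zero.2 h20)
      (by rw [← hsum]; exact neg_ne_zero.2 hq0) (hG.neg_ne_bot h10 h1b) (hG.neg_ne_bot h20 h2b)
      (by rwa [← hsum])
    intro z hz
    have hxyN : ⁅x, y⁆ ∈ N := N.lie_mem (ih q₁ h1 h10 (by omega) hx) (ih q₂ h2 h20 (by omega) hy)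
    have hxym := hG.lie_mem _ _ _ _ hx hy
    rw [← hsum] at hxym
    obtain ⟨c, rfl⟩ := hG.exists_eq_smul (neg_ne_zero.2 hq0) hxym hxy hz
    exact N.toSubmodule.smul_mem c hxyN

end LieAlgebra.IsReductiveGrading

end

section

open scoped TensorProduct
open LieSuperalgebra

namespace LieSuperalgebra

/-! ### The bracket and the even part of a Lie superalgebra -/

section Basics

variable {L : Type*} [AddCommGroup L] [Module ℂ L] [LieSuperalgebra L]

theorem zmod_two_cases (j : ZMod 2) : j = 0 ∨ j = 1 := by revert j; decide

theorem koszulSign_zero_left (i : ZMod 2) : koszulSign 0 i = 1 := by simp [koszulSign]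

theorem exists_add_mem_part (x : L) : ∃ y ∈ part (L := L) 0, ∃ z ∈ part (L := L) 1, x = y + z := by
  have hx : x ∈ part (L := L) 0 ⊔ part 1 := by
    rw [LieSuperalgebra.isCompl.sup_eq_top]; trivial
  obtain ⟨y, hy, z, hz, h⟩ := Submodule.mem_sup.1 hx
  exact ⟨y, hy, z, hz, h.symm⟩

theorem part_induction {p : L → Prop} (h : ∀ i, ∀ x ∈ part (L := L) i, p x)
    (hadd : ∀ x y, p x → p y → p (x + y)) (x : L) : p x := by
  obtain ⟨y, hy, z, hz, rfl⟩ := exists_add_mem_part x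
  exact hadd y z (h 0 y hy) (h 1 z hz)

theorem br_jacobi_of_mem {i j : ZMod 2} {x y : L} (hx : x ∈ part i) (hy : y ∈ part j) (z : L) :
    br x (br y z) = br (br x y) z + koszulSign i j • br y (br x z) := by
  refine part_induction (p := fun z => br x (br y z) = br (br x y) z + koszulSign i j • br y (br x z))
    (fun k z hz => br_jacobi i j k x y z hx hy hz)
    (fun a b h h' => by simp only [map_add, h, h', smul_add]; abel) z

theorem br_jacobi_of_even {x : L} (hx : x ∈ part (L := L) 0) (y z : L) :
    br x (br y z) = br (br x y) z + br y (br x z) := by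
  refine part_induction (p := fun y => br x (br y z) = br (br x y) z + br y (br x z))
    (fun j y hy => ?_) (fun a b h h' => by simp only [map_add, LinearMap.add_apply, h, h']; abel) y
  rw [br_jacobi_of_mem hx hy, koszulSign_zero_left, one_smul]

theorem br_skew_of_even {x : L} (hx : x ∈ part (L := L) 0) (y : L) : br x y = -br y x := by
  refine part_induction (p := fun y => br x y = -br y x)
    (fun j y hy => ?_) (fun a b h h' => by simp only [map_add, LinearMap.add_apply, h, h']; abel) y
  rw [br_skew 0 j x y hx hy, koszulSign_zero_left, one_smul]

theorem br_mem_part_of_even {x : L} (hx : x ∈ part (L := L) 0) {j : ZMod 2} {y : L}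
    (hy : y ∈ part j) : br x y ∈ part j := by
  simpa using br_mem 0 j x y hx hy

theorem subset_generated (s : Set L) : s ⊆ generated s :=
  fun x hx => by
    rw [generated, SetLike.mem_coe, Submodule.mem_sInf]
    exact fun N hN => hN.1 hx

theorem br_mem_generated {s : Set L} {x y : L} (hx : x ∈ generated s) (hy : y ∈ generated s) :
    br x y ∈ generated s := by
  rw [generated, Submodule.mem_sInf] at *
  exact fun N hN => hN.2 _ (hx N hN) _ (hy N hN)

theorem generated_le {s : Set L} {N : Submodule ℂ L} (hs : s ⊆ N)
    (hN : ∀ x ∈ N, ∀ y ∈ N, br x y ∈ N) : generated s ≤ N :=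
  sInf_le ⟨hs, hN⟩

/-- To prove closure of a span under the bracket it suffices to consider generators. -/
theorem br_mem_of_span {s t : Set L} {N : Submodule ℂ L} (h : ∀ x ∈ s, ∀ y ∈ t, br x y ∈ N)
    {x y : L} (hx : x ∈ Submodule.span ℂ s) (hy : y ∈ Submodule.span ℂ t) : br x y ∈ N := by
  have h1 : ∀ x ∈ s, br x y ∈ N := fun x hx => by
    have : Submodule.span ℂ t ≤ N.comap (br x) := Submodule.span_le.2 fun y hy => h x hx y hy
    exact this hy
  have : Submodule.span ℂ s ≤ N.comap ((br (L := L)).flip y) :=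
    Submodule.span_le.2 fun x hx => h1 x hx
  exact this hx

instance evenLieRing : LieRing (part (L := L) 0) where
  bracket x y := ⟨br (x : L) y, by simpa using br_mem 0 0 (x : L) y x.2 y.2⟩
  add_lie x y z := Subtype.ext (by change br ((x : L) + y) _ = br _ _ + br _ _; simp)
  lie_add x y z := Subtype.ext (map_add (br (x : L)) _ _)
  lie_self x := by
    apply Subtype.ext
    change br (x : L) x = 0
    have h := br_skew_of_even x.2 (x : L)
    have h2 : (2 : ℂ) • br (x : L) x = 0 := by
      rw [two_smul]; nth_rewrite 1 [h]; simp
    exact (smul_eq_zero.1 h2).resolve_left two_ne_zero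
  leibniz_lie x y z := Subtype.ext (br_jacobi_of_even x.2 (y : L) z)

instance evenLieAlgebra : LieAlgebra ℂ (part (L := L) 0) where
  lie_smul c x y := Subtype.ext (by change br (x : L) (c • (y : L)) = c • br (x : L) y; simp)

theorem coe_even_lie (x y : part (L := L) 0) : ((⁅x, y⁆ : part (L := L) 0) : L) = br (x : L) y :=
  rfl

/-- `L` as a module over its even part. -/
instance evenLieRingModule : LieRingModule (part (L := L) 0) L where
  bracket x y := br (x : L) y
  add_lie x y z := by change br ((x : L) + y) _ = br _ _ + br _ _; simp
  lie_add x y z := map_add (br (x : L)) _ _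
  leibniz_lie x y z := br_jacobi_of_even x.2 (y : L) z

instance evenLieModule : LieModule ℂ (part (L := L) 0) L where
  smul_lie c x y := by change br (c • (x : L)) y = c • br (x : L) y; simp
  lie_smul c x y := by change br (x : L) (c • y) = c • br (x : L) y; simp

variable (L) in
/-- The component `L i` as a module over the even part. -/
def partSubmodule (i : ZMod 2) : LieSubmodule ℂ (part (L := L) 0) L where
  toSubmodule := part i
  lie_mem {x _} hm := br_mem_part_of_even x.2 hm

end Basics

/-! ### The root decomposition -/

namespace SimpleRoots

variable {g : Type*} [AddCommGroup g] [Module ℂ g] [LieSuperalgebra g] (S : SimpleRoots g)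

/-- The weight `∑ qᵢ βᵢ` of `𝔥` given by an element `q` of the root lattice. -/
def wt : (Fin S.rank → ℤ) →+ Module.Dual ℂ S.cartan where
  toFun q := ∑ i, q i • S.β i
  map_zero' := by simp
  map_add' p q := by simp [add_smul, Finset.sum_add_distrib]

theorem wt_single (i : Fin S.rank) : S.wt (Pi.single i 1) = S.β i := by
  simp [wt, Pi.single_apply, ite_smul]

/-- Iterated brackets of the elements `Z i`, with their degrees. -/
inductive IsWord (Z : Fin S.rank → g) : (Fin S.rank → ℤ) → g → Prop
  | gen (i) : IsWord Z (Pi.single i 1) (Z i)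
  | cons (i) {q w} (h : IsWord Z q w) : IsWord Z (Pi.single i 1 + q) (br (Z i) w)

section Words

variable {S} {Z W : Fin S.rank → g} {ε : ℤ} {q : Fin S.rank → ℤ} {w : g}

theorem IsWord.mem_generated (h : S.IsWord Z q w) : w ∈ generated (Set.range Z) := by
  induction h with
  | gen i => exact subset_generated _ ⟨i, rfl⟩
  | cons i _ ih => exact br_mem_generated (subset_generated _ ⟨i, rfl⟩) ih

theorem IsWord.nonneg (h : S.IsWord Z q w) : 0 ≤ q := by
  induction h with
  | gen i => exact Pi.single_nonneg.2 zero_le_one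
  | cons i _ ih => exact add_nonneg (Pi.single_nonneg.2 zero_le_one) ih

theorem IsWord.exists_part (hZ : ∀ i, Z i ∈ part (S.parity i)) (h : S.IsWord Z q w) :
    ∃ j, w ∈ part j := by
  induction h with
  | gen i => exact ⟨_, hZ i⟩
  | cons i _ ih =>
    obtain ⟨j, hj⟩ := ih
    exact ⟨_, br_mem _ _ _ _ (hZ i) hj⟩

theorem IsWord.mem_root (hZ : ∀ i, Z i ∈ S.root (ε • Pi.single i 1)) (h : S.IsWord Z q w) :
    w ∈ S.root (ε • q) := by
  induction h with
  | gen i => exact hZ i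
  | cons i _ ih =>
    rw [smul_add]
    exact S.root_br _ _ _ _ (hZ i) ih

theorem IsWord.br_cartan (hZ : ∀ i (h : S.cartan), br (h : g) (Z i) = ((ε : ℂ) * S.β i h) • Z i)
    (hw : S.IsWord Z q w) (h : S.cartan) : br (h : g) w = S.wt (ε • q) h • w := by
  induction hw with
  | gen i => rw [hZ, map_zsmul, wt_single]; simp
  | cons i _ ih =>
    rw [br_jacobi_of_even (S.cartan_even h.2), ih, hZ, smul_add, map_add, map_zsmul S.wt ε (Pi.single i 1),
      wt_single]
    simp [add_smul]

/-- By the super Jacobi identity, moving an opposite generator past the first letter leaves an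
element of 𝔥 acting on the rest of the word by its weight, and then the same problem for a shorter
word. This is what makes the triangular span stable under the generators. -/
theorem IsWord.br_mem (hW : ∀ i, W i ∈ part (S.parity i)) (hZ : ∀ i, Z i ∈ part (S.parity i))
    (hh : ∀ i (h : S.cartan), br (h : g) (Z i) = ((ε : ℂ) * S.β i h) • Z i)
    (hWZ : ∀ i j, br (W i) (Z j) ∈ S.root 0) (hw : S.IsWord Z q w) (j : Fin S.rank) :
    br (W j) w ∈ Submodule.span ℂ {w | ∃ q, S.IsWord Z q w} ⊔ S.root 0 := by
  induction hw with
  | gen i => exact Submodule.mem_sup_right (hWZ j i)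
  | @cons i q w h ih =>
    obtain ⟨k, hk⟩ := h.exists_part hZ
    rw [br_jacobi _ _ _ _ _ _ (hW j) (hZ i) hk]
    refine add_mem ?_ (Submodule.smul_mem _ _ ?_)
    · refine Submodule.mem_sup_left ?_
      rw [h.br_cartan hh ⟨_, hWZ j i⟩]
      exact Submodule.smul_mem _ _ (Submodule.subset_span ⟨q, h⟩)
    · obtain ⟨y, hy, z, hz, hyz⟩ := Submodule.mem_sup.1 ih
      rw [← hyz, map_add]
      refine Submodule.mem_sup_left (add_mem ?_ ?_)
      · have : Submodule.span ℂ {w | ∃ q, S.IsWord Z q w} ≤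
            (Submodule.span ℂ {w | ∃ q, S.IsWord Z q w}).comap (br (Z i)) :=
          Submodule.span_le.2 fun w ⟨q, hw⟩ => Submodule.subset_span ⟨_, hw.cons i⟩
        exact this hy
      · have h1 := br_skew_of_even (S.cartan_even hz) (Z i)
        rw [← neg_eq_iff_eq_neg] at h1
        rw [← h1, hh i ⟨z, hz⟩]
        exact neg_mem (Submodule.smul_mem _ _ (Submodule.subset_span ⟨_, .gen i⟩))

end Words

theorem X_smul_mem (i : Fin S.rank) : S.X i ∈ S.root ((1 : ℤ) • Pi.single i 1) := by
  rw [one_smul]; exact S.X_mem i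

theorem Y_smul_mem (i : Fin S.rank) : S.Y i ∈ S.root ((-1 : ℤ) • Pi.single i 1) := by
  rw [neg_one_smul]; exact S.Y_mem i

theorem br_cartan_X' (i : Fin S.rank) (h : S.cartan) :
    br (h : g) (S.X i) = (((1 : ℤ) : ℂ) * S.β i h) • S.X i := by
  rw [S.br_cartan_X]; simp

theorem br_cartan_Y' (i : Fin S.rank) (h : S.cartan) :
    br (h : g) (S.Y i) = (((-1 : ℤ) : ℂ) * S.β i h) • S.Y i := by
  rw [S.br_cartan_Y]; simp

theorem br_X_Y_mem (i j : Fin S.rank) : br (S.X i) (S.Y j) ∈ S.root 0 := by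
  by_cases h : i = j
  · subst h
    simpa using S.root_br _ _ _ _ (S.X_mem i) (S.Y_mem i)
  · rw [S.br_X_Y i j h]; exact zero_mem _

theorem br_Y_X_mem (i j : Fin S.rank) : br (S.Y i) (S.X j) ∈ S.root 0 := by
  rw [br_skew _ _ _ _ (S.Y_parity i) (S.X_parity j)]
  exact neg_mem (Submodule.smul_mem _ _ (S.br_X_Y_mem j i))

/-- The triangular decomposition. -/
theorem span_words_eq_top :
    Submodule.span ℂ ({w | ∃ q, S.IsWord S.X q w} ∪ {w | ∃ q, S.IsWord S.Y q w} ∪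
      (S.root 0 : Set g)) = ⊤ := by
  set P := Submodule.span ℂ {w | ∃ q, S.IsWord S.X q w} with hP
  set P' := Submodule.span ℂ {w | ∃ q, S.IsWord S.Y q w} with hP'
  set N := Submodule.span ℂ ({w | ∃ q, S.IsWord S.X q w} ∪ {w | ∃ q, S.IsWord S.Y q w} ∪
      (S.root 0 : Set g)) with hN
  have hPN : P ≤ N := Submodule.span_mono fun w hw => Or.inl (Or.inl hw)
  have hPN' : P' ≤ N := Submodule.span_mono fun w hw => Or.inl (Or.inr hw)
  have h0N : S.root 0 ≤ N := fun w hw => Submodule.subset_span (Or.inr hw)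
  -- The stabilizer of `N`, spanned by homogeneous elements so that the super Jacobi identity
  -- applies, is a subalgebra containing the generators. It is therefore `g`, and `N` is closed
  -- under the bracket.
  let T := Submodule.span ℂ {x : g | (∃ i, x ∈ part i) ∧ ∀ y ∈ N, br x y ∈ N}
  have hTN : ∀ x ∈ T, ∀ y ∈ N, br x y ∈ N := by
    intro x hx y hy
    have : T ≤ N.comap ((br (L := g)).flip y) := Submodule.span_le.2 fun x hx => hx.2 y hy
    exact this hx
  have hT : T = ⊤ := by
    rw [eq_top_iff, ← S.generated_eq_top]
    refine generated_le ?_ fun x hx y hy => br_mem_of_span (N := T) ?_ hx hy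
    · have key : ∀ x, (∃ i, x ∈ part i) → (∀ q w, S.IsWord S.X q w → br x w ∈ N) →
          (∀ q w, S.IsWord S.Y q w → br x w ∈ N) → (∀ w ∈ S.root 0, br x w ∈ N) → x ∈ T := by
        intro x hx h1 h2 h3
        refine Submodule.subset_span ⟨hx, fun y hy => ?_⟩
        have : N ≤ N.comap (br x) := by
          rw [hN, Submodule.span_le]
          rintro w ((⟨q, hw⟩ | ⟨q, hw⟩) | hw)
          exacts [h1 q w hw, h2 q w hw, h3 w hw]
        exact this hy
      rintro _ ((⟨i, rfl⟩ | ⟨i, rfl⟩) | hx)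
      · refine key _ ⟨_, S.X_parity i⟩ (fun q w hw => hPN (Submodule.subset_span ⟨_, hw.cons i⟩))
          (fun q w hw => ?_) (fun w hw => ?_)
        · exact sup_le hPN' h0N (hw.br_mem S.X_parity S.Y_parity S.br_cartan_Y' S.br_X_Y_mem i)
        · rw [← neg_neg (br (S.X i) w), ← br_skew_of_even (S.cartan_even hw),
            S.br_cartan_X i ⟨w, hw⟩]
          exact neg_mem (Submodule.smul_mem _ _ (hPN (Submodule.subset_span ⟨_, .gen i⟩)))
      · refine key _ ⟨_, S.Y_parity i⟩ (fun q w hw => ?_)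
          (fun q w hw => hPN' (Submodule.subset_span ⟨_, hw.cons i⟩)) (fun w hw => ?_)
        · exact sup_le hPN h0N (hw.br_mem S.Y_parity S.X_parity S.br_cartan_X' S.br_Y_X_mem i)
        · rw [← neg_neg (br (S.Y i) w), ← br_skew_of_even (S.cartan_even hw),
            S.br_cartan_Y i ⟨w, hw⟩]
          exact neg_mem (neg_mem (Submodule.smul_mem _ _
            (hPN' (Submodule.subset_span ⟨_, .gen i⟩))))
      · refine key _ ⟨0, S.cartan_even hx⟩ (fun q w hw => ?_) (fun q w hw => ?_) (fun w hw => ?_)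
        · rw [hw.br_cartan S.br_cartan_X' ⟨_, hx⟩]
          exact Submodule.smul_mem _ _ (hPN (Submodule.subset_span ⟨_, hw⟩))
        · rw [hw.br_cartan S.br_cartan_Y' ⟨_, hx⟩]
          exact Submodule.smul_mem _ _ (hPN' (Submodule.subset_span ⟨_, hw⟩))
        · rw [S.cartan_abelian _ hx _ hw]; exact zero_mem _
    · rintro x ⟨⟨i, hi⟩, hx⟩ y ⟨⟨j, hj⟩, hy⟩
      refine Submodule.subset_span ⟨⟨_, br_mem i j x y hi hj⟩, fun z hz => ?_⟩
      have h := br_jacobi_of_mem hi hj z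
      rw [← sub_eq_iff_eq_add] at h
      rw [← h]
      exact sub_mem (hx _ (hy z hz)) (Submodule.smul_mem _ _ (hy _ (hx z hz)))
  rw [eq_top_iff, ← S.generated_eq_top]
  refine generated_le ?_ fun x hx y hy => hTN x (hT ▸ Submodule.mem_top) y hy
  rintro _ ((⟨i, rfl⟩ | ⟨i, rfl⟩) | hx)
  exacts [hPN (Submodule.subset_span ⟨_, .gen i⟩), hPN' (Submodule.subset_span ⟨_, .gen i⟩),
    h0N hx]

/-- Every root space is spanned by homogeneous elements on which `𝔥` acts by the weight, and which
lie in `𝔫⁺` if the root is positive. -/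
theorem root_le_span (q : Fin S.rank → ℤ) : S.root q ≤ Submodule.span ℂ
    {x | x ∈ S.root q ∧ (∃ j, x ∈ part j) ∧ (∀ h : S.cartan, br (h : g) x = S.wt q h • x) ∧
      (0 ≤ q ∨ q ≤ 0) ∧ (q ≠ 0 → 0 ≤ q → x ∈ S.nPlus)} := by
  have key : ∀ x : g, S.root_internal.proj q x ∈ Submodule.span ℂ
      {x | x ∈ S.root q ∧ (∃ j, x ∈ part j) ∧ (∀ h : S.cartan, br (h : g) x = S.wt q h • x) ∧
      (0 ≤ q ∨ q ≤ 0) ∧ (q ≠ 0 → 0 ≤ q → x ∈ S.nPlus)} := by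
    have key' : ∀ x : g, ∀ p, x ∈ S.root p → (p = q → x ∈ Submodule.span ℂ
        {x | x ∈ S.root q ∧ (∃ j, x ∈ part j) ∧ (∀ h : S.cartan, br (h : g) x = S.wt q h • x) ∧
        (0 ≤ q ∨ q ≤ 0) ∧ (q ≠ 0 → 0 ≤ q → x ∈ S.nPlus)}) → S.root_internal.proj q x ∈
        Submodule.span ℂ
        {x | x ∈ S.root q ∧ (∃ j, x ∈ part j) ∧ (∀ h : S.cartan, br (h : g) x = S.wt q h • x) ∧
        (0 ≤ q ∨ q ≤ 0) ∧ (q ≠ 0 → 0 ≤ q → x ∈ S.nPlus)} := by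
      intro x p hx h
      by_cases hpq : q = p
      · subst hpq
        rw [S.root_internal.proj_apply_of_mem hx]
        exact h rfl
      · rw [S.root_internal.proj_apply_of_ne hpq hx]; exact zero_mem _
    intro x
    have hx : x ∈ Submodule.span ℂ ({w | ∃ q, S.IsWord S.X q w} ∪ {w | ∃ q, S.IsWord S.Y q w} ∪
      (S.root 0 : Set g)) := by rw [S.span_words_eq_top]; trivial
    induction hx using Submodule.span_induction with
    | zero => simp
    | add x y _ _ hx hy => rw [map_add]; exact add_mem hx hy
    | smul c x _ hx => rw [map_smul]; exact Submodule.smul_mem _ _ hx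
    | mem x hx =>
      rcases hx with (⟨p, hx⟩ | ⟨p, hx⟩) | hx
      · have hm := hx.mem_root S.X_smul_mem
        rw [one_smul] at hm
        refine key' x p hm ?_
        rintro rfl
        refine Submodule.subset_span ⟨hm, hx.exists_part S.X_parity, fun h => ?_, Or.inl hx.nonneg,
          fun _ _ => hx.mem_generated⟩
        simpa using hx.br_cartan S.br_cartan_X' h
      · refine key' x (-p) (by simpa using hx.mem_root S.Y_smul_mem) ?_
        rintro rfl
        refine Submodule.subset_span ⟨by simpa using hx.mem_root S.Y_smul_mem,
          hx.exists_part S.Y_parity, fun h => ?_, Or.inr (neg_nonpos.2 hx.nonneg), fun h0 h1 => ?_⟩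
        · simpa using hx.br_cartan S.br_cartan_Y' h
        · exact absurd (le_antisymm (neg_nonpos.2 hx.nonneg) h1) h0
      · refine key' x 0 hx ?_
        rintro rfl
        refine Submodule.subset_span ⟨hx, ⟨0, S.cartan_even hx⟩, fun h => ?_, Or.inl le_rfl,
          fun h => absurd rfl h⟩
        rw [S.cartan_abelian _ h.2 _ hx]; simp
  intro x hx
  rw [← S.root_internal.proj_apply_of_mem hx]
  exact key x

theorem nonneg_or_nonpos {q : Fin S.rank → ℤ} (hq : S.root q ≠ ⊥) : 0 ≤ q ∨ q ≤ 0 := by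
  by_contra hcon
  apply hq
  rw [eq_bot_iff]
  refine (S.root_le_span q).trans (Submodule.span_le.2 fun x hx => absurd hx.2.2.2.1 hcon)

theorem root_le_nPlus {q : Fin S.rank → ℤ} (hq : 0 ≤ q) (hq0 : q ≠ 0) : S.root q ≤ S.nPlus :=
  (S.root_le_span q).trans (Submodule.span_le.2 fun _ hx => hx.2.2.2.2 hq0 hq)

theorem br_cartan {q : Fin S.rank → ℤ} {x : g} (hx : x ∈ S.root q) (h : S.cartan) :
    br (h : g) x = S.wt q h • x := by
  replace hx := S.root_le_span q hx
  induction hx using Submodule.span_induction with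
  | zero => simp
  | add x y _ _ hx hy => rw [map_add, hx, hy, smul_add]
  | smul c x _ hx => rw [map_smul, hx, smul_comm]
  | mem x hx' => exact hx'.2.2.1 h

theorem root_le_inf_part (q : Fin S.rank → ℤ) :
    S.root q ≤ (S.root q ⊓ part 0) ⊔ (S.root q ⊓ part 1) := by
  refine (S.root_le_span q).trans (Submodule.span_le.2 ?_)
  rintro x ⟨hx, ⟨j, hj⟩, -⟩
  obtain rfl | rfl := zmod_two_cases j
  · exact Submodule.mem_sup_left ⟨hx, hj⟩
  · exact Submodule.mem_sup_right ⟨hx, hj⟩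

/-- The homogeneous elements of `g`, with respect to roots and parity, span `g`. -/
theorem homogeneous_induction {p : g → Prop}
    (h : ∀ q j, ∀ x ∈ S.root q, x ∈ part j → p x) (hadd : ∀ x y, p x → p y → p (x + y)) (x : g) :
    p x := by
  refine S.root_internal.mem_induction (fun q x hx => ?_) hadd (h 0 0 0 (zero_mem _) (zero_mem _)) x
  obtain ⟨y, hy, z, hz, rfl⟩ := Submodule.mem_sup.1 (S.root_le_inf_part q hx)
  exact hadd y z (h q 0 y hy.1 hy.2) (h q 1 z hz.1 hz.2)

/-- Root spaces are spanned by words and elements of 𝔥, all homogeneous for the parity, so the two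
gradings of `g` are compatible. -/
theorem proj_mem_part (q : Fin S.rank → ℤ) {j : ZMod 2} {x : g} (hx : x ∈ part j) :
    S.root_internal.proj q x ∈ part j := by
  have key : ∀ x : g, ∃ y ∈ part (L := g) 0, ∃ z ∈ part (L := g) 1, x = y + z ∧
      ∀ q, S.root_internal.proj q y ∈ part (L := g) 0 ∧
        S.root_internal.proj q z ∈ part (L := g) 1 := by
    have hpr : ∀ q, ∀ i, ∀ x ∈ S.root q, x ∈ part i → ∀ p, S.root_internal.proj p x ∈ part i := by
      intro q i x hx hi p
      by_cases hp : p = q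
      · subst hp; rwa [S.root_internal.proj_apply_of_mem hx]
      · rw [S.root_internal.proj_apply_of_ne hp hx]; exact zero_mem _
    refine S.homogeneous_induction (fun q j x hx hj => ?_) ?_
    · obtain rfl | rfl := zmod_two_cases j
      · exact ⟨x, hj, 0, zero_mem _, by simp, fun p => ⟨hpr q 0 x hx hj p, by simp⟩⟩
      · exact ⟨0, zero_mem _, x, hj, by simp, fun p => ⟨by simp, hpr q 1 x hx hj p⟩⟩
    · rintro _ _ ⟨y, hy, z, hz, rfl, h⟩ ⟨y', hy', z', hz', rfl, h'⟩
      refine ⟨y + y', add_mem hy hy', z + z', add_mem hz hz', by abel, fun q => ?_⟩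
      rw [map_add, map_add]
      exact ⟨add_mem (h q).1 (h' q).1, add_mem (h q).2 (h' q).2⟩
  obtain ⟨y, hy, z, hz, rfl, h⟩ := key x
  have hd := Submodule.disjoint_def.1 (LieSuperalgebra.isCompl (L := g)).disjoint
  obtain rfl | rfl := zmod_two_cases j
  · have hz0 : z = 0 := hd z (by simpa using sub_mem hx hy) hz
    subst hz0
    rw [add_zero]
    exact (h q).1
  · have hy0 : y = 0 := hd y hy (by simpa using sub_mem hx hz)
    subst hy0
    rw [zero_add]
    exact (h q).2

/-- `𝔫⁺` lies in the sum of the positive root spaces. -/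
theorem nPlus_le : S.nPlus ≤ Submodule.span ℂ {x | ∃ q, 0 ≤ q ∧ q ≠ 0 ∧ x ∈ S.root q} := by
  refine generated_le ?_ fun x hx y hy => br_mem_of_span ?_ hx hy
  · rintro _ ⟨i, rfl⟩
    exact Submodule.subset_span ⟨_, Pi.single_nonneg.2 zero_le_one, by simp, S.X_mem i⟩
  · rintro x ⟨p, hp, hp0, hx⟩ y ⟨q, hq, hq0, hy⟩
    refine Submodule.subset_span ⟨_, add_nonneg hp hq, fun h => hp0 ?_, S.root_br _ _ _ _ hx hy⟩
    exact le_antisymm (by rw [← h]; exact le_add_of_nonneg_right hq) hp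

end SimpleRoots

end LieSuperalgebra

end

section

open scoped TensorProduct
open LieSuperalgebra Module

namespace LieSuperalgebra

/-- A subspace of the even part is graded. -/
theorem eq_inf_sup_inf {L : Type*} [AddCommGroup L] [Module ℂ L] [LieSuperalgebra L]
    {N : Submodule ℂ L} (hN : N ≤ part 0) : N = (N ⊓ part 0) ⊔ (N ⊓ part 1) := by
  rw [inf_eq_left.2 hN, sup_eq_left.2 inf_le_left]

namespace SimpleRoots

variable {g : Type*} [AddCommGroup g] [Module ℂ g] [LieSuperalgebra g] (S : SimpleRoots g)

/-! ### The root decomposition of the even part -/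

/-- The even part of a root space, as a subspace of the even part of `g`. -/
def evenRoot (q : Fin S.rank → ℤ) : Submodule ℂ (part (L := g) 0) :=
  (S.root q).comap (part (L := g) 0).subtype

theorem evenRoot_internal : DirectSum.IsInternal S.evenRoot := by
  apply DirectSum.isInternal_submodule_of_iSupIndep_of_iSup_eq_top
  · intro q
    rw [Submodule.disjoint_def]
    intro x hx hx'
    have h1 := (S.root_internal.submodule_iSupIndep) q
    rw [Submodule.disjoint_def] at h1
    apply Subtype.ext
    refine h1 x hx ?_
    have h2 : ⨆ p, ⨆ (_ : p ≠ q), S.evenRoot p ≤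
        (⨆ p, ⨆ (_ : p ≠ q), S.root p).comap (part (L := g) 0).subtype :=
      iSup₂_le fun p hp => Submodule.comap_mono (le_iSup₂_of_le p hp le_rfl)
    exact h2 hx'
  · rw [eq_top_iff]
    intro x _
    obtain ⟨s, hs⟩ := S.root_internal.exists_eq_sum_proj (x : g)
    have hx : x = ∑ q ∈ s, (⟨S.root_internal.proj q x, S.proj_mem_part q x.2⟩ : part (L := g) 0) := by
      apply Subtype.ext
      rw [AddSubmonoidClass.coe_finsetSum]
      exact hs
    rw [hx]
    exact Submodule.sum_mem _ fun q _ => Submodule.mem_iSup_of_mem q (S.root_internal.proj_mem q _)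

/-- The weights of `𝔥`, regarded as a subspace of the even part of `g`. -/
def evenWt : (Fin S.rank → ℤ) →+ Module.Dual ℂ (S.evenRoot 0) where
  toFun q := S.wt q ∘ₗ (part (L := g) 0).subtype.restrict (p := S.evenRoot 0) (q := S.root 0)
    (fun _ hx => hx)
  map_zero' := by rw [map_zero]; rfl
  map_add' p q := by rw [map_add]; rfl

theorem evenRoot_lie_mem (p q : Fin S.rank → ℤ) (x y : part (L := g) 0) (hx : x ∈ S.evenRoot p)
    (hy : y ∈ S.evenRoot q) : ⁅x, y⁆ ∈ S.evenRoot (p + q) :=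
  S.root_br p q x y hx hy

theorem evenRoot_nonneg_or {q : Fin S.rank → ℤ} (hq : S.evenRoot q ≠ ⊥) : 0 ≤ q ∨ q ≤ 0 := by
  apply S.nonneg_or_nonpos
  obtain ⟨x, hx, hx0⟩ := (Submodule.ne_bot_iff _).1 hq
  exact (Submodule.ne_bot_iff _).2 ⟨x, hx, fun h => hx0 (Subtype.ext h)⟩

theorem isReductiveGrading (h1 : (LieAlgebra.center ℂ (part (L := g) 0)).toSubmodule ≤ S.evenRoot 0)
    (h2 : LieAlgebra.IsKilling ℂ (⁅(⊤ : LieIdeal ℂ (part (L := g) 0)),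
      (⊤ : LieIdeal ℂ (part (L := g) 0))⁆ : LieIdeal ℂ (part (L := g) 0)))
    (h3 : (LieAlgebra.center ℂ (part (L := g) 0)).toSubmodule ⊔ (⁅(⊤ : LieIdeal ℂ (part (L := g) 0)),
      (⊤ : LieIdeal ℂ (part (L := g) 0))⁆ : LieIdeal ℂ (part (L := g) 0)).toSubmodule = ⊤) :
    LieAlgebra.IsReductiveGrading S.evenRoot S.evenWt where
  internal := S.evenRoot_internal
  lie_mem := S.evenRoot_lie_mem
  abelian _ hx _ hy := Subtype.ext (S.cartan_abelian _ hx _ hy)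
  lie_cartan h _ _ hx := Subtype.ext (S.br_cartan hx ⟨_, h.2⟩)
  center_le := h1
  isKilling := h2
  center_sup := h3

/-- The homogeneous components of a central element of the even part are central. -/
theorem proj_mem_center {x : part (L := g) 0} (hx : x ∈ LieAlgebra.center ℂ (part (L := g) 0))
    (q : Fin S.rank → ℤ) :
    S.evenRoot_internal.proj q x ∈ LieAlgebra.center ℂ (part (L := g) 0) := by
  have key : ∀ p, ∀ y ∈ S.evenRoot p, ∀ x, ⁅y, S.evenRoot_internal.proj q x⁆ =
      S.evenRoot_internal.proj (p + q) ⁅y, x⁆ := by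
    intro p y hy
    refine S.evenRoot_internal.mem_induction (fun j x hx => ?_)
      (fun a b h h' => by simp only [map_add, lie_add, h, h']) (by simp)
    have hyx := S.evenRoot_lie_mem p j y x hy hx
    by_cases h : q = j
    · subst h
      rw [S.evenRoot_internal.proj_apply_of_mem hx, S.evenRoot_internal.proj_apply_of_mem hyx]
    · rw [S.evenRoot_internal.proj_apply_of_ne h hx,
        S.evenRoot_internal.proj_apply_of_ne (by simpa using h) hyx, lie_zero]
  rw [LieModule.mem_maxTrivSubmodule] at hx ⊢
  refine S.evenRoot_internal.mem_induction (fun p y hy => ?_)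
    (fun a b h h' => by rw [add_lie, h, h', add_zero]) (by simp)
  rw [key p y hy, hx, map_zero]

/-- Root vectors act nilpotently on `g`. -/
theorem exists_pow_br_eq_zero [FiniteDimensional ℂ g] {q : Fin S.rank → ℤ} (hq : q ≠ 0) {x : g}
    (hx : x ∈ S.root q) (y : g) : ∃ n, ((br x) ^ n : Module.End ℂ g) y = 0 := by
  refine S.root_internal.mem_induction
    (p := fun y => ∃ n, ((br x) ^ n : Module.End ℂ g) y = 0) (fun p y hy => ?_) ?_ ⟨0, by simp⟩ y
  · have hmem : ∀ n : ℕ, ((br x) ^ n : Module.End ℂ g) y ∈ S.root (n • q + p) := by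
      intro n
      induction n with
      | zero => simpa using hy
      | succ n ih =>
        rw [pow_succ', Module.End.mul_apply, succ_nsmul', add_assoc]
        exact S.root_br _ _ _ _ hx ih
    -- Finitely many root spaces are nonzero, whereas the degrees `n • q + p` are pairwise distinct.
    have hfin : {p | S.root p ≠ ⊥}.Finite :=
      WellFoundedGT.finite_ne_bot_of_iSupIndep S.root_internal.submodule_iSupIndep
    by_contra! hcon
    have hinj : Function.Injective fun n : ℕ => n • q + p := by
      intro n m hnm
      obtain ⟨i, hi⟩ := Function.ne_iff.1 hq
      have := congrFun hnm i
      simp only [Pi.add_apply, Pi.smul_apply, add_left_inj] at this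
      rw [nsmul_eq_mul, nsmul_eq_mul] at this
      exact_mod_cast mul_right_cancel₀ hi this
    refine Set.infinite_range_of_injective hinj (hfin.subset ?_)
    rintro _ ⟨n, rfl⟩
    exact (Submodule.ne_bot_iff _).2 ⟨_, hmem n, hcon n⟩
  · rintro a b ⟨n, hn⟩ ⟨m, hm⟩
    refine ⟨n + m, ?_⟩
    rw [map_add, Module.End.pow_apply_eq_zero_of_le hn (Nat.le_add_right n m),
      Module.End.pow_apply_eq_zero_of_le hm (Nat.le_add_left m n), add_zero]

theorem toEnd_pow_eq (x : part (L := g) 0) (N : LieSubmodule ℂ (part (L := g) 0) g) (n : ℕ) (y : N) :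
    (((LieModule.toEnd ℂ (part (L := g) 0) N x ^ n) y : N) : g) =
      ((br (x : g)) ^ n : Module.End ℂ g) y := by
  induction n with
  | zero => rfl
  | succ n ih =>
    rw [pow_succ', pow_succ', Module.End.mul_apply, Module.End.mul_apply, ← ih]
    rfl

/-- If `g₀` has a faithful semisimple module inside `g`, it is reductive, and its center lies in
`𝔥`. -/
theorem isReductiveGrading_of_submodule [FiniteDimensional ℂ g]
    (V : LieSubmodule ℂ (part (L := g) 0) g)
    (hss : sSup {P : LieSubmodule ℂ (part (L := g) 0) V | IsAtom P} = ⊤)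
    (hfaith : ∀ x : part (L := g) 0, (∀ v : V, ⁅x, v⁆ = 0) → x = 0) :
    LieAlgebra.IsReductiveGrading S.evenRoot S.evenWt := by
  refine S.isReductiveGrading (fun z hz => ?_) (LieAlgebra.isKilling_lie_top_top hss hfaith)
    (LieAlgebra.center_sup_lie_top_top hss hfaith)
  -- A component of nonzero degree of a central element is again central, and it acts nilpotently as
  -- a root vector, so it is zero.
  refine S.evenRoot_internal.mem_of_proj fun q hq => ?_
  refine LieAlgebra.eq_zero_of_mem_center_of_isNilpotent hss hfaith (S.proj_mem_center hz q) ?_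
  rw [Module.End.isNilpotent_iff_of_finite]
  intro v
  obtain ⟨n, hn⟩ := S.exists_pow_br_eq_zero hq
    (x := (S.evenRoot_internal.proj q z : part (L := g) 0)) (S.evenRoot_internal.proj_mem q z) (v : g)
  exact ⟨n, Subtype.ext (by rw [toEnd_pow_eq, hn]; rfl)⟩

/-- The annihilator of g₁ in g₀ is an ideal of g. If it is zero, g₁ is a faithful g₀-module,
semisimple because g is basic. If it is everything, g is purely even and simple, and its adjoint
module is faithful and irreducible. -/
theorem isReductiveGrading_of_isBasic (hg : IsBasic g) :
    LieAlgebra.IsReductiveGrading S.evenRoot S.evenWt := by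
  have := hg.finiteDimensional
  let I : Submodule ℂ g :=
    { carrier := {x | x ∈ part (L := g) 0 ∧ ∀ y ∈ part (L := g) 1, br x y = 0}
      add_mem' := by
        rintro a b ⟨ha, ha'⟩ ⟨hb, hb'⟩
        exact ⟨add_mem ha hb, fun y hy => by simp [ha' y hy, hb' y hy]⟩
      zero_mem' := ⟨zero_mem _, by simp⟩
      smul_mem' := by
        rintro c a ⟨ha, ha'⟩
        exact ⟨Submodule.smul_mem _ _ ha, fun y hy => by simp [ha' y hy]⟩ }
  have hI0 : I ≤ part (L := g) 0 := fun x hx => hx.1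
  have hIdeal : I = ⊥ ∨ I = ⊤ := by
    refine hg.simple.2 I (eq_inf_sup_inf hI0) ?_
    · intro x hx y
      obtain ⟨y0, hy0, y1, hy1, rfl⟩ := exists_add_mem_part y
      rw [map_add, hx.2 y1 hy1, add_zero]
      refine ⟨br_mem_part_of_even hx.1 hy0, fun z hz => ?_⟩
      have h1 := br_jacobi_of_even hx.1 y0 z
      rw [hx.2 z hz, map_zero, add_zero, hx.2 _ (br_mem_part_of_even hy0 hz)] at h1
      exact h1.symm
  rcases hIdeal with hI | hI
  · refine S.isReductiveGrading_of_submodule (partSubmodule g 1) ?_ fun x hx => ?_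
    · by_contra hne
      set A := sSup {P : LieSubmodule ℂ (part (L := g) 0) (partSubmodule g 1) | IsAtom P} with hA
      let A' : LieSubmodule ℂ (part (L := g) 0) g := A.map (partSubmodule g 1).incl
      have hA' : ∀ x : partSubmodule g 1, (x : g) ∈ A' ↔ x ∈ A := by
        intro x
        rw [LieSubmodule.mem_map]
        exact ⟨fun ⟨y, hy, hyx⟩ => by rwa [← (Subtype.ext hyx : y = x)], fun h => ⟨x, h, rfl⟩⟩
      -- A nonzero complement of the sum of the irreducible submodules would contain an irreducible
      -- submodule outside that sum.
      obtain ⟨C, hC1, hC, hinf, hsup⟩ := hg.classical A'.toSubmodule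
        (by
          intro y hy
          obtain ⟨z, -, rfl⟩ := (LieSubmodule.mem_map _).1 hy
          exact z.2)
        (fun x hx y hy => A'.lie_mem (x := ⟨x, hx⟩) hy)
      let C' : LieSubmodule ℂ (part (L := g) 0) (partSubmodule g 1) :=
        { toSubmodule := C.comap (partSubmodule g 1).toSubmodule.subtype
          lie_mem := fun {x m} hm => hC x x.2 m hm }
      have hC'0 : C' ≠ ⊥ := by
        intro h0
        apply hne
        rw [eq_top_iff]
        intro x _
        have hx : (x : g) ∈ A'.toSubmodule ⊔ C := by rw [hsup]; exact x.2
        obtain ⟨a, ha, c, hc, hac⟩ := Submodule.mem_sup.1 hx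
        have hcm : (⟨c, hC1 hc⟩ : partSubmodule g 1) ∈ C' := hc
        rw [h0, LieSubmodule.mem_bot] at hcm
        have hc0 : c = 0 := congrArg Subtype.val hcm
        rw [hc0, add_zero] at hac
        rw [← hA', ← hac]
        exact ha
      obtain ⟨P, hP, hPC⟩ := (IsAtomic.eq_bot_or_exists_atom_le C').resolve_left hC'0
      obtain ⟨v, hv, hv0⟩ := P.toSubmodule.ne_bot_iff.1 (by simpa using hP.1)
      have hvA : v ∈ A := le_sSup (show P ∈ {P | IsAtom P} from hP) hv
      have : (v : g) ∈ A'.toSubmodule ⊓ C := ⟨(hA' v).2 hvA, hPC hv⟩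
      rw [hinf, Submodule.mem_bot] at this
      exact hv0 (Subtype.ext this)
    · have : (x : g) ∈ I := ⟨x.2, fun y hy => congrArg Subtype.val (hx ⟨y, hy⟩)⟩
      rw [hI, Submodule.mem_bot] at this
      exact Subtype.ext this
  · have h0 : ∀ x, x ∈ part (L := g) 0 := fun x => hI0 (hI ▸ Submodule.mem_top)
    refine S.isReductiveGrading_of_submodule ⊤ ?_ fun x hx => ?_
    · have hat : IsAtom (⊤ : LieSubmodule ℂ (part (L := g) 0)
          (⊤ : LieSubmodule ℂ (part (L := g) 0) g)) := by
        refine ⟨fun h => ?_, fun N hN => ?_⟩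
        · obtain ⟨x, y, hxy⟩ := hg.simple.1
          apply hxy
          have hx : (⟨x, trivial⟩ : (⊤ : LieSubmodule ℂ (part (L := g) 0) g)) ∈
            (⊤ : LieSubmodule ℂ (part (L := g) 0)
              (⊤ : LieSubmodule ℂ (part (L := g) 0) g)) := trivial
          rw [h, LieSubmodule.mem_bot] at hx
          rw [show x = 0 from congrArg Subtype.val hx]
          simp
        · let N' : LieSubmodule ℂ (part (L := g) 0) g :=
            N.map (⊤ : LieSubmodule ℂ (part (L := g) 0) g).incl
          have hN' : ∀ x : (⊤ : LieSubmodule ℂ (part (L := g) 0) g), (x : g) ∈ N' ↔ x ∈ N := by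
            intro x
            rw [LieSubmodule.mem_map]
            exact ⟨fun ⟨y, hy, hyx⟩ => by rwa [← (Subtype.ext hyx : y = x)], fun h => ⟨x, h, rfl⟩⟩
          rcases hg.simple.2 N'.toSubmodule (eq_inf_sup_inf fun x _ => h0 x)
            (fun x hx y => by
              rw [← neg_neg (br x y), ← br_skew_of_even (h0 y) x]
              exact neg_mem (N'.lie_mem (x := ⟨y, h0 y⟩) hx)) with h | h
          · rw [eq_bot_iff]
            intro x hx
            have := (hN' x).2 hx
            rw [← LieSubmodule.mem_toSubmodule, h, Submodule.mem_bot] at this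
            rw [LieSubmodule.mem_bot]
            exact Subtype.ext this
          · exfalso
            apply hN.ne
            rw [eq_top_iff]
            intro x _
            rw [← hN', ← LieSubmodule.mem_toSubmodule, h]; trivial
      exact le_antisymm le_top (le_sSup hat)
    · let Z : Submodule ℂ g := LinearMap.ker (br (L := g))
      have hZ : Z = ⊥ ∨ Z = ⊤ := by
        refine hg.simple.2 Z (eq_inf_sup_inf fun x _ => h0 x) ?_
        intro x hx y
        rw [LinearMap.mem_ker.1 hx]
        simp
      rcases hZ with hZ | hZ
      · have hxZ : (x : g) ∈ Z := LinearMap.mem_ker.2 (LinearMap.ext fun y =>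
          congrArg Subtype.val (hx ⟨y, trivial⟩))
        rw [hZ, Submodule.mem_bot] at hxZ
        exact Subtype.ext hxZ
      · exfalso
        obtain ⟨x, y, hxy⟩ := hg.simple.1
        have hxZ : x ∈ Z := hZ ▸ Submodule.mem_top
        exact hxy (by rw [LinearMap.mem_ker.1 hxZ]; simp)

end SimpleRoots

end LieSuperalgebra

end

section

open scoped TensorProduct
open LieSuperalgebra Module

namespace LieSuperalgebra

namespace SimpleRoots

variable {g : Type*} [AddCommGroup g] [Module ℂ g] [LieSuperalgebra g] (S : SimpleRoots g)

/-! ### The even part of `sl(n,n)` -/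

/-- The operator multiplying `root q` by `q i` is a derivation of `g` preserving the parity. -/
theorem exists_super_degree_derivation (i : Fin S.rank) :
    ∃ D : g →ₗ[ℂ] g, (∀ x y, D (br x y) = br (D x) y + br x (D y)) ∧
      (∀ j, ∀ x ∈ part (L := g) j, D x ∈ part (L := g) j) ∧
      ∀ q, ∀ x ∈ S.root q, D x = (q i : ℂ) • x := by
  obtain ⟨D, hD⟩ := S.root_internal.exists_linearMap (fun q => (q i : ℂ) • (S.root q).subtype)
  have hD' : ∀ q, ∀ x ∈ S.root q, D x = (q i : ℂ) • x := fun q x hx => hD q x hx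
  refine ⟨D, fun x y => ?_, fun j x hx => ?_, hD'⟩
  · refine S.root_internal.mem_induction (p := fun x => D (br x y) = br (D x) y + br x (D y))
      (fun p x hx => ?_)
      (fun x x' h h' => by simp only [LinearMap.add_apply, map_add, h, h']; abel) (by simp) x
    refine S.root_internal.mem_induction (p := fun y => D (br x y) = br (D x) y + br x (D y))
      (fun q y hy => ?_) (fun x x' h h' => by simp only [map_add, h, h']; abel) (by simp) y
    rw [hD' p x hx, hD' q y hy, hD' _ _ (S.root_br p q x y hx hy), Pi.add_apply, map_smul, map_smul,
      LinearMap.smul_apply, ← add_smul, Int.cast_add]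
  · obtain ⟨s, hs⟩ := S.root_internal.exists_eq_sum_proj x
    rw [hs, map_sum]
    refine Submodule.sum_mem _ fun q _ => ?_
    rw [hD' q _ (S.root_internal.proj_mem q x)]
    exact Submodule.smul_mem _ _ (S.proj_mem_part q hx)

end SimpleRoots

section Sl

variable {g : Type*} [AddCommGroup g] [Module ℂ g] [LieSuperalgebra g] {n : ℕ}
  {φ : g →ₗ[ℂ] Matrix (Fin n ⊕ Fin n) (Fin n ⊕ Fin n) ℂ}

/-- `φ` is an isomorphism of `g` with `sl(n,n)`. -/
structure IsSlIso (φ : g →ₗ[ℂ] Matrix (Fin n ⊕ Fin n) (Fin n ⊕ Fin n) ℂ) : Prop where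
  injective : Function.Injective φ
  range : ∀ M, (∃ x, φ x = M) ↔ M.toBlocks₁₁.trace - M.toBlocks₂₂.trace = 0
  even : ∀ x ∈ part (L := g) 0, (φ x).toBlocks₁₂ = 0 ∧ (φ x).toBlocks₂₁ = 0
  odd : ∀ x ∈ part (L := g) 1, (φ x).toBlocks₁₁ = 0 ∧ (φ x).toBlocks₂₂ = 0
  map_br : ∀ (i j : ZMod 2) (x y : g), x ∈ part i → y ∈ part j →
      φ (br x y) = φ x * φ y - koszulSign i j • (φ y * φ x)

namespace IsSlIso

variable (hφ : IsSlIso φ)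
include hφ

theorem map_br_even {x y : g} (hx : x ∈ part (L := g) 0) (hy : y ∈ part (L := g) 0) :
    φ (br x y) = φ x * φ y - φ y * φ x := by
  rw [hφ.map_br 0 0 x y hx hy, koszulSign_zero_left, one_smul]

theorem map_br_odd {x y : g} (hx : x ∈ part (L := g) 1) (hy : y ∈ part (L := g) 1) :
    φ (br x y) = φ x * φ y + φ y * φ x := by
  rw [hφ.map_br 1 1 x y hx hy]
  have : koszulSign 1 1 = -1 := by
    simp [koszulSign, ZMod.val_one]
  rw [this, neg_one_smul, sub_neg_eq_add]

theorem exists_even {M : Matrix (Fin n ⊕ Fin n) (Fin n ⊕ Fin n) ℂ}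
    (h : M.toBlocks₁₁.trace - M.toBlocks₂₂.trace = 0) (h12 : M.toBlocks₁₂ = 0)
    (h21 : M.toBlocks₂₁ = 0) : ∃ x ∈ part (L := g) 0, φ x = M := by
  obtain ⟨x, hx⟩ := (hφ.range M).2 h
  obtain ⟨y, hy, z, hz, rfl⟩ := exists_add_mem_part x
  refine ⟨y, hy, ?_⟩
  have h1 := hφ.even y hy
  have h2 := hφ.odd z hz
  rw [map_add] at hx
  have hz0 : φ z = 0 := by
    rw [← Matrix.fromBlocks_toBlocks (φ z), h2.1, h2.2]
    have e1 : (φ z).toBlocks₁₂ = 0 := by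
      have := congrArg Matrix.toBlocks₁₂ hx
      ext a b
      have h3 := congrFun (congrFun this a) b
      have h4 := congrFun (congrFun h1.1 a) b
      have h5 := congrFun (congrFun h12 a) b
      simp only [Matrix.toBlocks₁₂, Matrix.of_apply, Matrix.add_apply, Matrix.zero_apply] at *
      rw [h4, zero_add, h5] at h3; exact h3
    have e2 : (φ z).toBlocks₂₁ = 0 := by
      have := congrArg Matrix.toBlocks₂₁ hx
      ext a b
      have h3 := congrFun (congrFun this a) b
      have h4 := congrFun (congrFun h1.2 a) b
      have h5 := congrFun (congrFun h21 a) b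
      simp only [Matrix.toBlocks₂₁, Matrix.of_apply, Matrix.add_apply, Matrix.zero_apply] at *
      rw [h4, zero_add, h5] at h3; exact h3
    rw [e1, e2, Matrix.fromBlocks_zero]
  rwa [hz0, add_zero] at hx

theorem exists_odd {M : Matrix (Fin n ⊕ Fin n) (Fin n ⊕ Fin n) ℂ}
    (h11 : M.toBlocks₁₁ = 0) (h22 : M.toBlocks₂₂ = 0) : ∃ x ∈ part (L := g) 1, φ x = M := by
  obtain ⟨x, hx⟩ := (hφ.range M).2 (by rw [h11, h22]; simp)
  obtain ⟨y, hy, z, hz, rfl⟩ := exists_add_mem_part x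
  refine ⟨z, hz, ?_⟩
  have h1 := hφ.even y hy
  have h2 := hφ.odd z hz
  rw [map_add] at hx
  have hy0 : φ y = 0 := by
    rw [← Matrix.fromBlocks_toBlocks (φ y), h1.1, h1.2]
    have e1 : (φ y).toBlocks₁₁ = 0 := by
      have := congrArg Matrix.toBlocks₁₁ hx
      ext a b
      have h3 := congrFun (congrFun this a) b
      have h4 := congrFun (congrFun h2.1 a) b
      have h5 := congrFun (congrFun h11 a) b
      simp only [Matrix.toBlocks₁₁, Matrix.of_apply, Matrix.add_apply, Matrix.zero_apply] at *
      rw [h4, add_zero, h5] at h3; exact h3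
    have e2 : (φ y).toBlocks₂₂ = 0 := by
      have := congrArg Matrix.toBlocks₂₂ hx
      ext a b
      have h3 := congrFun (congrFun this a) b
      have h4 := congrFun (congrFun h2.2 a) b
      have h5 := congrFun (congrFun h22 a) b
      simp only [Matrix.toBlocks₂₂, Matrix.of_apply, Matrix.add_apply, Matrix.zero_apply] at *
      rw [h4, add_zero, h5] at h3; exact h3
    rw [e1, e2, Matrix.fromBlocks_zero]
  rwa [hy0, zero_add] at hx

/-- The matrices of even elements are block diagonal. -/
theorem even_apply {x : g} (hx : x ∈ part (L := g) 0) {j k : Fin n ⊕ Fin n}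
    (hjk : j.isLeft ≠ k.isLeft) : φ x j k = 0 := by
  rcases j with j | j <;> rcases k with k | k
  · exact absurd rfl hjk
  · exact congrFun (congrFun (hφ.even x hx).1 j) k
  · exact congrFun (congrFun (hφ.even x hx).2 j) k
  · exact absurd rfl hjk

/-- The natural representation of the even part on `ℂ^n ⊕ ℂ^n`. -/
abbrev lieRingModule : LieRingModule (part (L := g) 0) (Fin n ⊕ Fin n → ℂ) where
  bracket x v := (φ x).mulVec v
  add_lie x y v := by
    change (φ ((x : g) + y)).mulVec v = _
    rw [map_add, Matrix.add_mulVec]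
  lie_add x v w := Matrix.mulVec_add _ _ _
  leibniz_lie x y v := by
    change (φ x).mulVec ((φ y).mulVec v) = (φ (br (x : g) y)).mulVec v +
      (φ y).mulVec ((φ x).mulVec v)
    rw [hφ.map_br_even x.2 y.2, Matrix.sub_mulVec, Matrix.mulVec_mulVec, Matrix.mulVec_mulVec]
    abel

/-- `ℂ^n ⊕ 0` or `0 ⊕ ℂ^n`, as a module over the even part. -/
def side (b : Bool) :
    letI := hφ.lieRingModule
    LieSubmodule ℂ (part (L := g) 0) (Fin n ⊕ Fin n → ℂ) :=
  letI := hφ.lieRingModule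
  { carrier := {v | ∀ j, j.isLeft ≠ b → v j = 0}
    add_mem' := fun {v w} hv hw j hj => by rw [Pi.add_apply, hv j hj, hw j hj, add_zero]
    zero_mem' := fun _ _ => rfl
    smul_mem' := fun c v hv j hj => by rw [Pi.smul_apply, hv j hj, smul_zero]
    lie_mem := by
      intro x v hv j hj
      change ∑ k, φ x j k * v k = 0
      refine Finset.sum_eq_zero fun k _ => ?_
      by_cases hk : k.isLeft = b
      · rw [hφ.even_apply x.2 (fun h => hj (h.trans hk)), zero_mul]
      · rw [hv k hk, mul_zero] }

/-- A block-diagonal matrix can send a nonzero vector of one side to any vector of the same side. A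
scalar matrix in the other block does not affect these vectors and corrects the supertrace. -/
theorem isAtom_side (hn : 0 < n) (b : Bool) :
    letI := hφ.lieRingModule
    IsAtom (hφ.side b) := by
  let _ := hφ.lieRingModule
  have : Nonempty (Fin n) := ⟨⟨0, hn⟩⟩
  constructor
  · obtain ⟨i, hi⟩ : ∃ i : Fin n ⊕ Fin n, i.isLeft = b := by
      cases b
      · exact ⟨Sum.inr ⟨0, hn⟩, rfl⟩
      · exact ⟨Sum.inl ⟨0, hn⟩, rfl⟩
    intro h
    have h1 : (Pi.single i 1 : Fin n ⊕ Fin n → ℂ) ∈ hφ.side b := fun j hj => by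
      have : j ≠ i := fun h => hj (h ▸ hi)
      simp [this]
    rw [h, LieSubmodule.mem_bot] at h1
    simpa using congrFun h1 i
  · intro N hN
    by_contra hN0
    obtain ⟨v, hv, hv0⟩ := N.toSubmodule.ne_bot_iff.1 (by simpa using hN0)
    obtain ⟨i, hi⟩ := Function.ne_iff.1 hv0
    have hvb := hN.le hv
    have hib : i.isLeft = b := by
      by_contra h
      exact hi (hvb i h)
    apply hN.not_ge
    intro w hw
    -- The block moving `v` to `w` has only the column `i`, so its trace is `w i * (v i)⁻¹`; the
    -- scalar `t` on the other block has the same trace.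
    let t : ℂ := (w i * (v i)⁻¹) / n
    let M : Matrix (Fin n ⊕ Fin n) (Fin n ⊕ Fin n) ℂ :=
      fun j k => (if k = i then w j * (v i)⁻¹ else 0) + if j = k ∧ j.isLeft ≠ b then t else 0
    have hM : M.mulVec v = w := by
      funext j
      change ∑ k, M j k * v k = w j
      simp only [M, add_mul, Finset.sum_add_distrib, ite_mul, zero_mul]
      rw [Finset.sum_ite_eq' Finset.univ i, if_pos (Finset.mem_univ i), mul_assoc,
        inv_mul_cancel₀ hi, mul_one, add_eq_left]
      refine Finset.sum_eq_zero fun k _ => ?_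
      split_ifs with h
      · rw [← h.1, hvb j h.2, mul_zero]
      · rfl
    have hoff : ∀ j k, j.isLeft ≠ k.isLeft → M j k = 0 := by
      intro j k hjk
      simp only [M]
      rw [if_neg (fun h : j = k ∧ _ => hjk (by rw [h.1])), add_zero]
      split_ifs with h
      · rw [hw j (fun hj => hjk (by rw [hj, h, hib])), zero_mul]
      · rfl
    have hn0 : (n : ℂ) ≠ 0 := by exact_mod_cast hn.ne'
    have htr : M.toBlocks₁₁.trace - M.toBlocks₂₂.trace = 0 := by
      have ht : (n : ℂ) * t = w i * (v i)⁻¹ := by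
        simp only [t]; field_simp
      simp only [Matrix.trace, Matrix.diag_apply, Matrix.toBlocks₁₁, Matrix.toBlocks₂₂,
        Matrix.of_apply, M, Finset.sum_add_distrib]
      clear_value t
      subst hib
      rcases i with i | i
      · simp [ht]
      · simp [ht]
    obtain ⟨x, hx, hxM⟩ := hφ.exists_even htr
      (by ext j k; exact hoff _ _ (by simp)) (by ext j k; exact hoff _ _ (by simp))
    rw [← hM, ← hxM]
    exact N.lie_mem (x := ⟨x, hx⟩) hv

theorem sSup_atoms (hn : 0 < n) :
    letI := hφ.lieRingModule
    sSup {P : LieSubmodule ℂ (part (L := g) 0) (Fin n ⊕ Fin n → ℂ) | IsAtom P} = ⊤ := by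
  let _ := hφ.lieRingModule
  rw [eq_top_iff]
  intro v _
  have h : ∀ b, hφ.side b ≤
      sSup {P : LieSubmodule ℂ (part (L := g) 0) (Fin n ⊕ Fin n → ℂ) | IsAtom P} :=
    fun b => le_sSup (hφ.isAtom_side hn b)
  have hv : v = (fun j => if j.isLeft then v j else 0) + fun j => if j.isLeft then 0 else v j := by
    funext j
    rw [Pi.add_apply]
    split_ifs <;> simp
  rw [hv]
  refine add_mem (h true ?_) (h false ?_)
  · intro j hj
    simp [hj]
  · intro j hj
    simp [hj]

abbrev lieModule :
    letI := hφ.lieRingModule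
    LieModule ℂ (part (L := g) 0) (Fin n ⊕ Fin n → ℂ) :=
  letI := hφ.lieRingModule
  { smul_lie := fun c x v => by
      change (φ (c • (x : g))).mulVec v = c • (φ x).mulVec v
      rw [map_smul, Matrix.smul_mulVec]
    lie_smul := fun c x v => Matrix.mulVec_smul _ _ _ }

theorem faithful (x : part (L := g) 0) (hx : ∀ v, (φ x).mulVec v = 0) : x = 0 := by
  apply Subtype.ext
  apply hφ.injective
  change φ x = φ 0
  rw [map_zero]
  exact Matrix.mulVec_injective (funext fun v => by rw [hx, Matrix.zero_mulVec])

theorem finiteDimensional : FiniteDimensional ℂ g :=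
  FiniteDimensional.of_injective φ hφ.injective

/-- The center of the even part consists of scalar matrices. -/
theorem exists_eq_scalar (hn : 0 < n) {z : part (L := g) 0}
    (hz : z ∈ LieAlgebra.center ℂ (part (L := g) 0)) : ∃ c : ℂ, φ z = c • 1 := by
  let _ := hφ.lieRingModule
  have := hφ.lieModule
  have := hφ.finiteDimensional
  have key : ∀ b, ∃ c : ℂ, ∀ v ∈ hφ.side b, (φ z).mulVec v = c • v := by
    intro b
    obtain ⟨χ, hχ⟩ := LieAlgebra.exists_radical_lie_eq_smul_of_isAtom (hφ.isAtom_side hn b)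
    exact ⟨χ z, fun v hv => hχ z (LieAlgebra.center_le_radical _ _ hz) v hv⟩
  choose c hc using key
  have hdiag : ∀ j k, φ z j k = if j = k then c k.isLeft else 0 := by
    intro j k
    have h1 : (Pi.single k 1 : Fin n ⊕ Fin n → ℂ) ∈ hφ.side k.isLeft := fun l hl => by
      have : l ≠ k := fun h => hl (by rw [h])
      simp [this]
    have h2 := congrFun (hc _ _ h1) j
    rw [Matrix.mulVec_single_one, Pi.smul_apply, Pi.single_apply, Matrix.col_apply] at h2
    rw [h2]
    split_ifs <;> simp
  have htr := (hφ.range (φ z)).1 ⟨z, rfl⟩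
  -- The two blocks have equal size, so supertrace zero forces the two scalars to agree.
  have hcc : c true = c false := by
    simp only [Matrix.trace, Matrix.diag_apply, Matrix.toBlocks₁₁, Matrix.toBlocks₂₂,
        Matrix.of_apply, hdiag] at htr
    have hn0 : (n : ℂ) ≠ 0 := by exact_mod_cast hn.ne'
    simp at htr
    have := sub_eq_zero.1 htr
    exact mul_left_cancel₀ hn0 this
  refine ⟨c true, ?_⟩
  ext j k
  rw [hdiag, Matrix.smul_apply, Matrix.one_apply]
  have : c k.isLeft = c true := by
    cases k.isLeft
    · exact hcc.symm
    · rfl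
  split_ifs <;> simp [this]

theorem trace_lie_top_top {x : part (L := g) 0}
    (hx : x ∈ ⁅(⊤ : LieIdeal ℂ (part (L := g) 0)), (⊤ : LieIdeal ℂ (part (L := g) 0))⁆) :
    (φ x).trace = 0 := by
  rw [← LieSubmodule.mem_toSubmodule, LieSubmodule.lieIdeal_oper_eq_linear_span'] at hx
  induction hx using Submodule.span_induction with
  | mem x hx =>
    obtain ⟨a, -, b, -, rfl⟩ := hx
    rw [coe_even_lie, hφ.map_br_even a.2 b.2, Matrix.trace_sub, Matrix.trace_mul_comm, sub_self]
  | zero => simp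
  | add x y _ _ hx hy =>
    change (φ ((x : g) + y)).trace = 0
    rw [map_add, Matrix.trace_add, hx, hy, add_zero]
  | smul c x _ hx =>
    change (φ (c • (x : g))).trace = 0
    rw [map_smul, Matrix.trace_smul, hx, smul_zero]

/-- The center of the even part of `sl(n,n)` lies in every Cartan subalgebra. -/
theorem center_le (hn : 2 ≤ n) (S : SimpleRoots g)
    (h2 : LieAlgebra.IsKilling ℂ (⁅(⊤ : LieIdeal ℂ (part (L := g) 0)),
      (⊤ : LieIdeal ℂ (part (L := g) 0))⁆ : LieIdeal ℂ (part (L := g) 0)))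
    (h3 : (LieAlgebra.center ℂ (part (L := g) 0)).toSubmodule ⊔ (⁅(⊤ : LieIdeal ℂ (part (L := g) 0)),
      (⊤ : LieIdeal ℂ (part (L := g) 0))⁆ : LieIdeal ℂ (part (L := g) 0)).toSubmodule = ⊤) :
    (LieAlgebra.center ℂ (part (L := g) 0)).toSubmodule ≤ S.evenRoot 0 := by
  have := hφ.finiteDimensional
  intro z hz
  refine S.evenRoot_internal.mem_of_proj fun q hq => ?_
  obtain ⟨i, hi⟩ := Function.ne_iff.1 hq
  -- Scalar matrices commute with all of g, so nilpotency of the adjoint action cannot exclude a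
  -- component of nonzero degree. Instead, if there were one, it would span the center of g₀, and
  -- the degree derivation would multiply the center by `q i`. Corrected by an inner derivation, it
  -- vanishes on the derived algebra, and its value on `br x y` for two odd matrix units leads to a
  -- contradiction.
  by_contra hz0
  set z' := S.evenRoot_internal.proj q z with hz'
  have hz'q : (z' : g) ∈ S.root q := S.evenRoot_internal.proj_mem q z
  obtain ⟨a, ha⟩ := hφ.exists_eq_scalar (by omega) (S.proj_mem_center hz q)
  have ha0 : a ≠ 0 := by
    rintro rfl
    rw [zero_smul] at ha
    exact hz0 (Subtype.ext (hφ.injective (ha.trans (map_zero φ).symm)))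
  obtain ⟨D, hD, hDpart, hDroot⟩ := S.exists_super_degree_derivation i
  let D₀ : part (L := g) 0 →ₗ[ℂ] part (L := g) 0 := D.restrict (hDpart 0)
  obtain ⟨t, -, ht⟩ := LieAlgebra.exists_lie_eq_derivation D₀ fun x y => Subtype.ext (hD x y)
  -- the matrix units `x = E_{1,1'}` and `y = E_{1',1}`
  let k : Fin n := ⟨0, by omega⟩
  let l : Fin n := ⟨1, by omega⟩
  obtain ⟨x, hx, hxM⟩ := hφ.exists_odd (M := Matrix.single (Sum.inl k) (Sum.inr k) 1)
    (by ext; simp [Matrix.toBlocks₁₁])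
    (by ext; simp [Matrix.toBlocks₂₂])
  obtain ⟨y, hy, hyM⟩ := hφ.exists_odd (M := Matrix.single (Sum.inr k) (Sum.inl k) 1)
    (by ext; simp [Matrix.toBlocks₁₁])
    (by ext; simp [Matrix.toBlocks₂₂])
  have hxy0 : br x y ∈ part (L := g) 0 := by
    have := br_mem 1 1 x y hx hy
    rwa [show (1 : ZMod 2) + 1 = 0 from rfl] at this
  have hexy : (⟨br x y, hxy0⟩ : part (L := g) 0) ∈
      (LieAlgebra.center ℂ (part (L := g) 0)).toSubmodule ⊔ (⁅(⊤ : LieIdeal ℂ (part (L := g) 0)),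
      (⊤ : LieIdeal ℂ (part (L := g) 0))⁆ : LieIdeal ℂ (part (L := g) 0)).toSubmodule := by
    rw [h3]; trivial
  obtain ⟨u, hu, w, hw, huw⟩ := Submodule.mem_sup.1 hexy
  replace huw : (u : g) + w = br x y := congrArg Subtype.val huw
  obtain ⟨c, hc⟩ := hφ.exists_eq_scalar (by omega) hu
  have hφxy := hφ.map_br_odd hx hy
  -- The derived algebra of g₀ has trace zero, so the central part `u` of `br x y` is a nonzero
  -- scalar matrix.
  have htr : (φ (br x y)).trace = 2 := by
    rw [hφxy, hxM, hyM]
    simp [Matrix.trace_single_eq_same]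
    norm_num
  have hc0 : c ≠ 0 := by
    rintro rfl
    rw [← huw, map_add, hc, zero_smul, zero_add, hφ.trace_lie_top_top hw] at htr
    norm_num at htr
  -- `u` is a multiple of `z'`
  have huz : (u : g) = (c / a) • (z' : g) := by
    apply hφ.injective
    rw [map_smul, ha, hc, smul_smul, div_mul_cancel₀ c ha0]
  have hDu : D u = (q i : ℂ) • (u : g) := by
    rw [huz, map_smul, hDroot q _ hz'q, smul_comm]
  have hDw : D w = br (t : g) w := congrArg Subtype.val (ht w hw)
  have htu : br (t : g) u = 0 :=
    congrArg Subtype.val ((LieModule.mem_maxTrivSubmodule ℂ _ _ u).1 hu t)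
  -- Both sides are the value at `br x y` of the derivation D − ad t, which kills the derived part
  -- `w` and multiplies `u` by `q i`.
  have hmain : (q i : ℂ) • (u : g) = br (D x - br (t : g) x) y + br x (D y - br (t : g) y) := by
    have e1 := hD x y
    have e2 := br_jacobi_of_even t.2 x y
    have e3 : D (br x y) - br (t : g) (br x y) = (q i : ℂ) • (u : g) := by
      rw [← huw, map_add, map_add, hDu, hDw, htu]
      abel
    rw [← e3, e1, e2]
    simp only [map_sub, LinearMap.sub_apply]
    abel
  have hx' : D x - br (t : g) x ∈ part (L := g) 1 :=
    sub_mem (hDpart 1 x hx) (br_mem_part_of_even t.2 hx)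
  have hy' : D y - br (t : g) y ∈ part (L := g) 1 :=
    sub_mem (hDpart 1 y hy) (br_mem_part_of_even t.2 hy)
  -- Each product on the right contains a matrix unit with indices over `k` only, so its diagonal
  -- entry at `l ≠ k` is zero, while on the left this entry is `q i * c`. The second index `l`
  -- exists because `n ≥ 2`.
  have hfin := congrArg (fun x => φ x (Sum.inl l) (Sum.inl l)) hmain
  have hkl : k ≠ l := by simp [k, l]
  simp only [map_add, map_smul, hc, hφ.map_br_odd hx' hy, hφ.map_br_odd hx hy', hxM, hyM] at hfin
  simp [Matrix.mul_apply, hkl] at hfin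
  rcases hfin with h | h
  · exact hi h
  · exact hc0 h

theorem isReductiveGrading (hn : 2 ≤ n) (S : SimpleRoots g) :
    LieAlgebra.IsReductiveGrading S.evenRoot S.evenWt := by
  let _ := hφ.lieRingModule
  have := hφ.lieModule
  have := hφ.finiteDimensional
  have h1 := hφ.sSup_atoms (by omega)
  have h2 := LieAlgebra.isKilling_lie_top_top h1 hφ.faithful
  have h3 := LieAlgebra.center_sup_lie_top_top h1 hφ.faithful
  exact S.isReductiveGrading (hφ.center_le hn S h2 h3) h2 h3

end IsSlIso

end Sl

theorem SimpleRoots.finiteDimensional_of {g : Type*} [AddCommGroup g] [Module ℂ g]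
    [LieSuperalgebra g] (hg : IsBasic g ∨ ∃ n : ℕ, 2 ≤ n ∧ IsSl g n) : FiniteDimensional ℂ g := by
  obtain hg | ⟨n, -, φ, h1, h2, h3, h4, h5⟩ := hg
  · exact hg.finiteDimensional
  · exact IsSlIso.finiteDimensional ⟨h1, h2, h3, h4, h5⟩

theorem SimpleRoots.isReductiveGrading_of {g : Type*} [AddCommGroup g] [Module ℂ g]
    [LieSuperalgebra g] (hg : IsBasic g ∨ ∃ n : ℕ, 2 ≤ n ∧ IsSl g n) (S : SimpleRoots g) :
    LieAlgebra.IsReductiveGrading S.evenRoot S.evenWt := by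
  obtain hg | ⟨n, hn, φ, h1, h2, h3, h4, h5⟩ := hg
  · exact S.isReductiveGrading_of_isBasic hg
  · exact IsSlIso.isReductiveGrading ⟨h1, h2, h3, h4, h5⟩ hn S

end LieSuperalgebra

end

section

open scoped TensorProduct
open LieSuperalgebra Module

namespace LieSuperalgebra

/-! ### The enveloping superalgebra -/

namespace Env

variable {L : Type*} [AddCommGroup L] [Module ℂ L] [LieSuperalgebra L]

/-- The universal property of `U(L)`. -/
def lift {B : Type*} [Ring B] [Algebra ℂ B] (f : L →ₗ[ℂ] B)
    (hf : ∀ (i j : ZMod 2) (x y : L), x ∈ part i → y ∈ part j →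
      f x * f y = koszulSign i j • (f y * f x) + f (br x y)) : Env L →ₐ[ℂ] B :=
  RingQuot.liftAlgHom ℂ ⟨TensorAlgebra.lift ℂ f, by
    rintro _ _ ⟨i, j, x, y, hx, hy⟩
    simp only [map_mul, map_add, map_smul, TensorAlgebra.lift_ι_apply]
    exact hf i j x y hx hy⟩

theorem lift_ι {B : Type*} [Ring B] [Algebra ℂ B] (f : L →ₗ[ℂ] B)
    (hf : ∀ (i j : ZMod 2) (x y : L), x ∈ part i → y ∈ part j →
      f x * f y = koszulSign i j • (f y * f x) + f (br x y)) (x : L) : lift f hf (ι L x) = f x := by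
  have : lift f hf (RingQuot.mkAlgHom ℂ (EnvRel L) (TensorAlgebra.ι ℂ x)) = _ :=
    RingQuot.liftAlgHom_mkAlgHom_apply _ _ _ _
  exact this.trans (TensorAlgebra.lift_ι_apply f x)

theorem incl_ι {g : Type*} [AddCommGroup g] [Module ℂ g] [LieSuperalgebra g]
    {A : Type*} [CommRing A] [Algebra ℂ A] (x : g) :
    incl g A (ι g x) = ι (g ⊗[ℂ] A) (x ⊗ₜ 1) := by
  have : incl g A (RingQuot.mkAlgHom ℂ (EnvRel g) (TensorAlgebra.ι ℂ x)) = _ :=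
    RingQuot.liftAlgHom_mkAlgHom_apply _ _ _ _
  exact this.trans (TensorAlgebra.lift_ι_apply _ x)

variable (L) in
theorem adjoin_range_ι : Algebra.adjoin ℂ (Set.range (ι L)) = ⊤ := by
  have h1 : (⊤ : Subalgebra ℂ (TensorAlgebra ℂ L)).map (RingQuot.mkAlgHom ℂ (EnvRel L)) = ⊤ := by
    rw [Algebra.map_top, AlgHom.range_eq_top]
    exact RingQuot.mkAlgHom_surjective ℂ _
  have h2 := TensorAlgebra.adjoin_range_ι (R := ℂ) (M := L)
  rw [← h2, AlgHom.map_adjoin, ← Set.range_comp] at h1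
  exact h1

/-- An induction principle for a module generated by a vector. -/
theorem smul_induction {M : Type*} [AddCommGroup M] [Module ℂ M] [Module (Env L) M]
    [IsScalarTower ℂ (Env L) M] {s : Set L} (hs : Submodule.span ℂ s = ⊤) {v : M} {p : M → Prop}
    (hv : p v) (hadd : ∀ m m', p m → p m' → p (m + m')) (hsmul : ∀ (c : ℂ) m, p m → p (c • m))
    (hι : ∀ x ∈ s, ∀ m, p m → p (ι L x • m)) (u : Env L) : p (u • v) := by
  have h0 : p 0 := by simpa using hsmul 0 v hv
  have hι' : ∀ x : L, ∀ m, p m → p (ι L x • m) := by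
    intro x m hm
    have hx : x ∈ Submodule.span ℂ s := hs ▸ Submodule.mem_top
    induction hx using Submodule.span_induction with
    | mem x hx => exact hι x hx m hm
    | zero => rwa [map_zero, zero_smul]
    | add x y _ _ hx hy => rw [map_add, add_smul]; exact hadd _ _ hx hy
    | smul c x _ hx => rw [map_smul, smul_assoc]; exact hsmul c _ hx
  have hu : u ∈ Algebra.adjoin ℂ (Set.range (ι L)) := adjoin_range_ι L ▸ Algebra.mem_top
  have key : ∀ m, p m → p (u • m) := by
    induction hu using Algebra.adjoin_induction with
    | mem x hx => obtain ⟨x, rfl⟩ := hx; exact hι' x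
    | algebraMap c => intro m hm; rw [algebraMap_smul]; exact hsmul c m hm
    | add x y _ _ hx hy => intro m hm; rw [add_smul]; exact hadd _ _ (hx m hm) (hy m hm)
    | mul x y _ _ hx hy => intro m hm; rw [mul_smul]; exact hx _ (hy m hm)
  exact key v hv

section DegPart

variable {Γ : Type*} [AddCommMonoid Γ] {γ : Γ → Submodule ℂ L}

theorem one_mem_degPart : (1 : Env L) ∈ degPart γ 0 :=
  Submodule.subset_span ⟨[], by simp, by simp, by simp⟩

theorem ι_mul_mem_degPart {p q : Γ} {x : L} (hx : x ∈ γ p) {u : Env L} (hu : u ∈ degPart γ q) :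
    ι L x * u ∈ degPart γ (p + q) := by
  have : degPart γ q ≤ (degPart γ (p + q)).comap (LinearMap.mulLeft ℂ (ι L x)) := by
    refine Submodule.span_le.2 ?_
    rintro _ ⟨l, hl, hq, rfl⟩
    refine Submodule.subset_span ⟨(p, x) :: l, ?_, by simp [hq], by simp⟩
    simpa using ⟨hx, fun a b hab => hl (a, b) hab⟩
  exact this hu

theorem ι_mem_degPart {p : Γ} {x : L} (hx : x ∈ γ p) : ι L x ∈ degPart γ p := by
  simpa using ι_mul_mem_degPart hx one_mem_degPart

variable {M : Type*} [AddCommGroup M] [Module ℂ M] [Module (Env L) M] [IsScalarTower ℂ (Env L) M]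

theorem mem_orbit {P : Submodule ℂ (Env L)} {v m : M} : m ∈ orbit P v ↔ ∃ u ∈ P, u • v = m :=
  Iff.rfl

theorem self_mem_orbit (v : M) : v ∈ orbit (degPart γ 0) v :=
  mem_orbit.2 ⟨1, one_mem_degPart, one_smul _ _⟩

theorem ι_smul_mem_orbit {p q : Γ} {x : L} (hx : x ∈ γ p) {v m : M}
    (hm : m ∈ orbit (degPart γ q) v) : ι L x • m ∈ orbit (degPart γ (p + q)) v := by
  obtain ⟨u, hu, rfl⟩ := mem_orbit.1 hm
  exact mem_orbit.2 ⟨_, ι_mul_mem_degPart hx hu, mul_smul _ _ _⟩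

/-- An induction principle for the elements of degree `q` of a graded module. -/
theorem orbit_induction {v : M} {N : Γ → Submodule ℂ M} (hv : v ∈ N 0)
    (hN : ∀ p q, ∀ x ∈ γ p, ∀ m ∈ N q, ι L x • m ∈ N (p + q)) (q : Γ) :
    orbit (degPart γ q) v ≤ N q := by
  have : degPart γ q ≤
      (N q).comap ((LinearMap.toSpanSingleton (Env L) M v).restrictScalars ℂ) := by
    refine Submodule.span_le.2 ?_
    rintro _ ⟨l, hl, hq, rfl⟩
    change (l.map fun p => ι L p.2).prod • v ∈ N q
    induction l generalizing q with
    | nil => simpa [← hq] using hv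
    | cons a l ih =>
      rw [List.map_cons, List.prod_cons, mul_smul, ← hq, List.map_cons, List.sum_cons]
      exact hN _ _ _ (hl a (by simp)) _ (ih _ (fun p hp => hl p (by simp [hp])) rfl)
  rintro _ ⟨u, hu, rfl⟩
  exact this hu

end DegPart

end Env

/-! ### The action of the even part -/

/-- A representation of a Lie algebra, as a Lie module. -/
abbrev lieRingModuleOfEnd {K L M : Type*} [CommRing K] [LieRing L] [LieAlgebra K L] [AddCommGroup M]
    [Module K M] (ρ : L →ₗ[K] Module.End K M)
    (hρ : ∀ x y, ρ ⁅x, y⁆ = ρ x * ρ y - ρ y * ρ x) : LieRingModule L M where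
  bracket x m := ρ x m
  add_lie x y m := by simp
  lie_add x m m' := map_add _ _ _
  leibniz_lie x y m := by
    change ρ x (ρ y m) = ρ ⁅x, y⁆ m + ρ y (ρ x m)
    simp [hρ]

theorem lieModuleOfEnd {K L M : Type*} [CommRing K] [LieRing L] [LieAlgebra K L] [AddCommGroup M]
    [Module K M] (ρ : L →ₗ[K] Module.End K M)
    (hρ : ∀ x y, ρ ⁅x, y⁆ = ρ x * ρ y - ρ y * ρ x) :
    letI := lieRingModuleOfEnd ρ hρ
    LieModule K L M :=
  letI := lieRingModuleOfEnd ρ hρ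
  { smul_lie := fun c x m => by change ρ (c • x) m = c • ρ x m; simp
    lie_smul := fun c x m => map_smul _ _ _ }

section EvenAction

variable {L : Type*} [AddCommGroup L] [Module ℂ L] [LieSuperalgebra L]

theorem Env.ι_lie_of_even {x : L} (hx : x ∈ part (L := L) 0) (y : L) :
    Env.ι L (br x y) = Env.ι L x * Env.ι L y - Env.ι L y * Env.ι L x := by
  refine part_induction (p := fun y => Env.ι L (br x y) =
    Env.ι L x * Env.ι L y - Env.ι L y * Env.ι L x) (fun j y hy => ?_)
    (fun a b ha hb => by simp only [map_add, ha, hb, mul_add, add_mul]; abel) y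
  rw [Env.ι_mul_ι 0 j x y hx hy, koszulSign_zero_left, one_smul, add_sub_cancel_left]

variable (L) (M : Type*) [AddCommGroup M] [Module ℂ M] [Module (Env L) M]
  [IsScalarTower ℂ (Env L) M]

/-- The action of the even part on a module over the enveloping algebra. -/
def evenEnd : part (L := L) 0 →ₗ[ℂ] Module.End ℂ M :=
  (Algebra.lsmul ℂ ℂ M : Env L →ₐ[ℂ] Module.End ℂ M).toLinearMap ∘ₗ Env.ι L ∘ₗ
    (part (L := L) 0).subtype

theorem evenEnd_apply (x : part (L := L) 0) (m : M) : evenEnd L M x m = Env.ι L x • m := rfl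

theorem evenEnd_lie (x y : part (L := L) 0) :
    evenEnd L M ⁅x, y⁆ = evenEnd L M x * evenEnd L M y - evenEnd L M y * evenEnd L M x := by
  ext m
  rw [evenEnd_apply, coe_even_lie, Env.ι_lie_of_even x.2, sub_smul, mul_smul, mul_smul]
  rfl

end EvenAction

section MapEvenAction

variable (g : Type*) [AddCommGroup g] [Module ℂ g] [LieSuperalgebra g]
  (A : Type*) [CommRing A] [Algebra ℂ A] (M : Type*) [AddCommGroup M] [Module ℂ M]
  [Module (Env (g ⊗[ℂ] A)) M] [IsScalarTower ℂ (Env (g ⊗[ℂ] A)) M]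

/-- The action of the even part of `g` on a `g ⊗ A`-module. -/
def mapEvenEnd : part (L := g) 0 →ₗ[ℂ] Module.End ℂ M :=
  (Algebra.lsmul ℂ ℂ M : Env (g ⊗[ℂ] A) →ₐ[ℂ] Module.End ℂ M).toLinearMap ∘ₗ
    Env.ι (g ⊗[ℂ] A) ∘ₗ (TensorProduct.mk ℂ g A).flip 1 ∘ₗ (part (L := g) 0).subtype

variable {A M}

theorem br_tmul (x y : g) (a b : A) :
    br (L := g ⊗[ℂ] A) (x ⊗ₜ a) (y ⊗ₜ b) = br x y ⊗ₜ (a * b) := mapBr_tmul x y a b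

theorem tmul_mem_part {i : ZMod 2} {x : g} (hx : x ∈ part i) (a : A) :
    x ⊗ₜ[ℂ] a ∈ part (L := g ⊗[ℂ] A) i := tmul_mem_tensorPart hx a

theorem mapEvenEnd_apply (x : part (L := g) 0) (m : M) :
    mapEvenEnd g A M x m = Env.ι (g ⊗[ℂ] A) ((x : g) ⊗ₜ 1) • m := rfl

theorem mapEvenEnd_lie (x y : part (L := g) 0) :
    mapEvenEnd g A M ⁅x, y⁆ = mapEvenEnd g A M x * mapEvenEnd g A M y -
      mapEvenEnd g A M y * mapEvenEnd g A M x := by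
  ext m
  have h := Env.ι_lie_of_even (tmul_mem_part g x.2 (1 : A)) ((y : g) ⊗ₜ[ℂ] (1 : A))
  rw [br_tmul, one_mul] at h
  rw [mapEvenEnd_apply, coe_even_lie, h, sub_smul, mul_smul, mul_smul]
  rfl

end MapEvenAction

/-! ### Triples -/

namespace SimpleRoots

variable {g : Type*} [AddCommGroup g] [Module ℂ g] [LieSuperalgebra g] {S : SimpleRoots g}

theorem IsTriple.isSl2Triple {α : Fin S.rank → ℤ} {e f : g} {h : S.cartan} (t : S.IsTriple α e f h) :
    IsSl2Triple (⟨h, S.cartan_even h.2⟩ : part (L := g) 0) ⟨e, t.e_mem.2⟩ ⟨f, t.f_mem.2⟩ where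
  h_ne_zero h0 := by
    have h1 := t.br_h_e
    rw [show (h : g) = 0 from congrArg Subtype.val h0, map_zero, LinearMap.zero_apply] at h1
    exact t.e_ne_zero ((smul_eq_zero.1 h1.symm).resolve_left two_ne_zero)
  lie_e_f := Subtype.ext t.br_e_f
  lie_h_e_nsmul := Subtype.ext (by
    rw [coe_even_lie, t.br_h_e, two_smul, two_nsmul]; rfl)
  lie_h_f_nsmul := Subtype.ext (by
    rw [coe_even_lie, t.br_h_f, two_smul, two_nsmul]; rfl)

end SimpleRoots

end LieSuperalgebra

end

section

open scoped TensorProduct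
open LieSuperalgebra Module

namespace LieSuperalgebra

/-! ### Primitive vectors in locally finite representations -/

section Primitive

variable {L M : Type*} [LieRing L] [LieAlgebra ℂ L] [AddCommGroup M] [Module ℂ M]
  (ρ : L →ₗ[ℂ] Module.End ℂ M) (hρ : ∀ x y, ρ ⁅x, y⁆ = ρ x * ρ y - ρ y * ρ x)
  {N : Submodule ℂ M} [FiniteDimensional ℂ N] (hN : ∀ x, ∀ m ∈ N, ρ x m ∈ N)
  {h e f : L} (t : IsSl2Triple h e f) {v : M} (hvN : v ∈ N) {μ : ℂ}
  (hh : ρ h v = μ • v) (he : ρ e v = 0)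
include hρ hN t hvN hh he

theorem exists_nat_of_primitive (hv : v ≠ 0) : ∃ n : ℕ, μ = n := by
  let _ := lieRingModuleOfEnd ρ hρ
  have := lieModuleOfEnd ρ hρ
  let N' : LieSubmodule ℂ L M := { N with lie_mem := fun {x m} hm => hN x m hm }
  have : FiniteDimensional ℂ N' := inferInstanceAs (FiniteDimensional ℂ N)
  have P : t.HasPrimitiveVectorWith (⟨v, hvN⟩ : N') μ :=
    ⟨fun h0 => hv (congrArg Subtype.val h0), Subtype.ext hh, Subtype.ext he⟩
  exact P.exists_nat

theorem pow_eq_zero_of_primitive {n : ℕ} (hn : μ = n) : (ρ f ^ (n + 1)) v = 0 := by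
  by_cases hv : v = 0
  · rw [hv, map_zero]
  let _ := lieRingModuleOfEnd ρ hρ
  have := lieModuleOfEnd ρ hρ
  let N' : LieSubmodule ℂ L M := { N with lie_mem := fun {x m} hm => hN x m hm }
  have : FiniteDimensional ℂ N' := inferInstanceAs (FiniteDimensional ℂ N)
  have P : t.HasPrimitiveVectorWith (⟨v, hvN⟩ : N') μ :=
    ⟨fun h0 => hv (congrArg Subtype.val h0), Subtype.ext hh, Subtype.ext he⟩
  have h1 := congrArg Subtype.val (P.pow_toEnd_f_eq_zero_of_eq_nat hn)
  have h2 : ∀ k : ℕ, (((LieModule.toEnd ℂ L N' f ^ k) ⟨v, hvN⟩ : N') : M) = (ρ f ^ k) v := by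
    intro k
    induction k with
    | zero => rfl
    | succ k ih => rw [pow_succ', pow_succ', Module.End.mul_apply, Module.End.mul_apply, ← ih]; rfl
  rw [← h2, h1]
  rfl

end Primitive

namespace SimpleRoots

variable {g : Type*} [AddCommGroup g] [Module ℂ g] [LieSuperalgebra g] (S : SimpleRoots g)
  {A : Type*} [CommRing A] [Algebra ℂ A]

variable (A) in
/-- The elements `x ⊗ a` with `x` homogeneous span `g ⊗ A`. -/
theorem span_homogeneous_tmul : Submodule.span ℂ
    {t : g ⊗[ℂ] A | ∃ q j, ∃ x ∈ S.root q, x ∈ part (L := g) j ∧ ∃ a : A, t = x ⊗ₜ a} = ⊤ := by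
  rw [eq_top_iff]
  rintro t -
  induction t using TensorProduct.induction_on with
  | zero => exact zero_mem _
  | add x y hx hy => exact add_mem hx hy
  | tmul x a =>
    refine S.homogeneous_induction (p := fun x => x ⊗ₜ[ℂ] a ∈ Submodule.span ℂ
      {t : g ⊗[ℂ] A | ∃ q j, ∃ x ∈ S.root q, x ∈ part (L := g) j ∧ ∃ a : A, t = x ⊗ₜ a})
      (fun q j x hx hj => Submodule.subset_span ⟨q, j, x, hx, hj, a, rfl⟩) (fun x y hx hy => ?_) x
    rw [TensorProduct.add_tmul]
    exact add_mem hx hy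

/-! ### Straightening in modules generated by a highest weight vector. -/

section Lower

variable {M : Type*} [AddCommGroup M] [Module (Env (g ⊗[ℂ] A)) M]

variable (A) in
/-- The vectors obtained from `v` by the successive action of elements `x ⊗ a` with `x` homogeneous
of degree `≤ 0`, with their total degrees. -/
inductive IsLower (v : M) : (Fin S.rank → ℤ) → M → Prop
  | base : IsLower v 0 v
  | cons {q p : Fin S.rank → ℤ} {j : ZMod 2} {x : g} (a : A) {m : M} (hx : x ∈ S.root q)
      (hj : x ∈ part (L := g) j) (hq : q ≤ 0) (h : IsLower v p m) :
      IsLower v (q + p) (Env.ι (g ⊗[ℂ] A) (x ⊗ₜ a) • m)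

variable {S} {v : M}

theorem IsLower.le_zero {q : Fin S.rank → ℤ} {m : M} (h : S.IsLower A v q m) : q ≤ 0 := by
  induction h with
  | base => exact le_rfl
  | cons _ _ _ hq _ ih => exact add_nonpos hq ih

variable (S A) in
/-- The commutative algebra generated by `𝔥 ⊗ A`. -/
def cartanAlg : Subalgebra ℂ (Env (g ⊗[ℂ] A)) :=
  Algebra.adjoin ℂ {u | ∃ h ∈ S.root 0, ∃ a : A, u = Env.ι (g ⊗[ℂ] A) (h ⊗ₜ a)}

theorem commute_of_mem_cartanAlg {u u' : Env (g ⊗[ℂ] A)} (hu : u ∈ S.cartanAlg A)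
    (hu' : u' ∈ S.cartanAlg A) : u * u' = u' * u := by
  refine Algebra.commute_of_mem_adjoin_of_forall_mem_commute (R := ℂ) hu' fun b hb => ?_
  refine (Algebra.commute_of_mem_adjoin_of_forall_mem_commute (R := ℂ) hu fun c hc => ?_).symm
  obtain ⟨h, hh, a, rfl⟩ := hb
  obtain ⟨h', hh', a', rfl⟩ := hc
  have h1 := Env.ι_lie_of_even (tmul_mem_part g (S.cartan_even hh) a) (h' ⊗ₜ[ℂ] a')
  rw [br_tmul, S.cartan_abelian h hh h' hh', TensorProduct.zero_tmul, map_zero] at h1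
  exact (sub_eq_zero.1 h1.symm)

/-- All factors have degree at most zero, so a total degree of zero forces each of them into 𝔥 ⊗ A.
-/
theorem IsLower.exists_mem_cartanAlg {q : Fin S.rank → ℤ} {m : M} (h : S.IsLower A v q m)
    (hq : q = 0) : ∃ u ∈ S.cartanAlg A, m = u • v := by
  induction h with
  | base => exact ⟨1, one_mem _, (one_smul _ _).symm⟩
  | @cons q p j x a m hx hj hq0 h ih =>
    have hp := h.le_zero
    have hq' : q = 0 := le_antisymm hq0 (by
      rw [← hq]; exact add_le_of_nonpos_right hp)
    subst hq'
    obtain ⟨u, hu, rfl⟩ := ih (by simpa using hq)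
    exact ⟨_, mul_mem (Algebra.subset_adjoin ⟨x, hx, a, rfl⟩) hu, (mul_smul _ _ _).symm⟩

variable [Module ℂ M] [IsScalarTower ℂ (Env (g ⊗[ℂ] A)) M]

/-- A factor of positive degree is moved to the right until it meets `v` and kills it. Each
commutator is a single homogeneous factor applied to a shorter product, hence covered by the
induction hypothesis for arbitrary `x` and `a`. This replaces the use of a triangular factorization
of U(g ⊗ A). -/
theorem IsLower.smul_mem_span (hv : ∀ x ∈ S.nPlus, ∀ a : A, Env.ι (g ⊗[ℂ] A) (x ⊗ₜ a) • v = 0)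
    {q : Fin S.rank → ℤ} {m : M} (h : S.IsLower A v q m) {p : Fin S.rank → ℤ} {j : ZMod 2} {x : g}
    (hx : x ∈ S.root p) (hj : x ∈ part (L := g) j) (a : A) :
    Env.ι (g ⊗[ℂ] A) (x ⊗ₜ a) • m ∈ Submodule.span ℂ {m | S.IsLower A v (p + q) m} := by
  induction h generalizing p j x a with
  | base =>
    by_cases hx0 : x = 0
    · simp [hx0]
    by_cases hp : p ≤ 0
    · exact Submodule.subset_span (.cons a hx hj hp .base)
    · have hp' := (S.nonneg_or_nonpos ((Submodule.ne_bot_iff _).2 ⟨x, hx, hx0⟩)).resolve_right hp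
      rw [hv x (S.root_le_nPlus hp' (fun h => hp h.le) hx)]
      exact zero_mem _
  | @cons q' p' j' y b m hy hj' hq' h ih =>
    by_cases hx0 : x = 0
    · simp [hx0]
    by_cases hp : p ≤ 0
    · exact Submodule.subset_span (.cons a hx hj hp (.cons b hy hj' hq' h))
    rw [← mul_smul, Env.ι_mul_ι j j' _ _ (tmul_mem_part g hj a) (tmul_mem_part g hj' b), add_smul,
      smul_assoc, mul_smul, br_tmul]
    refine add_mem (Submodule.smul_mem _ _ ?_) ?_
    · have h1 := ih hx hj a
      have h2 : Submodule.span ℂ {m | S.IsLower A v (p + p') m} ≤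
          (Submodule.span ℂ {m | S.IsLower A v (p + (q' + p')) m}).comap
            (Algebra.lsmul ℂ ℂ M (Env.ι (g ⊗[ℂ] A) (y ⊗ₜ b))) := by
        refine Submodule.span_le.2 fun m hm => Submodule.subset_span ?_
        rw [show p + (q' + p') = q' + (p + p') by abel]
        exact .cons b hy hj' hq' hm
      exact h2 h1
    · rw [← add_assoc]
      exact ih (S.root_br _ _ _ _ hx hy) (br_mem _ _ _ _ hj hj') (a * b)

theorem orbit_le_span_isLower
    (hv : ∀ x ∈ S.nPlus, ∀ a : A, Env.ι (g ⊗[ℂ] A) (x ⊗ₜ a) • v = 0) (q : Fin S.rank → ℤ) :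
    orbit (Env.degPart (fun q' => tensorPart A (S.root q')) q) v ≤
      Submodule.span ℂ {m | S.IsLower A v q m} := by
  refine Env.orbit_induction (N := fun q => Submodule.span ℂ {m | S.IsLower A v q m})
    (Submodule.subset_span .base) (fun p q x hx m hm => ?_) q
  have key : ∀ p, ∀ x ∈ S.root p, ∀ a : A, Env.ι (g ⊗[ℂ] A) (x ⊗ₜ a) • m ∈
      Submodule.span ℂ {m | S.IsLower A v (p + q) m} := by
    intro p x hx a
    have hpart : ∀ j, ∀ x ∈ S.root p, x ∈ part (L := g) j → Env.ι (g ⊗[ℂ] A) (x ⊗ₜ a) • m ∈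
        Submodule.span ℂ {m | S.IsLower A v (p + q) m} := by
      intro j x hx hj
      induction hm using Submodule.span_induction with
      | mem m hm => exact hm.smul_mem_span hv hx hj a
      | zero => simp
      | add m m' _ _ h h' => rw [smul_add]; exact add_mem h h'
      | smul c m _ h =>
        rw [smul_comm]
        exact Submodule.smul_mem _ _ h
    obtain ⟨y, hy, z, hz, rfl⟩ := Submodule.mem_sup.1 (S.root_le_inf_part p hx)
    rw [TensorProduct.add_tmul, map_add, add_smul]
    exact add_mem (hpart 0 y hy.1 hy.2) (hpart 1 z hz.1 hz.2)
  induction hx using Submodule.span_induction with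
  | mem t ht =>
    obtain ⟨x, hx, a, rfl⟩ := ht
    exact key p x hx a
  | zero => simp
  | add m m' _ _ h h' => rw [map_add, add_smul]; exact add_mem h h'
  | smul c m _ h => rw [map_smul, smul_assoc]; exact Submodule.smul_mem _ _ h

/-- The weights of a module generated by a highest weight vector lie below its weight. -/
theorem smul_eq_zero_of_not_le
    (hv : ∀ x ∈ S.nPlus, ∀ a : A, Env.ι (g ⊗[ℂ] A) (x ⊗ₜ a) • v = 0) {q : Fin S.rank → ℤ}
    (hq : ¬ q ≤ 0) {u : Env (g ⊗[ℂ] A)}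
    (hu : u ∈ Env.degPart (fun q' => tensorPart A (S.root q')) q) : u • v = 0 := by
  have h1 := orbit_le_span_isLower hv q (Env.mem_orbit.2 ⟨u, hu, rfl⟩)
  have h2 : {m | S.IsLower A v q m} = ∅ :=
    Set.eq_empty_of_forall_notMem fun m hm => hq hm.le_zero
  rwa [h2, Submodule.span_empty, Submodule.mem_bot] at h1

variable (S A) in
/-- `v` is zero or a highest weight vector of weight `lam`. -/
structure IsExtremal (lam : Module.Dual ℂ S.cartan) (v : M) : Prop where
  nPlus_smul : ∀ x ∈ S.nPlus, ∀ a : A, Env.ι (g ⊗[ℂ] A) (x ⊗ₜ a) • v = 0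
  cartan_smul : ∀ h : S.cartan, Env.ι (g ⊗[ℂ] A) ((h : g) ⊗ₜ 1) • v = lam h • v

/-- In an integrable module, highest weight vectors satisfy the defining relations of
`V̄(lam)`. -/
theorem IsExtremal.pow_smul_eq_zero {lam : Module.Dual ℂ S.cartan} (hv : S.IsExtremal A lam v)
    (hM : IsEvenIntegrable g A M) {α : Fin S.rank → ℤ} (hα : α ∈ S.simpleEvenRoots) {e f : g}
    {h : S.cartan} {n : ℕ} (t : S.IsTriple α e f h) (hn : lam h = n) :
    Env.ι (g ⊗[ℂ] A) (f ⊗ₜ 1) ^ (n + 1) • v = 0 := by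
  obtain ⟨F, hF, -, hsup⟩ := hM
  have hvF : v ∈ sSup F := hsup ▸ Submodule.mem_top
  obtain ⟨s, hsF, hvs⟩ := Submodule.mem_sSup_iff_exists_finset.1 hvF
  -- Finitely many irreducible summands already contain `v`, and their sum is a finite-dimensional
  -- g₀-module in which sl₂-theory applies.
  let N : Submodule ℂ M := s.sup id
  have hN : FiniteDimensional ℂ N := by
    refine Module.Finite.iff_fg.2 (Submodule.fg_finset_sup s id fun P hP => ?_)
    exact Module.Finite.iff_fg.1 (hF P (hsF hP)).1
  have hvN : v ∈ N := by
    simp only [N, Finset.sup_eq_iSup]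
    exact hvs
  have hstab : ∀ x, ∀ m ∈ N, mapEvenEnd g A M x m ∈ N := by
    intro x
    have : N ≤ N.comap (mapEvenEnd g A M x) := Finset.sup_le fun P hP m hm =>
      (Finset.le_sup (f := id) hP : P ≤ N) ((hF P (hsF hP)).2.1 x x.2 m hm)
    exact this
  have hpow : ∀ k, (mapEvenEnd g A M ⟨f, t.f_mem.2⟩ ^ k) v =
      Env.ι (g ⊗[ℂ] A) (f ⊗ₜ 1) ^ k • v := by
    intro k
    induction k with
    | zero => simp
    | succ k ih => rw [pow_succ', pow_succ', Module.End.mul_apply, ih, mul_smul]; rfl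
  rw [← hpow]
  exact pow_eq_zero_of_primitive (mapEvenEnd g A M) (mapEvenEnd_lie g) hstab t.isSl2Triple hvN
    (hv.cartan_smul h) (hv.nPlus_smul e (S.root_le_nPlus hα.1.1 hα.1.2.1 t.e_mem.1) 1) hn

end Lower

/-! ### The universal property of the global Weyl module -/

section Universal

variable {M : Type*} [AddCommGroup M] [Module ℂ M] [Module (Env (g ⊗[ℂ] A)) M]
  [IsScalarTower ℂ (Env (g ⊗[ℂ] A)) M]

/-- Vectors satisfying the defining relations of `W(lam)` are images of its generator. -/
theorem exists_weyl_lift (lam : Module.Dual ℂ S.cartan) (v : M)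
    (h1 : ∀ x ∈ S.nPlus, Env.ι (g ⊗[ℂ] A) (x ⊗ₜ 1) • v = 0)
    (h2 : ∀ h : S.cartan, Env.ι (g ⊗[ℂ] A) ((h : g) ⊗ₜ 1) • v = lam h • v)
    (h3 : ∀ α ∈ S.simpleEvenRoots, ∀ (e f : g) (h : S.cartan) (n : ℕ), S.IsTriple α e f h →
      lam h = n → Env.ι (g ⊗[ℂ] A) (f ⊗ₜ 1) ^ (n + 1) • v = 0)
    (h4 : ∀ q, ¬ q ≤ 0 → ∀ u ∈ Env.degPart (fun q' => tensorPart A (S.root q')) q, u • v = 0) :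
    ∃ F : S.Weyl A lam →ₗ[Env (g ⊗[ℂ] A)] M, F (S.weylVec A lam) = v := by
  -- With `M` restricted to U(g), the map is built through the three quotients in turn: the Kac
  -- module, the induced module, and the removal of the weight spaces that are not lower.
  let _ : Module (Env g) M := Module.compHom M (Env.incl g A).toRingHom
  have hsm : ∀ (x : Env g) (m : M), x • m = Env.incl g A x • m := fun _ _ => rfl
  have : IsScalarTower ℂ (Env g) M := ⟨fun c x m => by
    rw [hsm, hsm, map_smul, smul_assoc]⟩
  have hle : S.kacIdeal lam ≤ LinearMap.ker (LinearMap.toSpanSingleton (Env g) M v) := by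
    refine Submodule.span_le.2 ?_
    rintro u ((⟨x, hx, rfl⟩ | ⟨h, rfl⟩) | ⟨α, hα, e, f, h, n, t, hn, rfl⟩)
    · change Env.ι g x • v = 0
      rw [hsm, Env.incl_ι]
      exact h1 x hx
    · change (Env.ι g (h : g) - algebraMap ℂ (Env g) (lam h)) • v = 0
      rw [sub_smul, algebraMap_smul, hsm, Env.incl_ι, h2, sub_self]
    · change (Env.ι g f ^ (n + 1)) • v = 0
      rw [hsm, map_pow, Env.incl_ι]
      exact h3 α hα e f h n t hn
  let k : S.Kac lam →ₗ[Env g] M := (S.kacIdeal lam).liftQ _ hle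
  have : SMulCommClass ℂ (Env (g ⊗[ℂ] A)) M := inferInstance
  let F₁ : Env (g ⊗[ℂ] A) ⊗[ℂ] S.Kac lam →ₗ[Env (g ⊗[ℂ] A)] M :=
    TensorProduct.AlgebraTensorModule.lift
      (LinearMap.toSpanSingleton (Env (g ⊗[ℂ] A)) (S.Kac lam →ₗ[ℂ] M) (k.restrictScalars ℂ))
  have hF₁ : ∀ u x, F₁ (u ⊗ₜ x) = u • k x := fun u x => rfl
  have hle₁ : inducedRel g A (S.Kac lam) ≤ LinearMap.ker F₁ := by
    refine Submodule.span_le.2 ?_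
    rintro _ ⟨u, x, y, rfl⟩
    change F₁ _ = 0
    rw [map_sub, hF₁, hF₁, map_smul, hsm, mul_smul, sub_self]
  let F₂ : Induced g A (S.Kac lam) →ₗ[Env (g ⊗[ℂ] A)] M := (inducedRel g A (S.Kac lam)).liftQ F₁ hle₁
  have hF₂ : F₂ (S.inducedVec A lam) = v := by
    change F₁ (1 ⊗ₜ S.kacVec lam) = v
    rw [hF₁, one_smul]
    change (1 : Env g) • v = v
    rw [one_smul]
  have hle₂ : S.nonLowerSubmodule A lam ≤ LinearMap.ker F₂ := by
    refine Submodule.span_le.2 ?_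
    rintro m ⟨q, hq, hm⟩
    obtain ⟨u, hu, rfl⟩ := Env.mem_orbit.1 hm
    change F₂ _ = 0
    rw [map_smul, hF₂, h4 q hq u hu]
  exact ⟨(S.nonLowerSubmodule A lam).liftQ F₂ hle₂, hF₂⟩

end Universal

end SimpleRoots

end LieSuperalgebra

end

section

open scoped TensorProduct
open LieSuperalgebra Module

namespace LieSuperalgebra

/-! ### Twisting modules by automorphisms -/

/-- The module `M` with the action of `U(L)` composed with `τ`. -/
def Twisted {L : Type*} [AddCommGroup L] [Module ℂ L] [LieSuperalgebra L] (_τ : Env L →ₐ[ℂ] Env L)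
    (M : Type*) := M

namespace Twisted

variable {L : Type*} [AddCommGroup L] [Module ℂ L] [LieSuperalgebra L] (τ : Env L →ₐ[ℂ] Env L)
  (M : Type*) [AddCommGroup M] [Module ℂ M] [Module (Env L) M] [IsScalarTower ℂ (Env L) M]

instance : AddCommGroup (Twisted τ M) := inferInstanceAs (AddCommGroup M)
instance : Module ℂ (Twisted τ M) := inferInstanceAs (Module ℂ M)
instance : Module (Env L) (Twisted τ M) := Module.compHom M τ.toRingHom

variable {M}

/-- The identity map from `M` to its twist. -/
def of : M ≃ₗ[ℂ] Twisted τ M := LinearEquiv.refl ℂ M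

omit [IsScalarTower ℂ (Env L) M] in
theorem smul_of (u : Env L) (m : M) : u • of τ m = of τ (τ u • m) := rfl

instance : IsScalarTower ℂ (Env L) (Twisted τ M) := ⟨fun c u m => by
  change τ (c • u) • (show M from m) = c • (τ u • (show M from m))
  rw [map_smul, smul_assoc]⟩

variable {τ} in
/-- A homomorphism from `M` to its twist, as a semilinear operator on `M`. -/
theorem exists_linearMap (F : M →ₗ[Env L] Twisted τ M) : ∃ F' : M →ₗ[ℂ] M,
    (∀ m, of τ (F' m) = F m) ∧ ∀ (u : Env L) m, F' (u • m) = τ u • F' m := by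
  let F' : M →ₗ[ℂ] M := (of τ).symm.toLinearMap ∘ₗ F.restrictScalars ℂ
  have hF' : ∀ m, of τ (F' m) = F m := fun m => LinearEquiv.apply_symm_apply _ (F m)
  exact ⟨F', hF', fun u m => (of τ).injective (by rw [hF', map_smul, ← hF', smul_of])⟩

end Twisted

theorem ι_smul_tmul {g : Type*} [AddCommGroup g] [Module ℂ g] [LieSuperalgebra g]
    {A : Type*} [CommRing A] [Algebra ℂ A] (c : ℂ) (x : g) (a : A) :
    Env.ι (g ⊗[ℂ] A) ((c • x) ⊗ₜ a) = c • Env.ι (g ⊗[ℂ] A) (x ⊗ₜ a) := by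
  rw [← TensorProduct.smul_tmul', LinearMap.map_smul]

namespace SimpleRoots

variable {g : Type*} [AddCommGroup g] [Module ℂ g] [LieSuperalgebra g] (S : SimpleRoots g)

theorem exists_scaling (s : (Fin S.rank → ℤ) → ZMod 2 → ℂ) :
    ∃ T : g →ₗ[ℂ] g, ∀ q j, ∀ x ∈ S.root q, x ∈ part (L := g) j → T x = s q j • x := by
  have h1 : ∀ j, ∃ T : g →ₗ[ℂ] g, ∀ q, ∀ x ∈ S.root q, T x = s q j • x := by
    intro j
    obtain ⟨T, hT⟩ := S.root_internal.exists_linearMap (fun q => s q j • (S.root q).subtype)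
    exact ⟨T, fun q x hx => hT q x hx⟩
  choose T hT using h1
  have hc := LieSuperalgebra.isCompl (L := g)
  let P₀ : g →ₗ[ℂ] g := (part (L := g) 0).subtype ∘ₗ (part (L := g) 0).projectionOnto (part 1) hc
  let P₁ : g →ₗ[ℂ] g :=
    (part (L := g) 1).subtype ∘ₗ (part (L := g) 1).projectionOnto (part 0) hc.symm
  have h00 : ∀ x ∈ part (L := g) 0, P₀ x = x := fun x hx =>
    congrArg Subtype.val (Submodule.projectionOnto_apply_left hc ⟨x, hx⟩)
  have h01 : ∀ x ∈ part (L := g) 1, P₀ x = 0 := fun x hx =>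
    congrArg Subtype.val (Submodule.projectionOnto_apply_right hc ⟨x, hx⟩)
  have h11 : ∀ x ∈ part (L := g) 1, P₁ x = x := fun x hx =>
    congrArg Subtype.val (Submodule.projectionOnto_apply_left hc.symm ⟨x, hx⟩)
  have h10 : ∀ x ∈ part (L := g) 0, P₁ x = 0 := fun x hx =>
    congrArg Subtype.val (Submodule.projectionOnto_apply_right hc.symm ⟨x, hx⟩)
  refine ⟨T 0 ∘ₗ P₀ + T 1 ∘ₗ P₁, fun q j x hx hj => ?_⟩
  change T 0 (P₀ x) + T 1 (P₁ x) = _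
  obtain rfl | rfl := zmod_two_cases j
  · rw [h00 x hj, h10 x hj, map_zero, add_zero, hT 0 q x hx]
  · rw [h01 x hj, h11 x hj, map_zero, zero_add, hT 1 q x hx]

variable (A : Type*) [CommRing A] [Algebra ℂ A] (lam : Module.Dual ℂ S.cartan)

/-! ### The generator of the global Weyl module -/

theorem incl_smul_weylVec (u : Env g) (hu : u ∈ S.kacIdeal lam) :
    Env.incl g A u • S.weylVec A lam = 0 := by
  have h1 : Env.incl g A u • S.inducedVec A lam = 0 := by
    have h2 : Env.incl g A u • S.inducedVec A lam =
        Submodule.Quotient.mk ((1 * Env.incl g A u) ⊗ₜ S.kacVec lam) := by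
      rw [one_mul, inducedVec, ← Submodule.Quotient.mk_smul, TensorProduct.smul_tmul', smul_eq_mul,
        mul_one]
    have h3 : u • S.kacVec lam = 0 := by
      rw [kacVec, ← Submodule.Quotient.mk_smul, smul_eq_mul, mul_one]
      exact (Submodule.Quotient.mk_eq_zero _).2 hu
    have h4 : ((1 * Env.incl g A u) ⊗ₜ[ℂ] S.kacVec lam - 1 ⊗ₜ[ℂ] (u • S.kacVec lam)) ∈
        inducedRel g A (S.Kac lam) := Submodule.subset_span ⟨_, _, _, rfl⟩
    rw [h3, TensorProduct.tmul_zero, sub_zero] at h4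
    rw [h2]
    exact (Submodule.Quotient.mk_eq_zero _).2 h4
  rw [weylVec, ← Submodule.Quotient.mk_smul, h1, Submodule.Quotient.mk_zero]

theorem smul_weylVec_of_not_le {q : Fin S.rank → ℤ} (hq : ¬ q ≤ 0) {u : Env (g ⊗[ℂ] A)}
    (hu : u ∈ Env.degPart (fun q' => tensorPart A (S.root q')) q) : u • S.weylVec A lam = 0 := by
  rw [weylVec, ← Submodule.Quotient.mk_smul]
  exact (Submodule.Quotient.mk_eq_zero _).2 (Submodule.subset_span ⟨q, hq, u, hu, rfl⟩)

/-- The relations of V̄(λ) only give annihilation by 𝔫⁺ ⊗ 1. That all of 𝔫⁺ ⊗ A kills the generator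
comes from dividing out the weights outside λ − Q⁺. -/
theorem isExtremal_weylVec : S.IsExtremal A lam (S.weylVec A lam) where
  nPlus_smul x hx a := by
    replace hx := S.nPlus_le hx
    induction hx using Submodule.span_induction with
    | mem x hx =>
      obtain ⟨q, hq, hq0, hx'⟩ := hx
      exact S.smul_weylVec_of_not_le A lam (fun h => hq0 (le_antisymm h hq))
        (Env.ι_mem_degPart (tmul_mem_tensorPart hx' a))
    | zero => simp
    | add x y _ _ h h' => rw [TensorProduct.add_tmul, map_add, add_smul, h, h', add_zero]
    | smul c x _ h => rw [ι_smul_tmul, smul_assoc, h, smul_zero]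
  cartan_smul h := by
    have h1 := S.incl_smul_weylVec A lam (Env.ι g (h : g) - algebraMap ℂ (Env g) (lam h))
      (Submodule.subset_span (Or.inl (Or.inr ⟨h, rfl⟩)))
    rw [map_sub, Env.incl_ι, AlgHom.commutes, sub_smul, algebraMap_smul, sub_eq_zero] at h1
    exact h1

theorem pow_smul_weylVec {α : Fin S.rank → ℤ} (hα : α ∈ S.simpleEvenRoots) {e f : g} {h : S.cartan}
    {n : ℕ} (t : S.IsTriple α e f h) (hn : lam h = n) :
    Env.ι (g ⊗[ℂ] A) (f ⊗ₜ 1) ^ (n + 1) • S.weylVec A lam = 0 := by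
  have h1 := S.incl_smul_weylVec A lam (Env.ι g f ^ (n + 1))
    (Submodule.subset_span (Or.inr ⟨α, hα, e, f, h, n, t, hn, rfl⟩))
  rwa [map_pow, Env.incl_ι] at h1

theorem exists_smul_weylVec (m : S.Weyl A lam) : ∃ u : Env (g ⊗[ℂ] A), u • S.weylVec A lam = m := by
  obtain ⟨m, rfl⟩ := Submodule.Quotient.mk_surjective _ m
  obtain ⟨m, rfl⟩ := Submodule.Quotient.mk_surjective _ m
  suffices h : ∃ u : Env (g ⊗[ℂ] A), u • S.inducedVec A lam = Submodule.Quotient.mk m by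
    obtain ⟨u, hu⟩ := h
    exact ⟨u, by rw [weylVec, ← Submodule.Quotient.mk_smul, hu]⟩
  induction m using TensorProduct.induction_on with
  | zero => exact ⟨0, by rw [zero_smul, Submodule.Quotient.mk_zero]⟩
  | add x y hx hy =>
    obtain ⟨u, hu⟩ := hx
    obtain ⟨u', hu'⟩ := hy
    exact ⟨u + u', by rw [add_smul, hu, hu', Submodule.Quotient.mk_add]⟩
  | tmul u x =>
    obtain ⟨x, rfl⟩ := Submodule.Quotient.mk_surjective _ x
    refine ⟨u * Env.incl g A x, ?_⟩
    rw [inducedVec, ← Submodule.Quotient.mk_smul, TensorProduct.smul_tmul', smul_eq_mul, mul_one,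
      Submodule.Quotient.eq]
    refine Submodule.subset_span ⟨u, x, S.kacVec lam, ?_⟩
    rw [kacVec, ← Submodule.Quotient.mk_smul, smul_eq_mul, mul_one]

theorem span_weylVec : Submodule.span (Env (g ⊗[ℂ] A)) {S.weylVec A lam} = ⊤ := by
  rw [eq_top_iff]
  intro m _
  obtain ⟨u, rfl⟩ := S.exists_smul_weylVec A lam m
  exact Submodule.smul_mem _ _ (Submodule.mem_span_singleton_self _)

/-- An induction principle for the global Weyl module. -/
theorem weyl_induction {p : S.Weyl A lam → Prop} (hv : p (S.weylVec A lam))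
    (hadd : ∀ m m', p m → p m' → p (m + m')) (hsmul : ∀ (c : ℂ) m, p m → p (c • m))
    (hι : ∀ q j, ∀ x ∈ S.root q, x ∈ part (L := g) j → ∀ (a : A) m, p m →
      p (Env.ι (g ⊗[ℂ] A) (x ⊗ₜ a) • m)) (m : S.Weyl A lam) : p m := by
  obtain ⟨u, rfl⟩ := S.exists_smul_weylVec A lam m
  refine Env.smul_induction (S.span_homogeneous_tmul A) hv hadd hsmul ?_ u
  rintro _ ⟨q, j, x, hx, hj, a, rfl⟩ m hm
  exact hι q j x hx hj a m hm

variable {A lam} in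
/-- Homomorphisms from the global Weyl module are determined by the image of the generator. -/
theorem weyl_hom_ext {M : Type*} [AddCommGroup M] [Module (Env (g ⊗[ℂ] A)) M]
    {f f' : S.Weyl A lam →ₗ[Env (g ⊗[ℂ] A)] M} (h : f (S.weylVec A lam) = f' (S.weylVec A lam)) :
    f = f' := by
  refine LinearMap.ext fun m => ?_
  obtain ⟨u, rfl⟩ := S.exists_smul_weylVec A lam m
  rw [map_smul, map_smul, h]

/-! ### Operators on the global Weyl module defined by gradings -/

/-- A multiplicative function of degree and parity defines an automorphism of `g ⊗ A`. -/
theorem exists_scaling_algHom (s : (Fin S.rank → ℤ) → ZMod 2 → ℂ)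
    (hmul : ∀ q j q' j', s q j * s q' j' = s (q + q') (j + j')) :
    ∃ (T : g →ₗ[ℂ] g) (τ : Env (g ⊗[ℂ] A) →ₐ[ℂ] Env (g ⊗[ℂ] A)),
      (∀ q j, ∀ x ∈ S.root q, x ∈ part (L := g) j → T x = s q j • x) ∧
      (∀ x ∈ S.nPlus, T x ∈ S.nPlus) ∧
      ∀ (x : g) (a : A), τ (Env.ι (g ⊗[ℂ] A) (x ⊗ₜ a)) = Env.ι (g ⊗[ℂ] A) (T x ⊗ₜ a) := by
  obtain ⟨T, hT⟩ := S.exists_scaling s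
  have hTbr : ∀ x y, br (T x) (T y) = T (br x y) := by
    intro x y
    refine S.homogeneous_induction (p := fun x => br (T x) (T y) = T (br x y))
      (fun q j x hx hj => ?_) (fun a b ha hb => by simp only [map_add, LinearMap.add_apply, ha, hb]) x
    refine S.homogeneous_induction (p := fun y => br (T x) (T y) = T (br x y))
      (fun q' j' y hy hj' => ?_) (fun a b ha hb => by simp only [map_add, ha, hb]) y
    rw [hT q j x hx hj, hT q' j' y hy hj',
      hT _ _ _ (S.root_br _ _ _ _ hx hy) (br_mem _ _ _ _ hj hj'), map_smul, map_smul,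
      LinearMap.smul_apply, smul_smul, mul_comm, hmul]
  have hTpart : ∀ j, ∀ x ∈ part (L := g) j, T x ∈ part (L := g) j := by
    intro j x hx
    obtain ⟨s', hs'⟩ := S.root_internal.exists_eq_sum_proj x
    rw [hs', map_sum]
    refine Submodule.sum_mem _ fun q _ => ?_
    rw [hT q j _ (S.root_internal.proj_mem q x) (S.proj_mem_part q hx)]
    exact Submodule.smul_mem _ _ (S.proj_mem_part q hx)
  have hTn : ∀ x ∈ S.nPlus, T x ∈ S.nPlus := by
    have : S.nPlus ≤ S.nPlus.comap T := by
      refine generated_le ?_ fun x hx y hy => ?_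
      · rintro _ ⟨i, rfl⟩
        change T _ ∈ S.nPlus
        rw [hT _ _ _ (S.X_mem i) (S.X_parity i)]
        exact Submodule.smul_mem _ _ (subset_generated _ ⟨i, rfl⟩)
      · change T _ ∈ S.nPlus
        rw [← hTbr]
        exact br_mem_generated hx hy
    exact this
  let T' : g ⊗[ℂ] A →ₗ[ℂ] g ⊗[ℂ] A := TensorProduct.map T LinearMap.id
  have hT'part : ∀ j, ∀ x ∈ part (L := g ⊗[ℂ] A) j, T' x ∈ part (L := g ⊗[ℂ] A) j := by
    intro j
    have : part (L := g ⊗[ℂ] A) j ≤ (part (L := g ⊗[ℂ] A) j).comap T' := by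
      refine Submodule.span_le.2 ?_
      rintro _ ⟨x, hx, a, rfl⟩
      exact tmul_mem_part g (hTpart j x hx) a
    exact this
  have hT'br : ∀ x y : g ⊗[ℂ] A, br (T' x) (T' y) = T' (br x y) := by
    intro x y
    induction x using TensorProduct.induction_on with
    | zero => simp
    | add a b ha hb => simp only [map_add, LinearMap.add_apply, ha, hb]
    | tmul x a =>
      induction y using TensorProduct.induction_on with
      | zero => simp
      | add a b ha hb => simp only [map_add, ha, hb]
      | tmul y b =>
        change br (T x ⊗ₜ[ℂ] a) (T y ⊗ₜ[ℂ] b) = T' (br (x ⊗ₜ[ℂ] a) (y ⊗ₜ[ℂ] b))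
        rw [br_tmul, br_tmul, hTbr]
        rfl
  let τ : Env (g ⊗[ℂ] A) →ₐ[ℂ] Env (g ⊗[ℂ] A) := Env.lift (Env.ι (g ⊗[ℂ] A) ∘ₗ T') (by
    intro i j x y hx hy
    rw [LinearMap.comp_apply, LinearMap.comp_apply, LinearMap.comp_apply,
      Env.ι_mul_ι i j _ _ (hT'part i x hx) (hT'part j y hy), hT'br])
  exact ⟨T, τ, hT, hTn, fun x a => Env.lift_ι _ _ _⟩

/-- A multiplicative function of degree and parity defines an operator on `W(lam)`. -/
theorem exists_weyl_operator (s : (Fin S.rank → ℤ) → ZMod 2 → ℂ) (h0 : s 0 0 = 1)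
    (hmul : ∀ q j q' j', s q j * s q' j' = s (q + q') (j + j')) :
    ∃ F : S.Weyl A lam →ₗ[ℂ] S.Weyl A lam, F (S.weylVec A lam) = S.weylVec A lam ∧
      ∀ q j, ∀ x ∈ S.root q, x ∈ part (L := g) j → ∀ (a : A) m,
        F (Env.ι (g ⊗[ℂ] A) (x ⊗ₜ a) • m) = s q j • (Env.ι (g ⊗[ℂ] A) (x ⊗ₜ a) • F m) := by
  obtain ⟨T, τ, hT, hTn, hτ⟩ := S.exists_scaling_algHom A s hmul
  set w := S.weylVec A lam with hw
  have hext := S.isExtremal_weylVec A lam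
  -- The automorphism only rescales homogeneous elements and fixes 𝔥, so the generator satisfies the
  -- same relations in the twisted module. The resulting homomorphism from W(λ) to its twist is the
  -- operator sought.
  have hn : ∀ x ∈ S.nPlus, ∀ a : A, Env.ι (g ⊗[ℂ] A) (x ⊗ₜ a) • Twisted.of τ w = 0 := by
    intro x hx a
    rw [Twisted.smul_of, hτ, hext.nPlus_smul _ (hTn x hx), map_zero]
  obtain ⟨F, hF⟩ := S.exists_weyl_lift lam (Twisted.of τ w) (fun x hx => hn x hx 1)
    (by
      intro h
      rw [Twisted.smul_of, hτ, hT 0 0 h h.2 (S.cartan_even h.2), h0, one_smul, hext.cartan_smul,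
        map_smul])
    (by
      intro α hα e f h n t hn
      rw [Twisted.smul_of, map_pow, hτ, hT _ 0 f t.f_mem.1 t.f_mem.2, ι_smul_tmul,
        smul_pow, smul_assoc, S.pow_smul_weylVec A lam hα t hn, smul_zero, map_zero])
    (fun q hq u hu => smul_eq_zero_of_not_le hn hq hu)
  obtain ⟨F', hF', hF'u⟩ := Twisted.exists_linearMap F
  refine ⟨F', (Twisted.of τ).injective (by rw [hF', hF]), fun q j x hx hj a m => ?_⟩
  rw [hF'u, hτ, hT q j x hx hj, ι_smul_tmul, smul_assoc]

/-- The two parts span because W(λ) is cyclic; the point is that they intersect trivially. The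
operator attached to the sign of the parity acts on them by 1 and −1. -/
theorem isSuperGrading_weylGrading : IsSuperGrading (L := g ⊗[ℂ] A) (S.weylGrading A lam) where
  isCompl := by
    constructor
    · obtain ⟨F, hF, hFx⟩ := S.exists_weyl_operator A lam (fun _ j => (-1) ^ j.val) (by simp) (by
        intro _ j _ j'
        obtain rfl | rfl := zmod_two_cases j <;> obtain rfl | rfl := zmod_two_cases j' <;>
          simp [ZMod.val_one, show (1 : ZMod 2) + 1 = 0 from rfl])
      have hFx' : ∀ j, ∀ x ∈ part (L := g ⊗[ℂ] A) j, ∀ m, F (Env.ι (g ⊗[ℂ] A) x • m) =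
          ((-1) ^ j.val : ℂ) • (Env.ι (g ⊗[ℂ] A) x • F m) := by
        intro j x hx m
        have key : ∀ x ∈ part (L := g) j, ∀ a : A, F (Env.ι (g ⊗[ℂ] A) (x ⊗ₜ a) • m) =
          ((-1) ^ j.val : ℂ) • (Env.ι (g ⊗[ℂ] A) (x ⊗ₜ a) • F m) := by
          intro x hx a
          obtain ⟨s, hs⟩ := S.root_internal.exists_eq_sum_proj x
          rw [hs]
          simp only [TensorProduct.sum_tmul, map_sum, Finset.sum_smul, Finset.smul_sum]
          exact Finset.sum_congr rfl fun q _ =>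
            hFx q j _ (S.root_internal.proj_mem q x) (S.proj_mem_part q hx) a m
        induction hx using Submodule.span_induction with
        | mem x hx =>
          obtain ⟨x, hx, a, rfl⟩ := hx
          exact key x hx a
        | zero => simp
        | add x y _ _ hx hy => simp only [map_add, add_smul, hx, hy, smul_add]
        | smul c x _ hx => rw [LinearMap.map_smul, smul_assoc, LinearMap.map_smul, hx, smul_assoc, smul_comm c]
      have heig : ∀ i, S.weylGrading A lam i ≤
          LinearMap.ker (F - ((-1) ^ i.val : ℂ) • LinearMap.id) := by
        refine Env.orbit_induction (γ := part (L := g ⊗[ℂ] A))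
          (N := fun i => LinearMap.ker (F - ((-1) ^ i.val : ℂ) • LinearMap.id)) ?_ ?_
        · simp [hF]
        · intro i j x hx m hm
          rw [LinearMap.mem_ker, LinearMap.sub_apply, sub_eq_zero] at hm ⊢
          rw [hFx' i x hx, hm]
          simp only [LinearMap.smul_apply, LinearMap.id_apply]
          rw [smul_comm (Env.ι (g ⊗[ℂ] A) x), smul_smul]
          congr 1
          obtain rfl | rfl := zmod_two_cases i <;> obtain rfl | rfl := zmod_two_cases j <;>
            simp [ZMod.val_one, show (1 : ZMod 2) + 1 = 0 from rfl]
      rw [Submodule.disjoint_def]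
      intro m h0 h1
      have e0 := heig 0 h0
      have e1 := heig 1 h1
      simp only [LinearMap.mem_ker, LinearMap.sub_apply, LinearMap.smul_apply, LinearMap.id_apply,
        ZMod.val_zero, ZMod.val_one, pow_zero, pow_one, one_smul, neg_one_smul] at e0 e1
      have h2 : (2 : ℂ) • m = 0 := by
        rw [two_smul]
        rw [sub_eq_zero] at e0 e1
        nth_rewrite 1 [← e0]
        rw [e1]; simp
      exact (smul_eq_zero.1 h2).resolve_left two_ne_zero
    · rw [codisjoint_iff, eq_top_iff]
      intro m _
      refine S.weyl_induction A lam (p := fun m => m ∈ S.weylGrading A lam 0 ⊔ S.weylGrading A lam 1)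
        ?_ (fun _ _ h h' => add_mem h h') (fun c _ h => Submodule.smul_mem _ c h) ?_ m
      · exact Submodule.mem_sup_left (Env.self_mem_orbit _)
      · intro q j x hx hj a m hm
        obtain ⟨y, hy, z, hz, rfl⟩ := Submodule.mem_sup.1 hm
        rw [smul_add]
        have h1 := Env.ι_smul_mem_orbit (γ := part (L := g ⊗[ℂ] A)) (tmul_mem_part g hj a) hy
        have h2 := Env.ι_smul_mem_orbit (γ := part (L := g ⊗[ℂ] A)) (tmul_mem_part g hj a) hz
        obtain rfl | rfl := zmod_two_cases j
        · exact add_mem (Submodule.mem_sup_left h1) (Submodule.mem_sup_right h2)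
        · exact add_mem (Submodule.mem_sup_right h1) (Submodule.mem_sup_left h2)
  smul_mem i j x m hx hm := Env.ι_smul_mem_orbit (γ := part (L := g ⊗[ℂ] A)) hx hm

end SimpleRoots

end LieSuperalgebra

end

section

open scoped TensorProduct
open LieSuperalgebra Module

namespace LieSuperalgebra

/-! ### Integrability -/

/-- A locally finite module that is the sum of its irreducible submodules is an object of
`I(g ⊗ A, g₀)`. -/
theorem isEvenIntegrable_of_sSup_atoms {g : Type*} [AddCommGroup g] [Module ℂ g] [LieSuperalgebra g]
    {A : Type*} [CommRing A] [Algebra ℂ A] {M : Type*} [AddCommGroup M] [Module ℂ M]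
    [Module (Env (g ⊗[ℂ] A)) M] [IsScalarTower ℂ (Env (g ⊗[ℂ] A)) M]
    (h : letI := lieRingModuleOfEnd (mapEvenEnd g A M) (mapEvenEnd_lie g)
      sSup {P : LieSubmodule ℂ (part (L := g) 0) M | IsAtom P ∧ FiniteDimensional ℂ P} = ⊤)
    (hfin : letI := lieRingModuleOfEnd (mapEvenEnd g A M) (mapEvenEnd_lie g)
      ∀ m : M, ∃ N : LieSubmodule ℂ (part (L := g) 0) M, FiniteDimensional ℂ N ∧ m ∈ N) :
    IsEvenIntegrable g A M := by
  let _ := lieRingModuleOfEnd (mapEvenEnd g A M) (mapEvenEnd_lie g)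
  have := lieModuleOfEnd (mapEvenEnd g A M) (mapEvenEnd_lie g)
  have htop : sSup {P : LieSubmodule ℂ (part (L := g) 0) M | IsAtom P} = ⊤ :=
    eq_top_iff.2 (h.symm.le.trans (sSup_le_sSup fun P hP => hP.1))
  -- The independent family may consist of any irreducible submodules. Each is finite-dimensional
  -- nevertheless, since it lies in every finite-dimensional submodule containing one of its nonzero
  -- vectors.
  obtain ⟨s, hs, hsup, hatom⟩ := exists_sSupIndep_of_sSup_atoms_eq_top htop
  have hfd : ∀ P ∈ s, FiniteDimensional ℂ P := by
    intro P hP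
    obtain ⟨m, hm, hm0⟩ := P.toSubmodule.ne_bot_iff.1 (by simpa using (hatom hP).1)
    obtain ⟨N, hN, hmN⟩ := hfin m
    have hPN : P ≤ N := by
      rw [← inf_eq_left]
      refine ((hatom hP).le_iff.1 (inf_le_left : P ⊓ N ≤ P)).resolve_left fun h0 => hm0 ?_
      have : m ∈ P ⊓ N := ⟨hm, hmN⟩
      rwa [h0, LieSubmodule.mem_bot] at this
    exact Submodule.finiteDimensional_of_le (S₂ := N.toSubmodule) hPN
  refine ⟨Set.range fun P : s => (P : LieSubmodule ℂ (part (L := g) 0) M).toSubmodule, ?_, ?_, ?_⟩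
  · rintro _ ⟨⟨P, hP⟩, rfl⟩
    refine ⟨hfd P hP, fun x hx m hm => P.lie_mem (x := ⟨x, hx⟩) hm, ?_, fun N' hN' hst => ?_⟩
    · simpa using (hatom hP).1
    · let N : LieSubmodule ℂ (part (L := g) 0) M :=
        { N' with lie_mem := fun {x m} hm => hst x x.2 m hm }
      rcases (hatom hP).le_iff.1 (show N ≤ P from hN') with h0 | h0
      · exact Or.inl (congrArg LieSubmodule.toSubmodule h0)
      · exact Or.inr (congrArg LieSubmodule.toSubmodule h0)
  · exact (LieSubmodule.iSupIndep_toSubmodule.2 ((sSupIndep_iff s).1 hs)).sSupIndep_range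
  · rw [sSup_range, eq_top_iff]
    have h1 := congrArg LieSubmodule.toSubmodule hsup
    rw [sSup_eq_iSup', LieSubmodule.iSup_toSubmodule, LieSubmodule.top_toSubmodule] at h1
    exact h1.symm.le

namespace SimpleRoots

variable {g : Type*} [AddCommGroup g] [Module ℂ g] [LieSuperalgebra g] {S : SimpleRoots g}
  {A : Type*} [CommRing A] [Algebra ℂ A]

theorem mem_simpleEvenRoots {q : Fin S.rank → ℤ} (hq : 0 ≤ q) (hq0 : q ≠ 0) (hb : S.evenRoot q ≠ ⊥)
    (h : ∀ q₁ q₂, 0 ≤ q₁ → q₁ ≠ 0 → S.evenRoot q₁ ≠ ⊥ → 0 ≤ q₂ → q₂ ≠ 0 → S.evenRoot q₂ ≠ ⊥ →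
      q ≠ q₁ + q₂) : q ∈ S.simpleEvenRoots := by
  have key : ∀ q, S.evenRoot q ≠ ⊥ ↔ S.root q ⊓ part 0 ≠ ⊥ := by
    intro q
    rw [Submodule.ne_bot_iff, Submodule.ne_bot_iff]
    constructor
    · rintro ⟨x, hx, hx0⟩
      exact ⟨x, ⟨hx, x.2⟩, fun h => hx0 (Subtype.ext h)⟩
    · rintro ⟨x, hx, hx0⟩
      exact ⟨⟨x, hx.2⟩, hx.1, fun h => hx0 (congrArg Subtype.val h)⟩
  exact ⟨⟨hq, hq0, (key q).1 hb⟩, fun q₁ h1 q₂ h2 => h q₁ q₂ h1.1 h1.2.1 ((key _).2 h1.2.2)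
    h2.1 h2.2.1 ((key _).2 h2.2.2)⟩

/-- Every simple even root has an `sl(2)`-triple whose negative root vector spans its root
space. -/
theorem exists_isTriple [FiniteDimensional ℂ g]
    (hS : LieAlgebra.IsReductiveGrading S.evenRoot S.evenWt) {q : Fin S.rank → ℤ} (hq0 : q ≠ 0)
    (hb : S.evenRoot q ≠ ⊥) : ∃ (e f : g) (h : S.cartan), S.IsTriple q e f h ∧
      ∀ x ∈ S.evenRoot (-q), ∃ c : ℂ, (x : g) = c • f := by
  obtain ⟨h, hh, e, he, f, hf, t⟩ := hS.exists_isSl2Triple hq0 hb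
  refine ⟨e, f, ⟨h, hh⟩, ⟨⟨he, e.2⟩, ⟨hf, f.2⟩, fun h0 => t.e_ne_zero (Subtype.ext h0),
    congrArg Subtype.val t.lie_e_f, ?_, ?_⟩, fun x hx => ?_⟩
  · exact congrArg Subtype.val (t.lie_h_e_smul ℂ)
  · exact congrArg Subtype.val (t.lie_lie_smul_f ℂ)
  · obtain ⟨c, hc⟩ := hS.exists_eq_smul (neg_ne_zero.2 hq0) hf t.f_ne_zero hx
    exact ⟨c, congrArg Subtype.val hc⟩

section

variable {M : Type*} [AddCommGroup M] [Module ℂ M] [Module (Env (g ⊗[ℂ] A)) M]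
  [IsScalarTower ℂ (Env (g ⊗[ℂ] A)) M] {lam : Module.Dual ℂ S.cartan} {v : M}

theorem IsExtremal.isLower_cartan_smul (hv : S.IsExtremal A lam v) {q : Fin S.rank → ℤ} {m : M}
    (hm : S.IsLower A v q m) (h : S.cartan) :
    Env.ι (g ⊗[ℂ] A) ((h : g) ⊗ₜ 1) • m = (lam h + S.wt q h) • m := by
  induction hm with
  | base => rw [hv.cartan_smul, map_zero, LinearMap.zero_apply, add_zero]
  | @cons q p j x a m hx hj hq hm ih =>
    have h1 := Env.ι_lie_of_even (tmul_mem_part g (S.cartan_even h.2) (1 : A)) (x ⊗ₜ[ℂ] a)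
    rw [br_tmul, one_mul, S.br_cartan hx h, ι_smul_tmul, eq_sub_iff_add_eq] at h1
    rw [← mul_smul, ← h1, add_smul, mul_smul, ih, smul_assoc, smul_comm _ (lam h + S.wt p h),
      ← add_smul, map_add, LinearMap.add_apply]
    congr 1
    ring

theorem IsExtremal.span_isLower (hv : S.IsExtremal A lam v)
    (hgen : ∀ m : M, ∃ u : Env (g ⊗[ℂ] A), u • v = m) :
    Submodule.span ℂ {m : M | ∃ q, S.IsLower A v q m} = ⊤ := by
  rw [eq_top_iff]
  intro m _
  obtain ⟨u, rfl⟩ := hgen m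
  refine Env.smul_induction (S.span_homogeneous_tmul A)
    (p := fun m => m ∈ Submodule.span ℂ {m : M | ∃ q, S.IsLower A v q m})
    (Submodule.subset_span ⟨0, .base⟩) (fun _ _ h h' => add_mem h h')
    (fun c _ h => Submodule.smul_mem _ c h) ?_ u
  rintro _ ⟨q, j, x, hx, hj, a, rfl⟩ m hm
  induction hm using Submodule.span_induction with
  | mem m hm =>
    obtain ⟨p, hm⟩ := hm
    exact Submodule.span_mono (show {m | S.IsLower A v (q + p) m} ⊆ {m | ∃ q, S.IsLower A v q m} from
      fun m hm => ⟨_, hm⟩) (hm.smul_mem_span hv.nPlus_smul hx hj a)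
  | zero => simp
  | add m m' _ _ h h' => rw [smul_add]; exact add_mem h h'
  | smul c m _ h => rw [smul_comm]; exact Submodule.smul_mem _ _ h

/-- Even positive root vectors act locally nilpotently. -/
theorem IsExtremal.isLocallyNilpotent_of_pos (hv : S.IsExtremal A lam v)
    (hgen : ∀ m : M, ∃ u : Env (g ⊗[ℂ] A), u • v = m) {q : Fin S.rank → ℤ} (hq : 0 ≤ q)
    (hq0 : q ≠ 0) {x : part (L := g) 0} (hx : x ∈ S.evenRoot q) :
    (mapEvenEnd g A M x).IsLocallyNilpotent := by
  intro m
  have hm : m ∈ Submodule.span ℂ {m : M | ∃ q, S.IsLower A v q m} := by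
    rw [hv.span_isLower hgen]; trivial
  induction hm using Submodule.span_induction with
  | zero => exact ⟨0, by simp⟩
  | add a b _ _ ha hb =>
    obtain ⟨n, hn⟩ := ha
    obtain ⟨k, hk⟩ := hb
    exact ⟨n + k, by rw [map_add, Module.End.pow_apply_eq_zero_of_le hn (Nat.le_add_right n k),
      Module.End.pow_apply_eq_zero_of_le hk (Nat.le_add_left k n), add_zero]⟩
  | smul c a _ ha =>
    obtain ⟨n, hn⟩ := ha
    exact ⟨n, by rw [map_smul, hn, smul_zero]⟩
  | mem m hm =>
    obtain ⟨p, hm⟩ := hm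
    -- Each application raises the degree by `q`, whereas lower vectors have degree at most zero.
    have hmem : ∀ n : ℕ, (mapEvenEnd g A M x ^ n) m ∈
        Submodule.span ℂ {m | S.IsLower A v (n • q + p) m} := by
      intro n
      induction n with
      | zero => exact Submodule.subset_span (by simpa using hm)
      | succ n ih =>
        rw [pow_succ', Module.End.mul_apply, succ_nsmul', add_assoc]
        generalize (mapEvenEnd g A M x ^ n) m = y at ih ⊢
        induction ih using Submodule.span_induction with
        | zero => rw [map_zero]; exact zero_mem _
        | add a b _ _ ha hb => rw [map_add]; exact add_mem ha hb
        | smul c a _ ha => rw [map_smul]; exact Submodule.smul_mem _ _ ha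
        | mem m hm => exact hm.smul_mem_span hv.nPlus_smul hx x.2 1
    obtain ⟨i, hi⟩ := Function.ne_iff.1 hq0
    have hi' : 0 < q i := lt_of_le_of_ne (hq i) (Ne.symm hi)
    -- Since `q i ≥ 1`, this many steps make the `i`-th coordinate of the degree positive.
    refine ⟨((- p i).toNat + 1), ?_⟩
    have h1 := hmem ((- p i).toNat + 1)
    have h2 : {m | S.IsLower A v (((- p i).toNat + 1) • q + p) m} = ∅ := by
      refine Set.eq_empty_of_forall_notMem fun m hm => ?_
      have h3 := hm.le_zero i
      rw [Pi.add_apply, Pi.smul_apply, nsmul_eq_mul] at h3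
      push_cast at h3
      have h4 := Int.self_le_toNat (-p i)
      change _ ≤ (0 : ℤ) at h3
      nlinarith
    rwa [h2, Submodule.span_empty, Submodule.mem_bot] at h1

/-- A root vector acts locally nilpotently on a module if it acts nilpotently on the generator. -/
theorem isLocallyNilpotent_of_generator [FiniteDimensional ℂ g]
    (hgen : ∀ m : M, ∃ u : Env (g ⊗[ℂ] A), u • v = m) {q : Fin S.rank → ℤ}
    (hq0 : q ≠ 0) {x : part (L := g) 0} (hx : x ∈ S.evenRoot q)
    (hxv : ∃ n, (mapEvenEnd g A M x ^ n) v = 0) :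
    (mapEvenEnd g A M x).IsLocallyNilpotent := by
  set T := mapEvenEnd g A M x with hT
  -- A form of the Leibniz rule: one application of `T` lowers the nilpotency order either of `y`
  -- under `ad x` or of `m` under `T`, so local nilpotency spreads from the generator.
  have key : ∀ n : ℕ, ∀ l k : ℕ, l + k = n → ∀ (y : g) (a : A) (m : M),
      ((br (x : g)) ^ l : Module.End ℂ g) y = 0 → (T ^ k) m = 0 →
      (T ^ n) (Env.ι (g ⊗[ℂ] A) (y ⊗ₜ a) • m) = 0 := by
    intro n
    induction n with
    | zero =>
      intro l k hlk y a m _ hm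
      obtain ⟨rfl, rfl⟩ : l = 0 ∧ k = 0 := by omega
      rw [show m = 0 from hm, smul_zero, map_zero]
    | succ n ih =>
      intro l k hlk y a m hy hm
      have h1 := Env.ι_lie_of_even (tmul_mem_part g x.2 (1 : A)) (y ⊗ₜ[ℂ] a)
      rw [br_tmul, one_mul, eq_sub_iff_add_eq] at h1
      have h2 : T (Env.ι (g ⊗[ℂ] A) (y ⊗ₜ a) • m) = Env.ι (g ⊗[ℂ] A) (br (x : g) y ⊗ₜ a) • m +
          Env.ι (g ⊗[ℂ] A) (y ⊗ₜ a) • T m := by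
        rw [hT, mapEvenEnd_apply, mapEvenEnd_apply, ← mul_smul, ← h1, add_smul, mul_smul]
      rw [pow_succ, Module.End.mul_apply, h2, map_add]
      have e1 : (T ^ n) (Env.ι (g ⊗[ℂ] A) (br (x : g) y ⊗ₜ a) • m) = 0 := by
        rcases l with _ | l
        · rw [show y = 0 from hy]; simp
        · exact ih l k (by omega) _ a m hy hm
      have e2 : (T ^ n) (Env.ι (g ⊗[ℂ] A) (y ⊗ₜ a) • T m) = 0 := by
        rcases k with _ | k
        · rw [show m = 0 from hm]; simp
        · exact ih l k (by omega) y a _ hy hm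
      rw [e1, e2, add_zero]
  intro m
  obtain ⟨u, rfl⟩ := hgen m
  refine Env.smul_induction (S.span_homogeneous_tmul A) (p := fun m => ∃ n, (T ^ n) m = 0) hxv
    ?_ ?_ ?_ u
  · rintro a b ⟨n, hn⟩ ⟨k, hk⟩
    exact ⟨n + k, by rw [map_add, Module.End.pow_apply_eq_zero_of_le hn (Nat.le_add_right n k),
      Module.End.pow_apply_eq_zero_of_le hk (Nat.le_add_left k n), add_zero]⟩
  · rintro c a ⟨n, hn⟩
    exact ⟨n, by rw [map_smul, hn, smul_zero]⟩
  · rintro _ ⟨p, j, y, hy, hj, a, rfl⟩ m ⟨k, hk⟩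
    obtain ⟨l, hl⟩ := S.exists_pow_br_eq_zero hq0 hx y
    exact ⟨l + k, key _ l k rfl y a m hl hk⟩

/-- A module generated by a highest weight vector on which the negatives of the simple even root
vectors act nilpotently is integrable. -/
theorem IsExtremal.isEvenIntegrable [FiniteDimensional ℂ g]
    (hS : LieAlgebra.IsReductiveGrading S.evenRoot S.evenWt) (hv : S.IsExtremal A lam v)
    (hgen : ∀ m : M, ∃ u : Env (g ⊗[ℂ] A), u • v = m)
    (hpow : ∀ α ∈ S.simpleEvenRoots, ∀ x ∈ S.evenRoot (-α),
      ∃ n, (mapEvenEnd g A M x ^ n) v = 0) : IsEvenIntegrable g A M := by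
  let _ := lieRingModuleOfEnd (mapEvenEnd g A M) (mapEvenEnd_lie g)
  have := lieModuleOfEnd (mapEvenEnd g A M) (mapEvenEnd_lie g)
  have hend : ∀ x, LieModule.toEnd ℂ (part (L := g) 0) M x = mapEvenEnd g A M x := fun _ => rfl
  have had : ∀ q, q ≠ 0 → ∀ x ∈ S.evenRoot q,
      (LieModule.toEnd ℂ (part (L := g) 0) (part (L := g) 0) x).IsLocallyNilpotent := by
    intro q hq x hx y
    obtain ⟨n, hn⟩ := S.exists_pow_br_eq_zero hq hx (y : g)
    refine ⟨n, Subtype.ext ?_⟩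
    have h1 : ∀ k, (((LieModule.toEnd ℂ (part (L := g) 0) (part (L := g) 0) x ^ k) y :
        part (L := g) 0) : g) = ((br (x : g)) ^ k : Module.End ℂ g) y := by
      intro k
      induction k with
      | zero => rfl
      | succ k ih =>
        rw [pow_succ', pow_succ', Module.End.mul_apply, Module.End.mul_apply, ← ih]; rfl
    exact (h1 n).trans hn
  -- Only the indecomposable roots are controlled by the relations. As the locally nilpotent
  -- elements span a subalgebra, all negative root spaces follow.
  let N := LieModule.locallyNilpotentSubalgebra ℂ (part (L := g) 0) M
  have hNsub : ∀ x, x ∈ LieModule.locallyNilpotentSet ℂ (part (L := g) 0) M → x ∈ N :=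
    fun x hx => Submodule.subset_span hx
  have hneg : ∀ q, 0 ≤ q → q ≠ 0 → S.evenRoot (-q) ≤ N.toSubmodule := by
    refine hS.neg_le_of_indecomposable N fun q hq hq0 hb hind x hx => hNsub x ⟨?_, ?_⟩
    · exact had _ (neg_ne_zero.2 hq0) x hx
    · exact isLocallyNilpotent_of_generator hgen (neg_ne_zero.2 hq0) hx
        (hpow q (mem_simpleEvenRoots hq hq0 hb hind) x hx)
  have hpos : ∀ q, 0 ≤ q → q ≠ 0 → S.evenRoot q ≤ N.toSubmodule := fun q hq hq0 x hx =>
    hNsub x ⟨had q hq0 x hx, hv.isLocallyNilpotent_of_pos hgen hq hq0 hx⟩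
  have hdiag : ∀ x ∈ S.evenRoot 0, LieModule.IsLocallyFinite ℂ M x := by
    intro x hx m
    have hm : m ∈ Submodule.span ℂ {m : M | ∃ q, S.IsLower A v q m} := by
      rw [hv.span_isLower hgen]; trivial
    induction hm using Submodule.span_induction with
    | zero => exact ⟨⊥, inferInstance, zero_mem _, fun u hu => by
        rw [(Submodule.mem_bot ℂ).1 hu, lie_zero]; exact zero_mem _⟩
    | add a b _ _ ha hb =>
      obtain ⟨F, hF, haF, hst⟩ := ha
      obtain ⟨F', hF', hbF, hst'⟩ := hb
      refine ⟨F ⊔ F', inferInstance, Submodule.add_mem_sup haF hbF, fun u hu => ?_⟩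
      obtain ⟨a, ha, b, hb, rfl⟩ := Submodule.mem_sup.1 hu
      rw [lie_add]
      exact Submodule.add_mem_sup (hst a ha) (hst' b hb)
    | smul c a _ ha =>
      obtain ⟨F, hF, haF, hst⟩ := ha
      exact ⟨F, hF, Submodule.smul_mem _ c haF, hst⟩
    | mem m hm =>
      obtain ⟨q, hm⟩ := hm
      refine ⟨Submodule.span ℂ {m}, inferInstance, Submodule.mem_span_singleton_self m,
        fun u hu => ?_⟩
      obtain ⟨c, rfl⟩ := Submodule.mem_span_singleton.1 hu
      rw [lie_smul]
      refine Submodule.smul_mem _ c ?_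
      rw [show ⁅x, m⁆ = _ from hv.isLower_cartan_smul hm ⟨x, hx⟩]
      exact Submodule.smul_mem _ _ (Submodule.mem_span_singleton_self m)
  let X : Set (part (L := g) 0) :=
    LieModule.locallyNilpotentSet ℂ (part (L := g) 0) M ∪ (S.evenRoot 0 : Set (part (L := g) 0))
  have hX : Submodule.span ℂ X = ⊤ := by
    rw [eq_top_iff]
    intro x _
    refine S.evenRoot_internal.mem_induction (p := fun x => x ∈ Submodule.span ℂ X)
      (fun q x hx => ?_) (fun _ _ h h' => add_mem h h') (zero_mem _) x
    have hNX : N.toSubmodule ≤ Submodule.span ℂ X := Submodule.span_mono Set.subset_union_left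
    by_cases hq : q = 0
    · subst hq
      exact Submodule.subset_span (Or.inr hx)
    by_cases hx0 : x = 0
    · rw [hx0]; exact zero_mem _
    rcases S.evenRoot_nonneg_or ((Submodule.ne_bot_iff _).2 ⟨x, hx, hx0⟩) with h | h
    · exact hNX (hpos q h hq hx)
    · have h1 := hneg (-q) (neg_nonneg.2 h) (neg_ne_zero.2 hq)
      rw [neg_neg] at h1
      exact hNX (h1 hx)
  -- A finite basis of g₀ is extracted from locally nilpotent elements and elements of 𝔥, all of
  -- which act locally finitely.
  obtain ⟨b, hbX, hbspan, hbind⟩ := exists_linearIndependent ℂ X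
  have hbfin : b.Finite := hbind.setFinite
  have hfin : ∀ m : M, ∃ N : LieSubmodule ℂ (part (L := g) 0) M, FiniteDimensional ℂ N ∧ m ∈ N := by
    refine LieModule.exists_finiteDimensional_lieSubmodule hbfin.toFinset.toList ?_ ?_
    · intro x hx
      rw [Finset.mem_toList, Set.Finite.mem_toFinset] at hx
      rcases hbX hx with h | h
      · exact .of_isLocallyNilpotent h.2
      · exact hdiag x h
    · simp only [Finset.mem_toList, Set.Finite.mem_toFinset, Set.ofPred_mem_eq]
      rw [hbspan, hX]
  have := hS.isKilling
  -- The center lies in 𝔥, so the lower vectors, being weight vectors, provide the required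
  -- eigenvectors.
  refine isEvenIntegrable_of_sSup_atoms (LieSubmodule.sSup_atoms_eq_top _ hS.center_sup hfin ?_) hfin
  rw [eq_top_iff, ← hv.span_isLower hgen]
  refine Submodule.span_mono ?_
  rintro m ⟨q, hm⟩
  classical
  refine ⟨fun z => if hz : z ∈ S.evenRoot 0 then lam ⟨z, hz⟩ + S.wt q ⟨z, hz⟩ else 0,
    fun z hz => ?_⟩
  have hz' := hS.center_le hz
  refine (hv.isLower_cartan_smul hm ⟨z, hz'⟩).trans ?_
  beta_reduce
  split_ifs with h
  · rfl
  · exact absurd hz' h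

end

/-! ### Dominant weights -/

/-- A dominant weight is the weight of a highest weight vector in a finite-dimensional module. -/
theorem exists_nat_of_mem_dominantWeights {lam : Module.Dual ℂ S.cartan}
    (hlam : lam ∈ S.dominantWeights) {α : Fin S.rank → ℤ} (hα : 0 ≤ α) (hα0 : α ≠ 0) {e f : g}
    {h : S.cartan} (t : S.IsTriple α e f h) : ∃ n : ℕ, lam h = n := by
  obtain ⟨V, _, _, _, _, G, hfd, -, -, v, -, hv0, hvn, hvh⟩ := hlam
  exact exists_nat_of_primitive (evenEnd g V) (evenEnd_lie g V) (N := ⊤) (fun _ _ _ => trivial)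
    t.isSl2Triple (Submodule.mem_top (x := v)) (hvh h) (hvn e (S.root_le_nPlus hα hα0 t.e_mem.1)) hv0

-- The module V(λ) ⊗ A, on which x ⊗ a acts by x on V(λ) and by multiplication by a, contains v ⊗ 1.
-- This vector is not zero because A ≠ 0, and it satisfies all relations of the generator.
variable (A) in
theorem weylVec_ne_zero [Nontrivial A] {lam : Module.Dual ℂ S.cartan}
    (hlam : lam ∈ S.dominantWeights) : S.weylVec A lam ≠ 0 := by
  obtain ⟨V, _, _, _, _, G, hfd, -, -, v, -, hv0, hvn, hvh⟩ := hlam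
  let φ : g ⊗[ℂ] A →ₗ[ℂ] Module.End ℂ (V ⊗[ℂ] A) := TensorProduct.lift
    ((TensorProduct.mapBilinear (RingHom.id ℂ) V A V A).compl₁₂
      ((Algebra.lsmul ℂ ℂ V : Env g →ₐ[ℂ] Module.End ℂ V).toLinearMap ∘ₗ Env.ι g)
      (LinearMap.mul ℂ A))
  have hφ : ∀ (x : g) (a : A) (u : V) (b : A),
      φ (x ⊗ₜ a) (u ⊗ₜ b) = (Env.ι g x • u) ⊗ₜ (a * b) := fun _ _ _ _ => rfl
  have hrel : ∀ (i j : ZMod 2) (x y : g ⊗[ℂ] A), x ∈ part i → y ∈ part j →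
      φ x * φ y = koszulSign i j • (φ y * φ x) + φ (br x y) := by
    intro i j x y hx hy
    induction hx using Submodule.span_induction with
    | zero => simp
    | add a b _ _ ha hb =>
      simp only [map_add, LinearMap.add_apply, add_mul, mul_add, ha, hb, smul_add]; abel
    | smul c a _ ha =>
      rw [map_smul, smul_mul_assoc, ha, mul_smul_comm, smul_add, smul_comm c, map_smul,
        LinearMap.smul_apply, map_smul]
    | mem x hx =>
      obtain ⟨x, hx, a, rfl⟩ := hx
      induction hy using Submodule.span_induction with
      | zero => simp
      | add a b _ _ ha hb =>
        simp only [map_add, add_mul, mul_add, ha, hb, smul_add]; abel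
      | smul c a _ ha =>
        rw [map_smul, smul_mul_assoc, mul_smul_comm, ha, smul_add, smul_comm c, map_smul, map_smul]
      | mem y hy =>
        obtain ⟨y, hy, b, rfl⟩ := hy
        refine TensorProduct.ext' fun u c => ?_
        rw [br_tmul]
        simp only [LinearMap.add_apply, LinearMap.smul_apply, Module.End.mul_apply, hφ]
        rw [← mul_smul, Env.ι_mul_ι i j x y hx hy, add_smul, TensorProduct.add_tmul, smul_assoc,
          mul_smul, TensorProduct.smul_tmul', ← mul_assoc, ← mul_assoc, mul_comm b a]
  let _ : Module (Env (g ⊗[ℂ] A)) (V ⊗[ℂ] A) := Module.compHom _ (Env.lift φ hrel).toRingHom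
  have hsm : ∀ (u : Env (g ⊗[ℂ] A)) (m : V ⊗[ℂ] A), u • m = Env.lift φ hrel u m := fun _ _ => rfl
  have hι : ∀ (x : g) (a : A) (u : V) (b : A),
      Env.ι (g ⊗[ℂ] A) (x ⊗ₜ a) • (u ⊗ₜ[ℂ] b) = (Env.ι g x • u) ⊗ₜ (a * b) := fun x a u b => by
    rw [hsm, Env.lift_ι, hφ]
  have : IsScalarTower ℂ (Env (g ⊗[ℂ] A)) (V ⊗[ℂ] A) := ⟨fun c u m => by
    rw [hsm, hsm, map_smul, LinearMap.smul_apply]⟩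
  have hn : ∀ x ∈ S.nPlus, ∀ a : A,
      Env.ι (g ⊗[ℂ] A) (x ⊗ₜ a) • (v ⊗ₜ[ℂ] (1 : A)) = 0 := fun x hx a => by
    rw [hι, hvn x hx, TensorProduct.zero_tmul]
  obtain ⟨F, hF⟩ := S.exists_weyl_lift (A := A) lam (v ⊗ₜ[ℂ] (1 : A)) (fun x hx => hn x hx 1)
    (fun h => by rw [hι, hvh, mul_one, TensorProduct.smul_tmul'])
    (by
      intro α hα e f h n t hn'
      have h1 : ∀ k : ℕ, Env.ι (g ⊗[ℂ] A) (f ⊗ₜ 1) ^ k • (v ⊗ₜ[ℂ] (1 : A)) =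
          (Env.ι g f ^ k • v) ⊗ₜ 1 := by
        intro k
        induction k with
        | zero => simp
        | succ k ih => rw [pow_succ', mul_smul, ih, hι, mul_one, pow_succ', mul_smul]
      have h2 : ∀ k : ℕ, (evenEnd g V ⟨f, t.f_mem.2⟩ ^ k) v = Env.ι g f ^ k • v := by
        intro k
        induction k with
        | zero => simp
        | succ k ih => rw [pow_succ', pow_succ', Module.End.mul_apply, ih, mul_smul]; rfl
      have h3 := pow_eq_zero_of_primitive (evenEnd g V) (evenEnd_lie g V) (N := ⊤)
        (fun _ _ _ => trivial) t.isSl2Triple (Submodule.mem_top (x := v)) (hvh h)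
        (hvn e (S.root_le_nPlus hα.1.1 hα.1.2.1 t.e_mem.1)) hn'
      rw [h1, ← h2, h3, TensorProduct.zero_tmul])
    (fun q hq u hu => smul_eq_zero_of_not_le hn hq hu)
  intro h0
  rw [h0, map_zero] at hF
  apply hv0
  -- Contracting v ⊗ 1 with a functional ℓ on V gives ℓ(v) times the unit of A.
  rw [← Module.forall_dual_apply_eq_zero_iff ℂ]
  intro ℓ
  have h1 := congrArg (TensorProduct.lid ℂ A ∘ LinearMap.rTensor A ℓ) hF
  simp only [Function.comp_apply, map_zero, LinearMap.rTensor_tmul, TensorProduct.lid_tmul] at h1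
  exact (smul_eq_zero.1 h1.symm).resolve_right one_ne_zero

-- Dominance makes λ(H_α) a natural number, so the relation for α is really among the relations
-- imposed. Since the root space of −α is a line, the relation controls every element of it.
variable (A) in
theorem isEvenIntegrable_weyl [FiniteDimensional ℂ g]
    (hS : LieAlgebra.IsReductiveGrading S.evenRoot S.evenWt) {lam : Module.Dual ℂ S.cartan}
    (hlam : lam ∈ S.dominantWeights) : IsEvenIntegrable g A (S.Weyl A lam) := by
  refine (S.isExtremal_weylVec A lam).isEvenIntegrable hS (S.exists_smul_weylVec A lam)
    fun α hα x hx => ?_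
  have hb : S.evenRoot α ≠ ⊥ := by
    obtain ⟨y, hy, hy0⟩ := (Submodule.ne_bot_iff _).1 hα.1.2.2
    exact (Submodule.ne_bot_iff _).2 ⟨⟨y, hy.2⟩, hy.1, fun h => hy0 (congrArg Subtype.val h)⟩
  obtain ⟨e, f, h, t, hf⟩ := exists_isTriple hS hα.1.2.1 hb
  obtain ⟨n, hn⟩ := exists_nat_of_mem_dominantWeights hlam hα.1.1 hα.1.2.1 t
  obtain ⟨c, hc⟩ := hf x hx
  refine ⟨n + 1, ?_⟩
  have hpow : ∀ k, (mapEvenEnd g A (S.Weyl A lam) x ^ k) (S.weylVec A lam) =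
      c ^ k • (Env.ι (g ⊗[ℂ] A) (f ⊗ₜ 1) ^ k • S.weylVec A lam) := by
    intro k
    induction k with
    | zero => simp
    | succ k ih =>
      rw [pow_succ', Module.End.mul_apply, ih, map_smul, mapEvenEnd_apply, hc, ι_smul_tmul,
        smul_assoc, smul_smul, ← mul_smul, ← pow_succ, ← pow_succ']
  rw [hpow, S.pow_smul_weylVec A lam hα t hn, smul_zero]

end SimpleRoots

end LieSuperalgebra

end

section

open scoped TensorProduct
open LieSuperalgebra Module

/-! ### Highest weight objects and surjective endomorphisms of W(λ). -/

namespace LieSuperalgebra.SimpleRoots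

variable {g : Type*} [AddCommGroup g] [Module ℂ g] [LieSuperalgebra g] {S : SimpleRoots g}
  {A : Type*} [CommRing A] [Algebra ℂ A] {lam : Module.Dual ℂ S.cartan}

/-- In an integrable module, every highest weight vector is the image of the generator of the
global Weyl module. -/
theorem IsExtremal.exists_hom {M : Type*} [AddCommGroup M] [Module ℂ M]
    [Module (Env (g ⊗[ℂ] A)) M] [IsScalarTower ℂ (Env (g ⊗[ℂ] A)) M]
    (hM : IsEvenIntegrable g A M) {v : M} (hv : S.IsExtremal A lam v) :
    ∃ F : S.Weyl A lam →ₗ[Env (g ⊗[ℂ] A)] M, F (S.weylVec A lam) = v :=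
  S.exists_weyl_lift lam v (fun x hx => hv.nPlus_smul x hx 1) hv.cartan_smul
    (fun _ hα _ _ _ _ t hn => hv.pow_smul_eq_zero hM hα t hn)
    fun _ hq _ hu => smul_eq_zero_of_not_le hv.nPlus_smul hq hu

theorem isHighestWeightObject_weyl [FiniteDimensional ℂ g] [Nontrivial A]
    (hS : LieAlgebra.IsReductiveGrading S.evenRoot S.evenWt) (hlam : lam ∈ S.dominantWeights) :
    IsHighestWeightObject S (A := A) lam (S.weylGrading A lam) where
  grading := S.isSuperGrading_weylGrading A lam
  integrable := isEvenIntegrable_weyl A hS hlam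
  generated := ⟨S.weylVec A lam, ⟨0, Env.self_mem_orbit _⟩,
    ⟨weylVec_ne_zero A hlam, (S.isExtremal_weylVec A lam).nPlus_smul,
      (S.isExtremal_weylVec A lam).cartan_smul⟩, S.span_weylVec A lam⟩

/-- The global Weyl module maps onto every highest weight object. -/
theorem exists_surjective_of_isHighestWeightObject {M : Type*} [AddCommGroup M] [Module ℂ M]
    [Module (Env (g ⊗[ℂ] A)) M] [IsScalarTower ℂ (Env (g ⊗[ℂ] A)) M] {G : ZMod 2 → Submodule ℂ M}
    (hG : IsHighestWeightObject S (A := A) lam G) :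
    ∃ f : S.Weyl A lam →ₗ[Env (g ⊗[ℂ] A)] M,
      IsHomogeneousMap (S.weylGrading A lam) G f ∧ Function.Surjective f := by
  obtain ⟨v, ⟨d, hd⟩, ⟨-, hn, hc⟩, hspan⟩ := hG.generated
  obtain ⟨f, hf⟩ := IsExtremal.exists_hom hG.integrable (lam := lam) ⟨hn, hc⟩
  refine ⟨f, ⟨d, Env.orbit_induction (γ := part (L := g ⊗[ℂ] A))
    (N := fun i => (G (i + d)).comap (f.restrictScalars ℂ)) ?_ ?_⟩, ?_⟩
  · change f _ ∈ G (0 + d)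
    rwa [hf, zero_add]
  · intro i j x hx m hm
    change f _ ∈ G (i + j + d)
    rw [map_smul, add_assoc]
    exact hG.grading.smul_mem i _ x _ hx hm
  · rw [← LinearMap.range_eq_top, eq_top_iff, ← hspan, Submodule.span_le,
      Set.singleton_subset_iff]
    exact ⟨_, hf⟩

/-! ### The grading of the global Weyl module by heights -/

variable (S A lam) in
/-- The eigenspaces of the operator given by the heights of roots. -/
theorem exists_height_grading : ∃ E : ℤ → Submodule ℂ (S.Weyl A lam), DirectSum.IsInternal E ∧
    S.weylVec A lam ∈ E 0 ∧ ∀ q j, ∀ x ∈ S.root q, x ∈ part (L := g) j → ∀ (a : A) (k : ℤ),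
      ∀ m ∈ E k, Env.ι (g ⊗[ℂ] A) (x ⊗ₜ a) • m ∈ E (∑ i, q i + k) := by
  -- As 2 is not a root of unity, different heights give different eigenvalues. This separates
  -- degrees even where the simple roots are dependent on 𝔥.
  obtain ⟨F, hF, hFx⟩ := S.exists_weyl_operator A lam (fun q _ => (2 : ℂ) ^ (∑ i, q i)) (by simp)
    (fun q _ q' _ => by
      simp only [Pi.add_apply, Finset.sum_add_distrib]
      rw [zpow_add₀ two_ne_zero])
  let E : ℤ → Submodule ℂ (S.Weyl A lam) := fun k => End.eigenspace F ((2 : ℂ) ^ k)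
  have hw : S.weylVec A lam ∈ E 0 := End.mem_eigenspace_iff.2 (by rw [hF, zpow_zero, one_smul])
  have hE : ∀ q j, ∀ x ∈ S.root q, x ∈ part (L := g) j → ∀ (a : A) (k : ℤ),
      ∀ m ∈ E k, Env.ι (g ⊗[ℂ] A) (x ⊗ₜ a) • m ∈ E (∑ i, q i + k) := by
    intro q j x hx hj a k m hm
    refine End.mem_eigenspace_iff.2 ?_
    rw [hFx q j x hx hj, End.mem_eigenspace_iff.1 hm, smul_comm (Env.ι (g ⊗[ℂ] A) (x ⊗ₜ[ℂ] a)),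
      smul_smul, zpow_add₀ two_ne_zero]
  refine ⟨E, ?_, hw, hE⟩
  have hinj : Function.Injective fun k : ℤ => (2 : ℂ) ^ k := by
    intro k l hkl
    have h1 := congrArg norm hkl
    simp only [norm_zpow, Complex.norm_ofNat] at h1
    exact zpow_right_injective₀ two_pos (by norm_num) h1
  refine DirectSum.isInternal_submodule_of_iSupIndep_of_iSup_eq_top
    ((End.eigenspaces_iSupIndep F).comp hinj) (eq_top_iff.2 fun m _ => ?_)
  refine S.weyl_induction A lam (p := fun m => m ∈ ⨆ k, E k) (Submodule.mem_iSup_of_mem 0 hw)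
    (fun _ _ h h' => add_mem h h') (fun c _ h => Submodule.smul_mem _ c h) ?_ m
  intro q j x hx hj a m hm
  refine Submodule.iSup_induction E (motive := fun m => Env.ι (g ⊗[ℂ] A) (x ⊗ₜ a) • m ∈ ⨆ k, E k)
    hm (fun k m hm => Submodule.mem_iSup_of_mem _ (hE q j x hx hj a k m hm)) ?_
    fun m m' h h' => ?_
  · rw [smul_zero]; exact zero_mem _
  · rw [smul_add]; exact add_mem h h'

section

variable {E : ℤ → Submodule ℂ (S.Weyl A lam)} (hint : DirectSum.IsInternal E)
  (hw : S.weylVec A lam ∈ E 0)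
  (hE : ∀ q j, ∀ x ∈ S.root q, x ∈ part (L := g) j → ∀ (a : A) (k : ℤ),
      ∀ m ∈ E k, Env.ι (g ⊗[ℂ] A) (x ⊗ₜ a) • m ∈ E (∑ i, q i + k))

include hw hE in
theorem IsLower.mem_height {q : Fin S.rank → ℤ} {m : S.Weyl A lam}
    (h : S.IsLower A (S.weylVec A lam) q m) : m ∈ E (∑ i, q i) := by
  induction h with
  | base => simpa using hw
  | cons a hx hj _ _ ih =>
    simp only [Pi.add_apply, Finset.sum_add_distrib]
    exact hE _ _ _ hx hj a _ _ ih

include hw hE in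
theorem proj_eq_zero_of_pos {k : ℤ} (hk : 0 < k) (m : S.Weyl A lam) : hint.proj k m = 0 := by
  have hm : m ∈ Submodule.span ℂ {m | ∃ q, S.IsLower A (S.weylVec A lam) q m} := by
    rw [(S.isExtremal_weylVec A lam).span_isLower (S.exists_smul_weylVec A lam)]; trivial
  induction hm using Submodule.span_induction with
  | mem m hm =>
    obtain ⟨q, hm⟩ := hm
    have h1 : ∑ i, q i ≤ 0 := Finset.sum_nonpos fun i _ => hm.le_zero i
    exact hint.proj_apply_of_ne (by omega) (hm.mem_height hw hE)
  | zero => exact map_zero _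
  | add a b _ _ ha hb => rw [map_add, ha, hb, add_zero]
  | smul c a _ ha => rw [map_smul, ha, smul_zero]

-- A degree that is at most zero and has height zero is itself zero, so only products of elements of
-- 𝔥 ⊗ A contribute to this part.
include hint hw hE in
theorem exists_mem_cartanAlg_of_mem_height {m : S.Weyl A lam} (hm : m ∈ E 0) :
    ∃ u ∈ S.cartanAlg A, m = u • S.weylVec A lam := by
  rw [← hint.proj_apply_of_mem hm]
  have hm' : m ∈ Submodule.span ℂ {m | ∃ q, S.IsLower A (S.weylVec A lam) q m} := by
    rw [(S.isExtremal_weylVec A lam).span_isLower (S.exists_smul_weylVec A lam)]; trivial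
  clear hm
  induction hm' using Submodule.span_induction with
  | mem m hm =>
    obtain ⟨q, hm⟩ := hm
    by_cases hq : ∑ i, q i = 0
    · rw [hint.proj_apply_of_mem (hq ▸ hm.mem_height hw hE)]
      refine hm.exists_mem_cartanAlg (funext fun i => ?_)
      exact (Finset.sum_eq_zero_iff_of_nonpos fun i _ => hm.le_zero i).1 hq i (Finset.mem_univ i)
    · rw [hint.proj_apply_of_ne (Ne.symm hq) (hm.mem_height hw hE)]
      exact ⟨0, zero_mem _, (zero_smul _ _).symm⟩
  | zero => exact ⟨0, zero_mem _, by rw [map_zero, zero_smul]⟩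
  | add a b _ _ ha hb =>
    obtain ⟨u, hu, ha⟩ := ha
    obtain ⟨u', hu', hb⟩ := hb
    exact ⟨u + u', add_mem hu hu', by rw [map_add, ha, hb, add_smul]⟩
  | smul c a _ ha =>
    obtain ⟨u, hu, ha⟩ := ha
    exact ⟨c • u, Subalgebra.smul_mem _ hu c, by rw [map_smul, ha, smul_assoc]⟩

include hE in
theorem proj_ι_smul {q : Fin S.rank → ℤ} {j : ZMod 2} {x : g} (hx : x ∈ S.root q)
    (hj : x ∈ part (L := g) j) (a : A) (k : ℤ) (m : S.Weyl A lam) :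
    hint.proj (∑ i, q i + k) (Env.ι (g ⊗[ℂ] A) (x ⊗ₜ a) • m) =
      Env.ι (g ⊗[ℂ] A) (x ⊗ₜ a) • hint.proj k m := by
  refine hint.mem_induction (p := fun m => hint.proj (∑ i, q i + k)
    (Env.ι (g ⊗[ℂ] A) (x ⊗ₜ a) • m) = Env.ι (g ⊗[ℂ] A) (x ⊗ₜ a) • hint.proj k m)
    (fun l m hm => ?_) (fun m m' h h' => by rw [smul_add, map_add, map_add, smul_add, h, h'])
    (by simp) m
  have h1 := hE q j x hx hj a l m hm
  by_cases hkl : k = l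
  · subst hkl
    rw [hint.proj_apply_of_mem hm, hint.proj_apply_of_mem h1]
  · rw [hint.proj_apply_of_ne hkl hm, hint.proj_apply_of_ne (by omega) h1, smul_zero]

-- Homogeneous elements shift heights by fixed amounts, so the linear conditions on an extremal
-- vector hold for each of its height components.
include hE in
theorem IsExtremal.proj {m : S.Weyl A lam} (hm : S.IsExtremal A lam m) (k : ℤ) :
    S.IsExtremal A lam (hint.proj k m) where
  nPlus_smul x hx a := by
    have key : ∀ q j, 0 ≤ q → q ≠ 0 → ∀ x ∈ S.root q, x ∈ part (L := g) j →
        Env.ι (g ⊗[ℂ] A) (x ⊗ₜ a) • hint.proj k m = 0 := by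
      intro q j hq hq0 x hx hj
      rw [← proj_ι_smul hint hE hx hj, hm.nPlus_smul x (S.root_le_nPlus hq hq0 hx), map_zero]
    replace hx := S.nPlus_le hx
    induction hx using Submodule.span_induction with
    | mem x hx =>
      obtain ⟨q, hq, hq0, hx⟩ := hx
      obtain ⟨y, hy, z, hz, rfl⟩ := Submodule.mem_sup.1 (S.root_le_inf_part q hx)
      rw [TensorProduct.add_tmul, map_add, add_smul, key q 0 hq hq0 y hy.1 hy.2,
        key q 1 hq hq0 z hz.1 hz.2, add_zero]
    | zero => simp
    | add x y _ _ h h' => rw [TensorProduct.add_tmul, map_add, add_smul, h, h', add_zero]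
    | smul c x _ h => rw [ι_smul_tmul, smul_assoc, h, smul_zero]
  cartan_smul h := by
    have h1 := proj_ι_smul hint hE h.2 (S.cartan_even h.2) (1 : A) k m
    rw [hm.cartan_smul, map_smul] at h1
    simpa using h1.symm

-- Positive root vectors would raise such a vector above the top height. Its 𝔥-weight is λ because
-- it arises from the generator by operators commuting with 𝔥.
include hint hw hE in
theorem isExtremal_of_mem_height {m : S.Weyl A lam} (hm : m ∈ E 0) : S.IsExtremal A lam m := by
  have hext := S.isExtremal_weylVec A lam
  have key : ∀ q j, 0 ≤ q → q ≠ 0 → ∀ x ∈ S.root q, x ∈ part (L := g) j → ∀ a : A,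
      Env.ι (g ⊗[ℂ] A) (x ⊗ₜ a) • m = 0 := by
    intro q j hq hq0 x hx hj a
    have h1 := proj_ι_smul hint hE hx hj a 0 m
    rw [hint.proj_apply_of_mem hm] at h1
    rw [← h1]
    refine proj_eq_zero_of_pos hint hw hE ?_ _
    rw [add_zero]
    refine lt_of_le_of_ne (Finset.sum_nonneg fun i _ => hq i) fun h0 => hq0 (funext fun i => ?_)
    exact (Finset.sum_eq_zero_iff_of_nonneg fun i _ => hq i).1 h0.symm i (Finset.mem_univ i)
  refine ⟨fun x hx a => ?_, fun h => ?_⟩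
  · replace hx := S.nPlus_le hx
    induction hx using Submodule.span_induction with
    | mem x hx =>
      obtain ⟨q, hq, hq0, hx⟩ := hx
      obtain ⟨y, hy, z, hz, rfl⟩ := Submodule.mem_sup.1 (S.root_le_inf_part q hx)
      rw [TensorProduct.add_tmul, map_add, add_smul, key q 0 hq hq0 y hy.1 hy.2,
        key q 1 hq hq0 z hz.1 hz.2, add_zero]
    | zero => simp
    | add x y _ _ h h' => rw [TensorProduct.add_tmul, map_add, add_smul, h, h', add_zero]
    | smul c x _ h => rw [ι_smul_tmul, smul_assoc, h, smul_zero]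
  · obtain ⟨u, hu, rfl⟩ := exists_mem_cartanAlg_of_mem_height hint hw hE hm
    have hh : Env.ι (g ⊗[ℂ] A) ((h : g) ⊗ₜ 1) ∈ S.cartanAlg A :=
      Algebra.subset_adjoin ⟨(h : g), h.2, 1, rfl⟩
    rw [← mul_smul, commute_of_mem_cartanAlg hh hu, mul_smul, hext.cartan_smul, smul_comm]

include hw hE in
/-- An endomorphism moving the generator to height `j` shifts heights by `j`. -/
theorem proj_endomorphism {C : S.Weyl A lam →ₗ[Env (g ⊗[ℂ] A)] S.Weyl A lam} {j : ℤ}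
    (hC : C (S.weylVec A lam) ∈ E j) (m : S.Weyl A lam) (k : ℤ) :
    hint.proj (k + j) (C m) = C (hint.proj k m) := by
  revert k
  refine S.weyl_induction A lam (p := fun m => ∀ k, hint.proj (k + j) (C m) = C (hint.proj k m))
    (fun k => ?_) (fun m m' h h' k => ?_) (fun c m h k => ?_) (fun q i x hx hi a m h k => ?_) m
  · by_cases hk : k = 0
    · subst hk
      rw [zero_add, hint.proj_apply_of_mem hC, hint.proj_apply_of_mem hw]
    · rw [hint.proj_apply_of_ne (by omega) hC, hint.proj_apply_of_ne hk hw, map_zero]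
  · rw [map_add, map_add, map_add, map_add, h, h']
  · have h1 : ∀ m, C (c • m) = c • C m := (C.restrictScalars ℂ).map_smul c
    rw [h1, map_smul, map_smul, h1, h]
  · have e1 := proj_ι_smul hint hE hx hi a (k - ∑ i, q i) m
    have e2 := proj_ι_smul hint hE hx hi a (k + j - ∑ i, q i) (C m)
    rw [add_sub_cancel] at e1 e2
    rw [map_smul, e1, e2, map_smul, ← h, sub_add_eq_add_sub]

end

/-- Surjective endomorphisms of an integrable global Weyl module are injective. -/
theorem injective_of_surjective_endomorphism (hM : IsEvenIntegrable g A (S.Weyl A lam))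
    {φ : S.Weyl A lam →ₗ[Env (g ⊗[ℂ] A)] S.Weyl A lam} (hφ : Function.Surjective φ) :
    Function.Injective φ := by
  obtain ⟨E, hint, hw, hE⟩ := S.exists_height_grading A lam
  set w := S.weylVec A lam with hwdef
  have hext : S.IsExtremal A lam (φ w) := by
    refine ⟨fun x hx a => ?_, fun h => ?_⟩
    · rw [← map_smul, (S.isExtremal_weylVec A lam).nPlus_smul x hx, map_zero]
    · rw [← map_smul, (S.isExtremal_weylVec A lam).cartan_smul]
      exact (φ.restrictScalars ℂ).map_smul _ _
  -- The height components of φ(w) are again images of the generator, which splits `φ` into a sum of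
  -- endomorphisms `C j`, each shifting heights by `j`.
  choose C hC using fun j => IsExtremal.exists_hom hM (hext.proj hint hE j)
  obtain ⟨s, hs⟩ := hint.exists_eq_sum_proj (φ w)
  have hφC : φ = ∑ j ∈ s, C j := by
    refine S.weyl_hom_ext ?_
    rw [← hwdef, hs, LinearMap.sum_apply]
    exact Finset.sum_congr rfl fun j _ => (hC j).symm
  have hshift : ∀ j m k, hint.proj (k + j) (C j m) = C j (hint.proj k m) := fun j m k =>
    proj_endomorphism hint hw hE (by rw [hC]; exact hint.proj_mem j _) m k
  have hCzero : ∀ j, hint.proj j (φ w) = 0 → C j = 0 := fun j hj =>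
    S.weyl_hom_ext (by rw [hC, hj, LinearMap.zero_apply])
  -- `C j` vanishes for `j > 0`, since no positive heights occur, and lowers heights for `j < 0`. So
  -- the top component of `φ m` depends only on that of `m`, through `C 0`.
  have hlead : ∀ k m, (∀ l, k < l → hint.proj l m = 0) →
      hint.proj k (φ m) = C 0 (hint.proj k m) := by
    intro k m hm
    have e1 : ∀ j, hint.proj k (C j m) = C j (hint.proj (k - j) m) := fun j => by
      have := hshift j m (k - j)
      rwa [sub_add_cancel] at this
    rw [hφC, LinearMap.sum_apply, map_sum, Finset.sum_eq_single 0]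
    · rw [e1, sub_zero]
    · intro j _ hj
      rw [e1]
      rcases lt_or_gt_of_ne hj with h | h
      · rw [hm _ (by omega), map_zero]
      · rw [hCzero j (proj_eq_zero_of_pos hint hw hE h _), LinearMap.zero_apply]
    · intro h0
      rw [hCzero 0, LinearMap.zero_apply, map_zero]
      rw [hs, map_sum]
      refine Finset.sum_eq_zero fun i hi => hint.proj_apply_of_ne ?_ (hint.proj_mem i _)
      rintro rfl
      exact h0 hi
  obtain ⟨m₀, hm₀⟩ := hφ w
  have hv₀ : C 0 (hint.proj 0 m₀) = w := by
    rw [← hlead 0 m₀ fun l hl => proj_eq_zero_of_pos hint hw hE hl _, hm₀,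
      hint.proj_apply_of_mem hw]
  -- A preimage of the generator under `φ` gives one under `C 0` in height zero. Sending the
  -- generator there defines `D`. On the generator `C 0` and `D` are multiplications by `u'` and
  -- `u`, and since these commute, `D` is a left inverse of `C 0`.
  obtain ⟨D, hD⟩ := IsExtremal.exists_hom hM
    (isExtremal_of_mem_height hint hw hE (hint.proj_mem 0 m₀))
  have hDC : D ∘ₗ C 0 = LinearMap.id := by
    refine S.weyl_hom_ext ?_
    obtain ⟨u, hu, e1⟩ := exists_mem_cartanAlg_of_mem_height hint hw hE (hint.proj_mem 0 m₀)
    obtain ⟨u', hu', e2⟩ := exists_mem_cartanAlg_of_mem_height hint hw hE (hint.proj_mem 0 (φ w))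
    rw [LinearMap.comp_apply, hC, e2, map_smul, hD, e1, ← mul_smul, commute_of_mem_cartanAlg hu' hu,
      mul_smul, ← e2, ← hC, ← map_smul, ← e1, hv₀, LinearMap.id_apply]
  have hC0 : Function.Injective (C 0) := fun a b hab => by
    have := congrArg D hab
    rwa [← LinearMap.comp_apply, ← LinearMap.comp_apply, hDC] at this
  rw [injective_iff_map_eq_zero]
  intro m hm
  -- Descend from height zero: once the higher components of an element of the kernel vanish,
  -- `hlead` and injectivity of `C 0` kill the next one.
  have key : ∀ n : ℕ, hint.proj (-n) m = 0 := by
    intro n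
    induction n using Nat.strong_induction_on with
    | h n ih =>
      refine hC0 ?_
      rw [map_zero, ← hlead, hm, map_zero]
      intro l hl
      rcases lt_or_ge 0 l with h | h
      · exact proj_eq_zero_of_pos hint hw hE h _
      · have := ih (-l).toNat (by omega)
        rwa [Int.toNat_of_nonneg (by omega), neg_neg] at this
  refine hint.eq_zero_of_proj fun k => ?_
  rcases lt_or_ge 0 k with h | h
  · exact proj_eq_zero_of_pos hint hw hE h _
  · have := key (-k).toNat
    rwa [Int.toNat_of_nonneg (by omega), neg_neg] at this

end LieSuperalgebra.SimpleRoots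

namespace LieSuperalgebra

/-- A component of the preimage with the wrong parity would have its image in both homogeneous parts
of the target, so it is zero. The shift `d` is its own inverse modulo 2. -/
theorem IsHomogeneousMap.symm {R M N : Type*} [Ring R] [AddCommGroup M] [Module ℂ M] [Module R M]
    [AddCommGroup N] [Module ℂ N] [Module R N] {G : ZMod 2 → Submodule ℂ M}
    {H : ZMod 2 → Submodule ℂ N} (hG : IsCompl (G 0) (G 1)) (hH : IsCompl (H 0) (H 1))
    {f : M ≃ₗ[R] N} (hf : IsHomogeneousMap G H f) : IsHomogeneousMap H G f.symm := by
  obtain ⟨d, hd⟩ := hf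
  have hdisj : ∀ i, Disjoint (H i) (H (i + 1)) := by
    intro i
    obtain rfl | rfl := zmod_two_cases i
    · exact hH.disjoint
    · exact hH.disjoint.symm
  have hsup : ∀ i, G i ⊔ G (i + 1) = ⊤ := by
    intro i
    obtain rfl | rfl := zmod_two_cases i
    · exact hG.sup_eq_top
    · exact sup_comm (G 0) (G 1) ▸ hG.sup_eq_top
  refine ⟨d, fun i m hm => ?_⟩
  obtain ⟨y, hy, z, hz, hyz⟩ := Submodule.mem_sup.1
    (show f.symm m ∈ G (i + d) ⊔ G (i + d + 1) by rw [hsup]; trivial)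
  have hdd : d + d = 0 := by obtain rfl | rfl := zmod_two_cases d <;> rfl
  have h1 := hd _ y hy
  have h2 := hd _ z hz
  rw [add_assoc, hdd, add_zero] at h1
  rw [show i + d + 1 + d = i + 1 by rw [add_right_comm, add_assoc i, hdd, add_zero]] at h2
  have h3 : m = f y + f z := by rw [← map_add, hyz, LinearEquiv.apply_symm_apply]
  have h4 : f z = 0 := by
    refine Submodule.disjoint_def.1 (hdisj i) _ ?_ h2
    rw [eq_sub_of_add_eq' h3.symm]
    exact sub_mem hm h1
  rw [← hyz, f.map_eq_zero_iff.1 h4, add_zero]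
  exact hy

end LieSuperalgebra

end

theorem proposition3p5 {g : Type u} [AddCommGroup g] [Module ℂ g] [LieSuperalgebra g]
    (hg : IsBasic g ∨ ∃ n : ℕ, 2 ≤ n ∧ IsSl g n) (S : SimpleRoots g)
    {A : Type v} [CommRing A] [Nontrivial A] [Algebra ℂ A]
    (lam : Module.Dual ℂ S.cartan) (hlam : lam ∈ S.dominantWeights) :
    IsHighestWeightObject S (A := A) lam (S.weylGrading A lam) ∧
    (∀ (M : Type w) [AddCommGroup M] [Module ℂ M] [Module (Env (g ⊗[ℂ] A)) M]
      [IsScalarTower ℂ (Env (g ⊗[ℂ] A)) M] (G : ZMod 2 → Submodule ℂ M),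
      IsHighestWeightObject S (A := A) lam G →
        ∃ f : S.Weyl A lam →ₗ[Env (g ⊗[ℂ] A)] M,
          IsHomogeneousMap (S.weylGrading A lam) G f ∧ Function.Surjective f) ∧
    (∀ (W : Type w) [AddCommGroup W] [Module ℂ W] [Module (Env (g ⊗[ℂ] A)) W]
      [IsScalarTower ℂ (Env (g ⊗[ℂ] A)) W] (H : ZMod 2 → Submodule ℂ W),
      IsHighestWeightObject S (A := A) lam H →
      (∀ (M : Type (max u v)) [AddCommGroup M] [Module ℂ M] [Module (Env (g ⊗[ℂ] A)) M]
        [IsScalarTower ℂ (Env (g ⊗[ℂ] A)) M] (G : ZMod 2 → Submodule ℂ M),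
        IsHighestWeightObject S (A := A) lam G →
          ∃ f : W →ₗ[Env (g ⊗[ℂ] A)] M, IsHomogeneousMap H G f ∧ Function.Surjective f) →
      ∃ e : W ≃ₗ[Env (g ⊗[ℂ] A)] S.Weyl A lam, IsHomogeneousMap H (S.weylGrading A lam) e) := by
  have := SimpleRoots.finiteDimensional_of hg
  have hS := SimpleRoots.isReductiveGrading_of hg S
  have hweyl := SimpleRoots.isHighestWeightObject_weyl (A := A) hS hlam
  refine ⟨hweyl, fun M _ _ _ _ G hG => SimpleRoots.exists_surjective_of_isHighestWeightObject hG,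
    fun W _ _ _ _ H hH huniv => ?_⟩
  obtain ⟨f, hf, hfs⟩ := SimpleRoots.exists_surjective_of_isHighestWeightObject hH
  obtain ⟨f', -, hfs'⟩ := huniv _ _ hweyl
  -- The composite of the two surjections is a surjective endomorphism of W(λ), hence injective, and
  -- so `f` is injective as well.
  have hinj : Function.Injective f := Function.Injective.of_comp (f := f')
    (SimpleRoots.injective_of_surjective_endomorphism hweyl.integrable (φ := f' ∘ₗ f)
      (hfs'.comp hfs))
  exact ⟨(LinearEquiv.ofBijective f ⟨hinj, hfs⟩).symm,
    IsHomogeneousMap.symm hweyl.grading.isCompl hH.grading.isCompl hf⟩
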